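/- **Definitions.** A *nice diagram* with nodes $1,\dots,n$ is a finite directed acyclic graph whose arrows $i\xrightarrow{j}k$ are labelled by nodes, such that: there is at most one arrow from $i$ to $k$; two distinct arrows with the same source, or with the same target, have distinct labels; if $i\xrightarrow{j}k$ is an arrow, then $i\neq j$ and $j\xrightarrow{i}k$ is an arrow; and for pairwise distinct nodes $i,j,k$ and any node $l$ it never happens that exactly one of $\{\{i,j\},k\}\to l$, $\{\{j,k\},i\}\to l$, $\{\{k,i\},j\}\to l$ holds, where $\{\{i,j\},k\}\to l$ means that $i\xrightarrow{j}h\xrightarrow{k}l$ for some node $h$. Its *root matrix* $M_\Delta$ has one row $I$ for each pair of arrows $i\xrightarrow{j}k$, $j\xrightarrow{i}k$, with entry $-1$ in columns $i$ and $j$, $1$ in column $k$ and $0$ elsewhere. A real Lie algebra with a basis $e_1,\dots,e_n$ and brackets $[e_i,e_j]=\sum_k c_{ijk}e_k$ has *diagram* $\Delta$ if $c_{ijk}\neq0$ exactly when $i\xrightarrow{j}k$ is an arrow of $\Delta$; for the row $I$ above write $c_I=c_{ijk}$. A *nondiagonal triple* $(\mathcal A,A,D)$ on $\Delta$ consists of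 a nonempty set $\mathcal A$ of pairs of nodes, a function $A:\mathcal A\to\mathbb R\setminus\{0\}$, $(i,j)\mapsto A^i_j$, and a linear map $D=\sum_i\lambda_i\,e^i\otimes e_i+\sum_{(i,j)\in\mathcal A}a_{ji}\,e^i\otimes e_j$ of $\mathbb R^n$ (where $e^i\otimes e_j$ maps $e_i$ to $e_j$), such that: $i\ne j$ for $(i,j)\in\mathcal A$; for distinct $(i,j),(i',j')\in\mathcal A$ the nodes $i,j,i',j'$ are pairwise distinct; for $(i,j)\in\mathcal A$ there is no arrow from $i$ to $j$; for all $\mu\in\ker M_\Delta$ $$\sum_i\lambda_i\mu_i=\Bigl(1+\sum_{(i,j)\in\mathcal A}A^i_j\Bigr)\sum_i\mu_i+\sum_{(i,j)\in\mathcal A}A^i_j(\mu_j-\mu_i);$$ $\operatorname{Tr}D=\lambda_i-\lambda_j$ for $(i,j)\in\mathcal A$; $a_{ji}^2=|2A^i_j\operatorname{Tr}D|\ne0$ for $(i,j)\in\mathcal A$; and $(\lambda_1,\dots,\lambda_n)\in\ker M_\Delta$. A *solution arising from a nondiagonal triple* $(\mathcal A,A,D)$ on $\Delta$ is a triple $(\mathfrak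 g,D,\epsilon)$, where $\mathfrak g$ is a Lie algebra with basis $e_1,\dots,e_n$ and diagram $\Delta$, $D$ is a derivation of $\mathfrak g$, $\epsilon\in\{\pm1\}^n$, and there is a vector $X=(x_I)$ with $c_I^2=|x_I|$ for all $I$, $$\frac1{2\operatorname{Tr}D}\,{}^tM_\Delta X=-\Bigl(1+\sum_{(i,j)\in\mathcal A}A^i_j\Bigr)(1,\dots,1)+\sum_{(i,j)\in\mathcal A}A^i_j(e_i-e_j)+(\lambda_1,\dots,\lambda_n),$$ $\operatorname{sign}x_I=\epsilon_i\epsilon_j\epsilon_k$ for the row $I$ of $i\xrightarrow{j}k$ (that is, $M_\Delta\bmod 2$ maps the log signs of $\epsilon$ to those of $X$), and $\epsilon_i/\epsilon_j=\operatorname{sign}(A^i_j\operatorname{Tr}D)$ for $(i,j)\in\mathcal A$. The metric on $\mathfrak g$ is $g=\sum_i\epsilon_i\,e^i\otimes e^i$. Two such solutions $(\mathfrak g,D,\epsilon)$, $(\mathfrak g',D',\epsilon')$ are *equivalent* if there is a Lie algebra isomorphism $\mathfrak g\to\mathfrak g'$ that maps each basis vector to a nonzero multiple of a basis vector, maps $g$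 to $g'$ and intertwines $D$ and $D'$. A *standard decomposition* of a Lie algebra with a metric (a nondegenerate symmetric bilinear form) is an orthogonal decomposition into a nilpotent ideal and an abelian subalgebra $\mathfrak a$; it is *of pseudo-Iwasawa type* if $\operatorname{ad}x$ is symmetric for all $x\in\mathfrak a$. **Tables.** Each row lists $\mathfrak g$ in the form $(de^1,\dots,de^n)$, with $e^{ij}=e^i\wedge e^j$ and $de^k(e_i,e_j)=-e^k([e_i,e_j])$; then $D$, as the vector of its diagonal entries plus its off-diagonal part; then a list of metrics, each given by the indices of its timelike basis vectors ($13$ stands for $\epsilon_1=\epsilon_3=-1$ and all other $\epsilon_i=1$). An *entry* is a row together with one metric of its list. Table 1 ($n=3,4$): 1. $(0,0,\tfrac{4}{7}e^{12});\quad (\tfrac{6}{7},-\tfrac{2}{7},\tfrac{4}{7})+\tfrac{8}{7}e^{1}\otimes e_{2};\quad \{13,23\}$ 2. $(0,0,0);\quad (1,-\tfrac{1}{5},\tfrac{2}{5})+\tfrac{6}{5}e^{1}\otimes e_{2};\quad \{1,13,2,23\}$ 3. $(0,0,\tfrac{14}{51}\sqrt{3}e^{12},\tfrac{7}{51}\sqrt{34}e^{13});\quad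 (\tfrac{28}{51},-\tfrac{7}{17},\tfrac{7}{51},\tfrac{35}{51})+\tfrac{7}{51}\sqrt{66}e^{1}\otimes e_{2};\quad \{13,234\}$ 4. $(0,0,0,\tfrac{2}{17}\sqrt{22}e^{12});\quad (\tfrac{15}{17},-\tfrac{7}{17},\tfrac{6}{17},\tfrac{8}{17})+\tfrac{22}{17}e^{1}\otimes e_{2};\quad \{134,14,234,24\}$ 5. $(0,0,0,\tfrac{1}{3}\sqrt{6}e^{12});\quad (0,0,1,0)+\tfrac{2}{3}\sqrt{3}e^{3}\otimes e_{4};\quad \{123,14,3\}$ 6. $(0,0,0,\tfrac{1}{3}\sqrt{6}e^{12});\quad (\tfrac{2}{3},0,-\tfrac{1}{3},\tfrac{2}{3})+\tfrac{2}{3}\sqrt{3}e^{1}\otimes e_{3};\quad \{12,14,234,3\}$ 7. $(0,0,0,\tfrac{2}{9}\sqrt{6}e^{12});\quad (\tfrac{1}{3},-\tfrac{1}{3},\tfrac{2}{3},0)+\tfrac{2}{3}e^{1}\otimes e_{2}+\tfrac{4}{9}\sqrt{3}e^{3}\otimes e_{4};\quad \{14,24\}$ 8. $(0,0,0,0);\quad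 (1,-\tfrac{1}{3},\tfrac{1}{3},\tfrac{1}{3})+\tfrac{4}{3}e^{1}\otimes e_{2};\quad \{1,13,134,2,23,234\}$ 9. $(0,0,0,0);\quad (\tfrac{3}{5},\tfrac{3}{5},-\tfrac{1}{5},-\tfrac{1}{5})+\tfrac{4}{5}e^{1}\otimes e_{3}+\tfrac{4}{5}e^{2}\otimes e_{4};\quad \{12,14,34\}$ Table 2 ($n=5$): 10. $(0,0,\tfrac{3}{10}\sqrt{5}e^{12},\tfrac{3}{10}\sqrt{2}e^{13},\tfrac{3}{10}\sqrt{5}e^{14});\quad (-\tfrac{3}{10},\tfrac{3}{4},\tfrac{9}{20},\tfrac{3}{20},-\tfrac{3}{20})+\tfrac{3}{10}\sqrt{14}e^{2}\otimes e_{5};\quad \{124,135\}$ 11. $(0,0,\tfrac{11}{159}\sqrt{6}e^{12},\tfrac{11}{159}\sqrt{106}e^{13},\tfrac{22}{53}\sqrt{3}e^{14});\quad (\tfrac{55}{159},-\tfrac{22}{53},-\tfrac{11}{159},\tfrac{44}{159},\tfrac{33}{53})+\tfrac{22}{159}\sqrt{57}e^{1}\otimes e_{2};\quad \{14,2\}$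 12. $(0,0,\tfrac{10}{31}e^{12},\tfrac{5}{31}\sqrt{3}e^{13},\tfrac{5}{31}\sqrt{3}e^{23});\quad (\tfrac{15}{31},-\tfrac{10}{31},\tfrac{5}{31},\tfrac{20}{31},-\tfrac{5}{31})+\tfrac{25}{31}e^{1}\otimes e_{2}+\tfrac{25}{31}e^{4}\otimes e_{5};\quad \{135,234\}$ 13. $(0,0,0,\tfrac{4}{15}\sqrt{10}e^{12},\tfrac{4}{15}\sqrt{3}e^{14});\quad (-\tfrac{2}{15},\tfrac{2}{3},-\tfrac{2}{5},\tfrac{8}{15},\tfrac{2}{5})+\tfrac{4}{15}\sqrt{21}e^{2}\otimes e_{3};\quad \{125,134,245,3\}$ 14. $(0,0,0,\tfrac{5}{51}\sqrt{6}e^{12},\tfrac{5}{51}\sqrt{34}e^{14});\quad (\tfrac{10}{51},-\tfrac{5}{17},\tfrac{10}{17},-\tfrac{5}{51},\tfrac{5}{51})+\tfrac{5}{51}\sqrt{42}e^{1}\otimes e_{2}+\tfrac{5}{51}\sqrt{42}e^{3}\otimes e_{5};\quad \{134,245\}$ 15. $(0,0,0,\tfrac{4}{15}\sqrt{3}e^{12},\tfrac{4}{15}\sqrt{10}e^{14});\quad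 (-\tfrac{2}{15},\tfrac{1}{5},1,\tfrac{1}{15},-\tfrac{1}{15})+\tfrac{4}{15}\sqrt{21}e^{3}\otimes e_{5};\quad \{125,134,245,3\}$ 16. $(0,0,0,\tfrac{4}{21}\sqrt{14}e^{12},\tfrac{4}{21}\sqrt{14}e^{14});\quad (\tfrac{1}{3},-\tfrac{1}{21},-\tfrac{3}{7},\tfrac{2}{7},\tfrac{13}{21})+\tfrac{4}{21}\sqrt{30}e^{1}\otimes e_{3};\quad \{125,14,2345,3\}$ 17. $(0,0,0,\tfrac{4}{15}\sqrt{3}e^{12},\tfrac{4}{15}\sqrt{10}e^{14});\quad (\tfrac{17}{30},-\tfrac{1}{2},\tfrac{3}{10},\tfrac{1}{15},\tfrac{19}{30})+\tfrac{4}{15}\sqrt{21}e^{1}\otimes e_{2};\quad \{134,14,2345,245\}$ 18. $(0,0,0,\tfrac{6}{17}\sqrt{6}e^{12},\tfrac{6}{17}e^{13}+\tfrac{6}{17}\sqrt{2}e^{24});\quad (\tfrac{12}{17},-\tfrac{3}{17},-\tfrac{6}{17},\tfrac{9}{17},\tfrac{6}{17})+\tfrac{12}{17}\sqrt{3}e^{1}\otimes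 e_{3};\quad \{234,3\}$ 19. $(0,0,0,\tfrac{36}{115}\sqrt{3}e^{12},\tfrac{9}{506}\sqrt{110}e^{13}+\tfrac{9}{2530}\sqrt{2090}e^{24});\quad (-\tfrac{9}{23},\tfrac{36}{115},\tfrac{72}{115},-\tfrac{9}{115},\tfrac{27}{115})+\sqrt{\tfrac{143127}{290950}}e^{2}\otimes e_{1}-\sqrt{\tfrac{7533}{11638}}e^{3}\otimes e_{4};\quad \{145,24\}$ 20. $(0,0,0,\tfrac{1}{19}\sqrt{102}e^{12},\tfrac{6}{19}e^{13});\quad (\tfrac{3}{19},\tfrac{6}{19},-\tfrac{6}{19},\tfrac{9}{19},-\tfrac{3}{19})+\tfrac{2}{19}\sqrt{33}e^{1}\otimes e_{3}+\tfrac{5}{19}\sqrt{6}e^{2}\otimes e_{5};\quad \{145,35\}$ 21. $(0,0,0,\tfrac{3}{11}e^{12},\tfrac{3}{11}e^{13});\quad (\tfrac{1}{11},\tfrac{6}{11},-\tfrac{3}{11},\tfrac{7}{11},-\tfrac{2}{11})+\tfrac{9}{11}e^{2}\otimes e_{3}+\tfrac{9}{11}e^{4}\otimes e_{5};\quad \{125,134,24,35\}$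 22. $(0,0,0,\tfrac{1}{6}\sqrt{6}e^{12},\tfrac{1}{6}\sqrt{6}e^{13});\quad (-\tfrac{1}{3},\tfrac{1}{3},\tfrac{1}{3},0,0)+\tfrac{1}{6}\sqrt{10}e^{2}\otimes e_{5}-\tfrac{1}{6}\sqrt{10}e^{3}\otimes e_{4};\quad \{123,145,24\}$ 23. $(0,0,0,\tfrac{1}{6}\sqrt{6}e^{12},\tfrac{1}{6}\sqrt{6}e^{13});\quad (-\tfrac{1}{3},\tfrac{1}{3},\tfrac{1}{3},0,0)+\tfrac{1}{6}\sqrt{10}e^{2}\otimes e_{5}+\tfrac{1}{6}\sqrt{10}e^{3}\otimes e_{4};\quad \{123,145,24\}$ 24. $(0,0,0,\tfrac{1}{14}\sqrt{91}e^{12},\tfrac{1}{14}\sqrt{91}e^{13});\quad (-\tfrac{3}{14},\tfrac{3}{4},\tfrac{1}{28},\tfrac{15}{28},-\tfrac{5}{28})+\tfrac{1}{7}\sqrt{65}e^{2}\otimes e_{5};\quad \{123,145,24,35\}$ 25. $(0,0,0,\tfrac{2}{53}\sqrt{29}e^{12},\tfrac{6}{53}\sqrt{58}e^{13});\quad (\tfrac{36}{53},-\tfrac{22}{53},-\tfrac{3}{53},\tfrac{14}{53},\tfrac{33}{53})+\tfrac{2}{53}\sqrt{1102}e^{1}\otimes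 e_{2};\quad \{13,15,2,235\}$ 26. $(0,0,0,0,\tfrac{1}{3}\sqrt{3}e^{12});\quad (\tfrac{1}{4},\tfrac{1}{4},-\tfrac{1}{4},-\tfrac{1}{4},\tfrac{1}{2})+\tfrac{1}{6}\sqrt{15}e^{1}\otimes e_{3}+\tfrac{1}{6}\sqrt{15}e^{2}\otimes e_{4};\quad \{12,145,34\}$ 27. $(0,0,0,0,\tfrac{1}{5}\sqrt{7}e^{12});\quad (\tfrac{9}{10},-\tfrac{1}{2},\tfrac{3}{10},\tfrac{3}{10},\tfrac{2}{5})+\tfrac{7}{5}e^{1}\otimes e_{2};\quad \{1345,135,15,2345,235,25\}$ 28. $(0,0,0,0,\tfrac{1}{5}\sqrt{7}e^{12});\quad (\tfrac{1}{5},\tfrac{1}{5},1,-\tfrac{2}{5},\tfrac{2}{5})+\tfrac{7}{5}e^{3}\otimes e_{4};\quad \{123,124,135,145,3,4\}$ 29. $(0,0,0,0,\tfrac{1}{21}\sqrt{322}e^{12});\quad (\tfrac{2}{3},-\tfrac{1}{21},-\tfrac{3}{7},\tfrac{2}{7},\tfrac{13}{21})+\tfrac{1}{21}\sqrt{690}e^{1}\otimes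 e_{3};\quad \{12,124,145,15,2345,235,3,34\}$ 30. $(0,0,0,0,\tfrac{1}{21}\sqrt{322}e^{12});\quad (-\tfrac{1}{21},-\tfrac{1}{21},1,\tfrac{2}{7},-\tfrac{2}{21})+\tfrac{1}{21}\sqrt{690}e^{3}\otimes e_{5};\quad \{123,1234,145,15,3,34\}$ 31. $(0,0,0,0,\tfrac{2}{65}\sqrt{322}e^{12});\quad (\tfrac{21}{65},-\tfrac{5}{13},\tfrac{42}{65},\tfrac{12}{65},-\tfrac{4}{65})+\tfrac{2}{65}\sqrt{690}e^{3}\otimes e_{5}+\tfrac{46}{65}e^{1}\otimes e_{2};\quad \{145,15,245,25\}$ 32. $(0,0,0,0,\tfrac{1}{3}\sqrt{3}e^{12});\quad (\tfrac{1}{4},-\tfrac{1}{6},\tfrac{7}{12},-\tfrac{1}{4},\tfrac{1}{12})+\tfrac{1}{6}\sqrt{15}e^{1}\otimes e_{4}+\tfrac{1}{6}\sqrt{15}e^{3}\otimes e_{5};\quad \{123,15,245,34\}$ 33. $(0,0,0,0,\tfrac{2}{17}\sqrt{7}e^{12});\quad (\tfrac{9}{17},-\tfrac{5}{17},\tfrac{10}{17},-\tfrac{4}{17},\tfrac{4}{17})+\tfrac{14}{17}e^{1}\otimes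 e_{2}+\tfrac{14}{17}e^{3}\otimes e_{4};\quad \{135,145,235,245\}$ 34. $(0,0,0,0,\tfrac{3}{11}e^{12}+\tfrac{3}{11}e^{34});\quad (\tfrac{6}{11},-\tfrac{3}{11},\tfrac{6}{11},-\tfrac{3}{11},\tfrac{3}{11})+\tfrac{9}{11}e^{1}\otimes e_{2}+\tfrac{9}{11}e^{3}\otimes e_{4};\quad \{135,145,245\}$ 35. $(0,0,0,0,\tfrac{3}{11}e^{12}+\tfrac{3}{11}e^{34});\quad (\tfrac{6}{11},-\tfrac{3}{11},\tfrac{6}{11},-\tfrac{3}{11},\tfrac{3}{11})+\tfrac{9}{11}e^{1}\otimes e_{2}-\tfrac{9}{11}e^{3}\otimes e_{4};\quad \{135,145,245\}$ 36. $(0,0,0,0,\tfrac{3}{11}e^{12}+\tfrac{3}{11}e^{34});\quad (\tfrac{6}{11},-\tfrac{3}{11},\tfrac{6}{11},-\tfrac{3}{11},\tfrac{3}{11})+\tfrac{9}{11}e^{1}\otimes e_{4}+\tfrac{9}{11}e^{3}\otimes e_{2};\quad \{12,135,245\}$ 37. $(0,0,0,0,\tfrac{6}{13}e^{12}+\tfrac{6}{13}e^{34});\quad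 (\tfrac{12}{13},-\tfrac{6}{13},\tfrac{3}{13},\tfrac{3}{13},\tfrac{6}{13})+\tfrac{18}{13}e^{1}\otimes e_{2};\quad \{135,235\}$ 38. $(0,0,0,0,0);\quad (\tfrac{7}{12},\tfrac{7}{12},-\tfrac{1}{4},-\tfrac{1}{4},\tfrac{1}{6})+\tfrac{5}{6}e^{1}\otimes e_{3}+\tfrac{5}{6}e^{2}\otimes e_{4};\quad \{12,125,14,145,34,345\}$ 39. $(0,0,0,0,0);\quad (1,-\tfrac{3}{7},\tfrac{2}{7},\tfrac{2}{7},\tfrac{2}{7})+\tfrac{10}{7}e^{1}\otimes e_{2};\quad \{1,13,134,1345,2,23,234,2345\}$ **Theorem.** (a) Let $n\le5$, $n\neq2$. Every solution arising from a nondiagonal triple on a nice diagram with $n$ nodes is equivalent to exactly one entry of Tables 1 and 2. (b) Every entry $(\mathfrak g,D,\epsilon)$ of the tables, with $n=\dim\mathfrak g$, arises from a nondiagonal triple on a nice diagram and satisfies the generalized nilsoliton equation (with $\tau=1$) $$\mathrm{Ric}=-\operatorname{Tr}((D^s)^2)\,\mathrm{id}-\tfrac12[D,D^*]+(\operatorname{Tr}D)D^s,\qquad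 \operatorname{Tr}(\operatorname{ad}v\circ D^*)=0\quad(v\in\mathfrak g),$$ where $\mathrm{Ric}$ is the Ricci operator of $g$, $D^*$ is the adjoint of $D$ with respect to $g$ and $D^s=\frac12(D+D^*)$. The solvable Lie algebra $\tilde{\mathfrak g}=\mathfrak g\rtimes_D\mathbb R e_0$, with $[e_0,x]=Dx$, has dimension $n+1$; with the metric $g+e^0\otimes e^0$ it is Einstein, $\mathfrak g\oplus\mathbb R e_0$ is a standard decomposition of it, and it has no standard decomposition of pseudo-Iwasawa type. -/

import Mathlib

open scoped Matrix

noncomputable section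

namespace NiceNil

/-! ### Nice diagrams and nice Lie algebras -/

/-- A nice diagram with nodes `1, …, n` (indexed by `Fin n`): a labelled directed acyclic graph,
`(i, j, k) ∈ arrows` meaning that there is an arrow `i → k` with label the node `j`. -/
structure NiceDiagram (n : ℕ) where
  arrows : Finset (Fin n × Fin n × Fin n)
  acyclic : ∀ i, ¬ Relation.TransGen (fun a b => ∃ j, (a, j, b) ∈ arrows) i i
  label_unique : ∀ i j j' k, (i, j, k) ∈ arrows → (i, j', k) ∈ arrows → j = j'
  target_unique : ∀ i j k k', (i, j, k) ∈ arrows → (i, j, k') ∈ arrows → k = k'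
  source_unique : ∀ i i' j k, (i, j, k) ∈ arrows → (i', j, k) ∈ arrows → i = i'
  swap : ∀ i j k, (i, j, k) ∈ arrows → i ≠ j ∧ (j, i, k) ∈ arrows
  /-- Concatenated arrows: for distinct `i, j, k`, writing `{{i, j}, k} → l` when there are arrows
  `i → h` with label `j` and `h → l` with label `k`, it cannot be that exactly one of
  `{{i, j}, k} → l`, `{{j, k}, i} → l`, `{{k, i}, j} → l` holds. -/
  concat : ∀ i j k l, i ≠ j → j ≠ k → i ≠ k →
    (∃ h, (i, j, h) ∈ arrows ∧ (h, k, l) ∈ arrows) →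
      (∃ h, (j, k, h) ∈ arrows ∧ (h, i, l) ∈ arrows) ∨
      (∃ h, (k, i, h) ∈ arrows ∧ (h, j, l) ∈ arrows)

/-- The rows of the root matrix: one for each pair of arrows `i → k` with label `j` and
`j → k` with label `i`. -/
abbrev NiceDiagram.Row {n : ℕ} (Δ : NiceDiagram n) : Type :=
  {I : Fin n × Fin n × Fin n // I ∈ Δ.arrows ∧ I.1 < I.2.1}

/-- The root matrix, with integer entries. -/
def NiceDiagram.rootMatrix {n : ℕ} (Δ : NiceDiagram n) : Matrix Δ.Row (Fin n) ℤ :=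
  fun I l => (if l = I.1.2.2 then 1 else 0) - (if l = I.1.1 then 1 else 0)
    - (if l = I.1.2.1 then 1 else 0)

/-- The real root matrix `M_Δ`. -/
def NiceDiagram.rootMatrixReal {n : ℕ} (Δ : NiceDiagram n) : Matrix Δ.Row (Fin n) ℝ :=
  Δ.rootMatrix.map (fun z : ℤ => (z : ℝ))

/-- The mod 2 reduction `M_{Δ,2}` of the root matrix. -/
def NiceDiagram.rootMatrixMod2 {n : ℕ} (Δ : NiceDiagram n) : Matrix Δ.Row (Fin n) (ZMod 2) :=
  Δ.rootMatrix.map (fun z : ℤ => (z : ZMod 2))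

/-- Structure constants `[e_i, e_j] = ∑ k, c i j k • e_k` of a real Lie algebra with basis
`e_1, …, e_n`. -/
structure StructureConstants (n : ℕ) where
  c : Fin n → Fin n → Fin n → ℝ
  skew : ∀ i j k, c i j k = -c j i k
  jacobi : ∀ i j k l, ∑ h, (c i j h * c h k l + c j k h * c h i l + c k i h * c h j l) = 0

/-- The Lie algebra `ℝⁿ` with the bracket given by the structure constants. -/
def StructureConstants.Carrier {n : ℕ} (_L : StructureConstants n) : Type := Fin n → ℝ

namespace StructureConstants

variable {n : ℕ} (L : StructureConstants n)

instance : AddCommGroup L.Carrier := inferInstanceAs (AddCommGroup (Fin n → ℝ))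

instance : Module ℝ L.Carrier := inferInstanceAs (Module ℝ (Fin n → ℝ))

instance : Module.Finite ℝ L.Carrier := inferInstanceAs (Module.Finite ℝ (Fin n → ℝ))

/-- The basis vector `e_i`. -/
def e (i : Fin n) : L.Carrier := (Pi.single i 1 : Fin n → ℝ)

/-- The coordinates of a vector with respect to the basis `e_1, …, e_n`. -/
def coord (x : L.Carrier) : Fin n → ℝ := x

/-- The linear map `x ↦ M x` defined by a matrix in the basis `e_1, …, e_n`. -/
def mapOf (M : Matrix (Fin n) (Fin n) ℝ) : L.Carrier →ₗ[ℝ] L.Carrier :=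
  (M.mulVecLin : (Fin n → ℝ) →ₗ[ℝ] (Fin n → ℝ))

instance : Bracket L.Carrier L.Carrier where
  bracket x y := (fun k => ∑ i, ∑ j, L.coord x i * L.coord y j * L.c i j k : Fin n → ℝ)

theorem lie_apply (x y : L.Carrier) (k : Fin n) :
    L.coord ⁅x, y⁆ k = ∑ i, ∑ j, L.coord x i * L.coord y j * L.c i j k := rfl

theorem lie_antisymm (x y : L.Carrier) : ⁅x, y⁆ = -⁅y, x⁆ := by
  funext k
  change (∑ i, ∑ j, L.coord x i * L.coord y j * L.c i j k)
    = -∑ i, ∑ j, L.coord y i * L.coord x j * L.c i j k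
  rw [Finset.sum_comm, ← Finset.sum_neg_distrib]
  refine Finset.sum_congr rfl fun i _ => ?_
  rw [← Finset.sum_neg_distrib]
  refine Finset.sum_congr rfl fun j _ => ?_
  rw [L.skew j i k]; ring

theorem lie_lie_apply (x y z : L.Carrier) (l : Fin n) :
    L.coord ⁅⁅x, y⁆, z⁆ l = ∑ i, ∑ j, ∑ k, L.coord x i * L.coord y j * L.coord z k *
      ∑ h, L.c i j h * L.c h k l := by
  rw [lie_apply]
  simp only [lie_apply, Finset.sum_mul, Finset.mul_sum]
  rw [Finset.sum_congr rfl fun h _ => Finset.sum_comm, Finset.sum_comm]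
  refine Finset.sum_congr rfl fun i _ => ?_
  rw [Finset.sum_congr rfl fun h _ => Finset.sum_comm, Finset.sum_comm]
  refine Finset.sum_congr rfl fun j _ => ?_
  rw [Finset.sum_comm]
  refine Finset.sum_congr rfl fun k _ => Finset.sum_congr rfl fun h _ => ?_
  ring

theorem add_lie_aux (x y z : L.Carrier) : ⁅x + y, z⁆ = ⁅x, z⁆ + ⁅y, z⁆ := by
  funext k
  change (∑ i, ∑ j, (L.coord x i + L.coord y i) * L.coord z j * L.c i j k)
    = (∑ i, ∑ j, L.coord x i * L.coord z j * L.c i j k)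
      + ∑ i, ∑ j, L.coord y i * L.coord z j * L.c i j k
  simp only [← Finset.sum_add_distrib]
  refine Finset.sum_congr rfl fun i _ => Finset.sum_congr rfl fun j _ => ?_
  ring

theorem lie_jacobi_aux (x y z : L.Carrier) :
    ⁅⁅x, y⁆, z⁆ + ⁅⁅y, z⁆, x⁆ + ⁅⁅z, x⁆, y⁆ = 0 := by
  funext l
  change L.coord ⁅⁅x, y⁆, z⁆ l + L.coord ⁅⁅y, z⁆, x⁆ l + L.coord ⁅⁅z, x⁆, y⁆ l = 0
  have h1 : L.coord ⁅⁅y, z⁆, x⁆ l = ∑ i, ∑ j, ∑ k, L.coord x i * L.coord y j * L.coord z k *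
      ∑ h, L.c j k h * L.c h i l := by
    rw [lie_lie_apply, Finset.sum_congr rfl fun i _ => Finset.sum_comm, Finset.sum_comm]
    refine Finset.sum_congr rfl fun i _ => Finset.sum_congr rfl fun j _ =>
      Finset.sum_congr rfl fun k _ => ?_
    ring
  have h2 : L.coord ⁅⁅z, x⁆, y⁆ l = ∑ i, ∑ j, ∑ k, L.coord x i * L.coord y j * L.coord z k *
      ∑ h, L.c k i h * L.c h j l := by
    rw [lie_lie_apply, Finset.sum_comm]
    refine Finset.sum_congr rfl fun i _ => ?_
    rw [Finset.sum_comm]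
    refine Finset.sum_congr rfl fun j _ => Finset.sum_congr rfl fun k _ => ?_
    ring
  rw [lie_lie_apply, h1, h2]
  simp only [← Finset.sum_add_distrib, ← mul_add]
  refine Finset.sum_eq_zero fun i _ => Finset.sum_eq_zero fun j _ => Finset.sum_eq_zero fun k _ => ?_
  rw [L.jacobi i j k l, mul_zero]

instance : LieRing L.Carrier where
  add_lie := L.add_lie_aux
  lie_add x y z := by
    rw [L.lie_antisymm x, L.add_lie_aux, L.lie_antisymm x y, L.lie_antisymm x z]; abel
  lie_self x := by
    have h := L.lie_antisymm x x
    have h2 : (2 : ℝ) • ⁅x, x⁆ = 0 := by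
      rw [two_smul]; nth_rewrite 1 [h]; exact neg_add_cancel _
    exact (smul_eq_zero.mp h2).resolve_left two_ne_zero
  leibniz_lie x y z := by
    have h := L.lie_jacobi_aux x y z
    have h1 : ⁅⁅y, z⁆, x⁆ = -⁅x, ⁅y, z⁆⁆ := L.lie_antisymm _ _
    have hz : ⁅z, x⁆ + ⁅x, z⁆ = 0 := by rw [L.lie_antisymm z x]; exact neg_add_cancel _
    have h2 : ⁅⁅z, x⁆, y⁆ + ⁅⁅x, z⁆, y⁆ = 0 := by
      rw [← L.add_lie_aux, hz]
      have h0 := L.add_lie_aux 0 0 y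
      rw [add_zero] at h0
      exact left_eq_add.mp h0
    have h3 : ⁅⁅x, z⁆, y⁆ = -⁅y, ⁅x, z⁆⁆ := L.lie_antisymm _ _
    rw [h3, add_neg_eq_zero] at h2
    rw [h1, h2] at h
    have h4 : ⁅⁅x, y⁆, z⁆ + ⁅y, ⁅x, z⁆⁆ - ⁅x, ⁅y, z⁆⁆ = 0 := by rw [← h]; abel
    exact (sub_eq_zero.mp h4).symm

instance : LieAlgebra ℝ L.Carrier where
  lie_smul t x y := by
    funext k
    change (∑ i, ∑ j, L.coord x i * (t * L.coord y j) * L.c i j k)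
      = t * ∑ i, ∑ j, L.coord x i * L.coord y j * L.c i j k
    simp only [Finset.mul_sum]
    refine Finset.sum_congr rfl fun i _ => Finset.sum_congr rfl fun j _ => ?_
    ring


/-- `Δ` is the diagram of the Lie algebra with its basis: there is an arrow `i → k` with label `j`
precisely when `[e_i, e_j]` is a nonzero multiple of `e_k`. -/
def HasDiagram (Δ : NiceDiagram n) : Prop :=
  ∀ i j k, L.c i j k ≠ 0 ↔ (i, j, k) ∈ Δ.arrows

end StructureConstants

/-! ### Metric Lie algebras -/

section Metric

variable {G : Type*} [LieRing G] [LieAlgebra ℝ G]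

/-- A metric on a Lie algebra: a nondegenerate symmetric bilinear form of any signature. -/
def IsMetric (B : LinearMap.BilinForm ℝ G) : Prop := B.IsSymm ∧ B.Nondegenerate

/-- `nabla` is the Levi-Civita connection of the left-invariant metric `B`, acting on left-invariant
vector fields: it is torsion-free and metric. -/
def IsLeviCivita (B : LinearMap.BilinForm ℝ G) (nabla : G →ₗ[ℝ] G →ₗ[ℝ] G) : Prop :=
  (∀ x y, nabla x y - nabla y x = ⁅x, y⁆) ∧
  (∀ x y z, B (nabla x y) z + B y (nabla x z) = 0)

/-- The curvature `R(x, y) z = ∇_x ∇_y z - ∇_y ∇_x z - ∇_[x,y] z`. -/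
def curvature (nabla : G →ₗ[ℝ] G →ₗ[ℝ] G) (x y z : G) : G :=
  nabla x (nabla y z) - nabla y (nabla x z) - nabla ⁅x, y⁆ z

/-- The Ricci tensor `ric(y, z)`, the trace of `x ↦ R(x, y) z`. -/
def ricci (nabla : G →ₗ[ℝ] G →ₗ[ℝ] G) (y z : G) : ℝ :=
  LinearMap.trace ℝ G
    { toFun := fun x => curvature nabla x y z
      map_add' := fun a b => by simp only [curvature, map_add, LinearMap.add_apply, add_lie]; abel
      map_smul' := fun t a => by
        simp only [curvature, map_smul, LinearMap.smul_apply, smul_lie, RingHom.id_apply, smul_sub] }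

/-- `Rc` is the Ricci operator of the metric `B`. -/
def IsRicciOperator (B : LinearMap.BilinForm ℝ G) (Rc : G →ₗ[ℝ] G) : Prop :=
  ∃ nabla : G →ₗ[ℝ] G →ₗ[ℝ] G, IsLeviCivita B nabla ∧ ∀ y z, B (Rc y) z = ricci nabla y z

/-- The Einstein condition `Ric = Λ id`. -/
def IsEinstein (B : LinearMap.BilinForm ℝ G) : Prop :=
  ∃ Λ : ℝ, IsRicciOperator B (Λ • LinearMap.id)

/-- The generalized nilsoliton equation with `τ = 1`:
`Ric = -Tr((D^s)²) id - 1/2 [D, D^*] + (Tr D) D^s` and `Tr(ad v ∘ D^*) = 0` for all `v`,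
where `D^*` is the metric adjoint of `D` and `D^s = 1/2 (D + D^*)`. -/
def SolvesGeneralizedNilsoliton (B : LinearMap.BilinForm ℝ G) (D : G →ₗ[ℝ] G) : Prop :=
  ∃ Rc Dstar Ds : G →ₗ[ℝ] G,
    IsRicciOperator B Rc ∧
    (∀ x y, B (Dstar x) y = B x (D y)) ∧
    Ds = (1 / 2 : ℝ) • (D + Dstar) ∧
    Rc = -(LinearMap.trace ℝ G (Ds ∘ₗ Ds)) • LinearMap.id
      - (1 / 2 : ℝ) • (D ∘ₗ Dstar - Dstar ∘ₗ D) + (LinearMap.trace ℝ G D) • Ds ∧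
    ∀ v : G, LinearMap.trace ℝ G ((LieAlgebra.ad ℝ G v : G →ₗ[ℝ] G) ∘ₗ Dstar) = 0

/-- `G = N ⊕ A` is a standard decomposition: `N` is a nilpotent ideal, `A` an abelian subalgebra,
and the two are complementary and orthogonal. -/
structure IsStandardDecomposition (B : LinearMap.BilinForm ℝ G) (N : LieIdeal ℝ G)
    (A : LieSubalgebra ℝ G) : Prop where
  compl : IsCompl N.toSubmodule A.toSubmodule
  orthogonal : ∀ x ∈ N, ∀ y ∈ A, B x y = 0
  nilpotent : LieRing.IsNilpotent N
  abelian : IsLieAbelian A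

/-- A standard decomposition is of pseudo-Iwasawa type if `ad x` is symmetric for all `x` in `A`. -/
def IsPseudoIwasawa (B : LinearMap.BilinForm ℝ G) (N : LieIdeal ℝ G)
    (A : LieSubalgebra ℝ G) : Prop :=
  IsStandardDecomposition B N A ∧ ∀ x ∈ A, ∀ y z, B ⁅x, y⁆ z = B y ⁅x, z⁆

end Metric

/-! ### Nondiagonal triples and nondiagonal solutions -/

/-- A nondiagonal triple `(D, A, 𝒜)` on a nice diagram. The matrix `D` acts on column vectors, so
its entry in row `j` and column `i` is the coefficient of `e^i ⊗ e_j`; its diagonal entries are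
`λ_i = D i i`. -/
structure NondiagonalTriple {n : ℕ} (Δ : NiceDiagram n) where
  D : Matrix (Fin n) (Fin n) ℝ
  𝒜 : Finset (Fin n × Fin n)
  A : {p // p ∈ 𝒜} → ℝ
  nonempty : 𝒜.Nonempty
  A_ne_zero : ∀ p, A p ≠ 0
  ne : ∀ p ∈ 𝒜, p.1 ≠ p.2
  disjoint : ∀ p ∈ 𝒜, ∀ q ∈ 𝒜, p ≠ q → p.1 ≠ q.1 ∧ p.1 ≠ q.2 ∧ p.2 ≠ q.1 ∧ p.2 ≠ q.2
  no_arrow : ∀ p ∈ 𝒜, ∀ k, (p.1, k, p.2) ∉ Δ.arrows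
  nik : ∀ μ : Fin n → ℝ, Δ.rootMatrixReal *ᵥ μ = 0 →
    ∑ i, D i i * μ i = (1 + ∑ p, A p) * ∑ i, μ i + ∑ p, A p * (μ p.1.2 - μ p.1.1)
  trace_eq : ∀ p ∈ 𝒜, D.trace = D p.1 p.1 - D p.2 p.2
  off_diagonal : ∀ i j, i ≠ j → (i, j) ∉ 𝒜 → D j i = 0
  entry_sq : ∀ p : {p // p ∈ 𝒜},
    D p.1.2 p.1.1 ^ 2 = |2 * A p * D.trace| ∧ |2 * A p * D.trace| ≠ 0
  diag_mem_ker : Δ.rootMatrixReal *ᵥ (fun i => D i i) = 0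

/-- The log sign of a nonzero real number. -/
def logsign (x : ℝ) : ZMod 2 := if x < 0 then 1 else 0

/-- A Lie algebra with a basis, a derivation `D` written as a matrix in that basis, and the metric
for which the basis is orthonormal with `⟨e_i, e_i⟩ = ε_i = ±1`. -/
structure Datum (n : ℕ) where
  L : StructureConstants n
  D : Matrix (Fin n) (Fin n) ℝ
  leibniz : ∀ x y : L.Carrier, L.mapOf D ⁅x, y⁆ = ⁅L.mapOf D x, y⁆ + ⁅x, L.mapOf D y⁆
  ε : Fin n → ℤˣ

namespace Datum

variable {n : ℕ} (d : Datum n)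

/-- The nilpotent Lie algebra `𝔤`. -/
abbrev Alg : Type := d.L.Carrier

/-- `D` as a derivation of the Lie algebra. -/
def derivation : LieDerivation ℝ d.Alg d.Alg where
  toLinearMap := d.L.mapOf d.D
  leibniz' := fun x y => by
    rw [d.leibniz x y, ← lie_skew y]; abel

/-- The diagonal metric `∑ ε_i e^i ⊗ e^i`. -/
def metric : LinearMap.BilinForm ℝ d.Alg :=
  ((Matrix.diagonal fun i => ((d.ε i : ℤ) : ℝ)).toBilin' : LinearMap.BilinForm ℝ (Fin n → ℝ))

/-- `d` arises from the nondiagonal triple `T` on `Δ`: the Lie algebra has diagram `Δ`, the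
derivation is that of `T`, and the structure constants and `ε` form a nondiagonal solution. -/
def ArisesFrom {Δ : NiceDiagram n} (T : NondiagonalTriple Δ) : Prop :=
  d.L.HasDiagram Δ ∧ d.D = T.D ∧
  ∃ X : Δ.Row → ℝ,
    ((1 / (2 * T.D.trace)) • (Δ.rootMatrixRealᵀ *ᵥ X) = fun l =>
      (-1 - ∑ p, T.A p)
        + ∑ p, T.A p * ((if l = p.1.1 then 1 else 0) - (if l = p.1.2 then 1 else 0))
        + T.D l l) ∧
    Δ.rootMatrixMod2 *ᵥ (fun i => logsign ((d.ε i : ℤ) : ℝ)) = (fun I => logsign (X I)) ∧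
    (∀ p : {p // p ∈ T.𝒜}, ((d.ε p.1.1 : ℤ) : ℝ) / ((d.ε p.1.2 : ℤ) : ℝ)
      = Real.sign (T.A p * T.D.trace)) ∧
    ∀ I : Δ.Row, d.L.c I.1.1 I.1.2.1 I.1.2.2 ^ 2 = |X I|

/-- `d` arises from some nondiagonal triple on some nice diagram with `n` nodes. -/
def IsNondiagonalSolution : Prop :=
  ∃ (Δ : NiceDiagram n) (T : NondiagonalTriple Δ), d.ArisesFrom T

/-- Equivalence: an isomorphism of Lie algebras that maps each basis vector to a nonzero multiple
of a basis vector and respects the metrics and the derivations. -/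
def Equivalent {m : ℕ} (d' : Datum m) : Prop :=
  ∃ φ : d.Alg ≃ₗ⁅ℝ⁆ d'.Alg,
    (∀ i, ∃ j, ∃ r : ℝ, r ≠ 0 ∧ φ (d.L.e i) = r • d'.L.e j) ∧
    (∀ x y, d'.metric (φ x) (φ y) = d.metric x y) ∧
    (∀ x, φ (d.derivation x) = d'.derivation (φ x))

attribute [local instance] LieRing.ofAssociativeRing

/-- The action `t ↦ t D` of `ℝ` by derivations. -/
def action : ℝ →ₗ⁅ℝ⁆ LieDerivation ℝ d.Alg d.Alg where
  toFun t := t • d.derivation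
  map_add' := fun s t => add_smul s t _
  map_smul' := fun s t => by simp [mul_smul]
  map_lie' := fun {s t} => by
    have h : ⁅s, t⁆ = (0 : ℝ) := by rw [LieRing.of_associative_ring_bracket]; ring
    rw [h]; simp

/-- The solvable extension `𝔤 ⋊_D ℝ e_0`, in which `[e_0, x] = D x`. -/
abbrev Ext : Type := LieAlgebra.SemiDirectSum d.Alg ℝ d.action

/-- The metric `g + e^0 ⊗ e^0` on the extension. -/
def extMetric : LinearMap.BilinForm ℝ d.Ext :=
  d.metric.compl₁₂ (LieAlgebra.SemiDirectSum.projl d.action)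
      (LieAlgebra.SemiDirectSum.projl d.action) +
    (LinearMap.mul ℝ ℝ).compl₁₂
      (LieAlgebra.SemiDirectSum.projr d.action : d.Ext →ₗ[ℝ] ℝ)
      (LieAlgebra.SemiDirectSum.projr d.action : d.Ext →ₗ[ℝ] ℝ)

/-- The ideal `𝔤` in `𝔤 ⋊_D ℝ e_0`. -/
def nilIdeal : LieIdeal ℝ d.Ext := (LieAlgebra.SemiDirectSum.projr d.action).ker

/-- The abelian subalgebra `ℝ e_0` in `𝔤 ⋊_D ℝ e_0`. -/
def line : LieSubalgebra ℝ d.Ext := (LieAlgebra.SemiDirectSum.inr d.action).range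

end Datum

/-! ### The tables -/

/-- A row of the tables; nodes are numbered from `1`. `(i, j, k, v)` in `brackets` stands for the
summand `v e^i ∧ e^j` of `de^k`; `diagonal` is `(λ_1, …, λ_n)`; `(i, j, v)` in `offDiagonal` stands
for the summand `v e^i ⊗ e_j` of `D`; each element of `signatures` lists the timelike basis vectors
of one metric. -/
structure TableRow where
  size : ℕ
  brackets : List (ℕ × ℕ × ℕ × ℝ)
  diagonal : List ℝ
  offDiagonal : List (ℕ × ℕ × ℝ)
  signatures : List (List ℕ)

/-- The rows with `n = 3, 4`. -/
def table34 : List TableRow := [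
  ⟨3, [(1, 2, 3, 4/7)],
    [6/7, -2/7, 4/7],
    [(1, 2, 8/7)],
    [[1, 3], [2, 3]]⟩,
  ⟨3, [],
    [1, -1/5, 2/5],
    [(1, 2, 6/5)],
    [[1], [1, 3], [2], [2, 3]]⟩,
  ⟨4, [(1, 2, 3, 14/51*√3), (1, 3, 4, 7/51*√34)],
    [28/51, -7/17, 7/51, 35/51],
    [(1, 2, 7/51*√66)],
    [[1, 3], [2, 3, 4]]⟩,
  ⟨4, [(1, 2, 4, 2/17*√22)],
    [15/17, -7/17, 6/17, 8/17],
    [(1, 2, 22/17)],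
    [[1, 3, 4], [1, 4], [2, 3, 4], [2, 4]]⟩,
  ⟨4, [(1, 2, 4, 1/3*√6)],
    [0, 0, 1, 0],
    [(3, 4, 2/3*√3)],
    [[1, 2, 3], [1, 4], [3]]⟩,
  ⟨4, [(1, 2, 4, 1/3*√6)],
    [2/3, 0, -1/3, 2/3],
    [(1, 3, 2/3*√3)],
    [[1, 2], [1, 4], [2, 3, 4], [3]]⟩,
  ⟨4, [(1, 2, 4, 2/9*√6)],
    [1/3, -1/3, 2/3, 0],
    [(1, 2, 2/3), (3, 4, 4/9*√3)],
    [[1, 4], [2, 4]]⟩,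
  ⟨4, [],
    [1, -1/3, 1/3, 1/3],
    [(1, 2, 4/3)],
    [[1], [1, 3], [1, 3, 4], [2], [2, 3], [2, 3, 4]]⟩,
  ⟨4, [],
    [3/5, 3/5, -1/5, -1/5],
    [(1, 3, 4/5), (2, 4, 4/5)],
    [[1, 2], [1, 4], [3, 4]]⟩]

/-- The rows with `n = 5`. -/
def table5 : List TableRow := [
  ⟨5, [(1, 2, 3, 3/10*√5), (1, 3, 4, 3/10*√2), (1, 4, 5, 3/10*√5)],
    [-3/10, 3/4, 9/20, 3/20, -3/20],
    [(2, 5, 3/10*√14)],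
    [[1, 2, 4], [1, 3, 5]]⟩,
  ⟨5, [(1, 2, 3, 11/159*√6), (1, 3, 4, 11/159*√106), (1, 4, 5, 22/53*√3)],
    [55/159, -22/53, -11/159, 44/159, 33/53],
    [(1, 2, 22/159*√57)],
    [[1, 4], [2]]⟩,
  ⟨5, [(1, 2, 3, 10/31), (1, 3, 4, 5/31*√3), (2, 3, 5, 5/31*√3)],
    [15/31, -10/31, 5/31, 20/31, -5/31],
    [(1, 2, 25/31), (4, 5, 25/31)],
    [[1, 3, 5], [2, 3, 4]]⟩,
  ⟨5, [(1, 2, 4, 4/15*√10), (1, 4, 5, 4/15*√3)],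
    [-2/15, 2/3, -2/5, 8/15, 2/5],
    [(2, 3, 4/15*√21)],
    [[1, 2, 5], [1, 3, 4], [2, 4, 5], [3]]⟩,
  ⟨5, [(1, 2, 4, 5/51*√6), (1, 4, 5, 5/51*√34)],
    [10/51, -5/17, 10/17, -5/51, 5/51],
    [(1, 2, 5/51*√42), (3, 5, 5/51*√42)],
    [[1, 3, 4], [2, 4, 5]]⟩,
  ⟨5, [(1, 2, 4, 4/15*√3), (1, 4, 5, 4/15*√10)],
    [-2/15, 1/5, 1, 1/15, -1/15],
    [(3, 5, 4/15*√21)],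
    [[1, 2, 5], [1, 3, 4], [2, 4, 5], [3]]⟩,
  ⟨5, [(1, 2, 4, 4/21*√14), (1, 4, 5, 4/21*√14)],
    [1/3, -1/21, -3/7, 2/7, 13/21],
    [(1, 3, 4/21*√30)],
    [[1, 2, 5], [1, 4], [2, 3, 4, 5], [3]]⟩,
  ⟨5, [(1, 2, 4, 4/15*√3), (1, 4, 5, 4/15*√10)],
    [17/30, -1/2, 3/10, 1/15, 19/30],
    [(1, 2, 4/15*√21)],
    [[1, 3, 4], [1, 4], [2, 3, 4, 5], [2, 4, 5]]⟩,
  ⟨5, [(1, 2, 4, 6/17*√6), (1, 3, 5, 6/17), (2, 4, 5, 6/17*√2)],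
    [12/17, -3/17, -6/17, 9/17, 6/17],
    [(1, 3, 12/17*√3)],
    [[2, 3, 4], [3]]⟩,
  ⟨5, [(1, 2, 4, 36/115*√3), (1, 3, 5, 9/506*√110), (2, 4, 5, 9/2530*√2090)],
    [-9/23, 36/115, 72/115, -9/115, 27/115],
    [(2, 1, √(143127/290950)), (3, 4, -√(7533/11638))],
    [[1, 4, 5], [2, 4]]⟩,
  ⟨5, [(1, 2, 4, 1/19*√102), (1, 3, 5, 6/19)],
    [3/19, 6/19, -6/19, 9/19, -3/19],
    [(1, 3, 2/19*√33), (2, 5, 5/19*√6)],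
    [[1, 4, 5], [3, 5]]⟩,
  ⟨5, [(1, 2, 4, 3/11), (1, 3, 5, 3/11)],
    [1/11, 6/11, -3/11, 7/11, -2/11],
    [(2, 3, 9/11), (4, 5, 9/11)],
    [[1, 2, 5], [1, 3, 4], [2, 4], [3, 5]]⟩,
  ⟨5, [(1, 2, 4, 1/6*√6), (1, 3, 5, 1/6*√6)],
    [-1/3, 1/3, 1/3, 0, 0],
    [(2, 5, 1/6*√10), (3, 4, -1/6*√10)],
    [[1, 2, 3], [1, 4, 5], [2, 4]]⟩,
  ⟨5, [(1, 2, 4, 1/6*√6), (1, 3, 5, 1/6*√6)],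
    [-1/3, 1/3, 1/3, 0, 0],
    [(2, 5, 1/6*√10), (3, 4, 1/6*√10)],
    [[1, 2, 3], [1, 4, 5], [2, 4]]⟩,
  ⟨5, [(1, 2, 4, 1/14*√91), (1, 3, 5, 1/14*√91)],
    [-3/14, 3/4, 1/28, 15/28, -5/28],
    [(2, 5, 1/7*√65)],
    [[1, 2, 3], [1, 4, 5], [2, 4], [3, 5]]⟩,
  ⟨5, [(1, 2, 4, 2/53*√29), (1, 3, 5, 6/53*√58)],
    [36/53, -22/53, -3/53, 14/53, 33/53],
    [(1, 2, 2/53*√1102)],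
    [[1, 3], [1, 5], [2], [2, 3, 5]]⟩,
  ⟨5, [(1, 2, 5, 1/3*√3)],
    [1/4, 1/4, -1/4, -1/4, 1/2],
    [(1, 3, 1/6*√15), (2, 4, 1/6*√15)],
    [[1, 2], [1, 4, 5], [3, 4]]⟩,
  ⟨5, [(1, 2, 5, 1/5*√7)],
    [9/10, -1/2, 3/10, 3/10, 2/5],
    [(1, 2, 7/5)],
    [[1, 3, 4, 5], [1, 3, 5], [1, 5], [2, 3, 4, 5], [2, 3, 5], [2, 5]]⟩,
  ⟨5, [(1, 2, 5, 1/5*√7)],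
    [1/5, 1/5, 1, -2/5, 2/5],
    [(3, 4, 7/5)],
    [[1, 2, 3], [1, 2, 4], [1, 3, 5], [1, 4, 5], [3], [4]]⟩,
  ⟨5, [(1, 2, 5, 1/21*√322)],
    [2/3, -1/21, -3/7, 2/7, 13/21],
    [(1, 3, 1/21*√690)],
    [[1, 2], [1, 2, 4], [1, 4, 5], [1, 5], [2, 3, 4, 5], [2, 3, 5], [3], [3, 4]]⟩,
  ⟨5, [(1, 2, 5, 1/21*√322)],
    [-1/21, -1/21, 1, 2/7, -2/21],
    [(3, 5, 1/21*√690)],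
    [[1, 2, 3], [1, 2, 3, 4], [1, 4, 5], [1, 5], [3], [3, 4]]⟩,
  ⟨5, [(1, 2, 5, 2/65*√322)],
    [21/65, -5/13, 42/65, 12/65, -4/65],
    [(3, 5, 2/65*√690), (1, 2, 46/65)],
    [[1, 4, 5], [1, 5], [2, 4, 5], [2, 5]]⟩,
  ⟨5, [(1, 2, 5, 1/3*√3)],
    [1/4, -1/6, 7/12, -1/4, 1/12],
    [(1, 4, 1/6*√15), (3, 5, 1/6*√15)],
    [[1, 2, 3], [1, 5], [2, 4, 5], [3, 4]]⟩,
  ⟨5, [(1, 2, 5, 2/17*√7)],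
    [9/17, -5/17, 10/17, -4/17, 4/17],
    [(1, 2, 14/17), (3, 4, 14/17)],
    [[1, 3, 5], [1, 4, 5], [2, 3, 5], [2, 4, 5]]⟩,
  ⟨5, [(1, 2, 5, 3/11), (3, 4, 5, 3/11)],
    [6/11, -3/11, 6/11, -3/11, 3/11],
    [(1, 2, 9/11), (3, 4, 9/11)],
    [[1, 3, 5], [1, 4, 5], [2, 4, 5]]⟩,
  ⟨5, [(1, 2, 5, 3/11), (3, 4, 5, 3/11)],
    [6/11, -3/11, 6/11, -3/11, 3/11],
    [(1, 2, 9/11), (3, 4, -9/11)],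
    [[1, 3, 5], [1, 4, 5], [2, 4, 5]]⟩,
  ⟨5, [(1, 2, 5, 3/11), (3, 4, 5, 3/11)],
    [6/11, -3/11, 6/11, -3/11, 3/11],
    [(1, 4, 9/11), (3, 2, 9/11)],
    [[1, 2], [1, 3, 5], [2, 4, 5]]⟩,
  ⟨5, [(1, 2, 5, 6/13), (3, 4, 5, 6/13)],
    [12/13, -6/13, 3/13, 3/13, 6/13],
    [(1, 2, 18/13)],
    [[1, 3, 5], [2, 3, 5]]⟩,
  ⟨5, [],
    [7/12, 7/12, -1/4, -1/4, 1/6],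
    [(1, 3, 5/6), (2, 4, 5/6)],
    [[1, 2], [1, 2, 5], [1, 4], [1, 4, 5], [3, 4], [3, 4, 5]]⟩,
  ⟨5, [],
    [1, -3/7, 2/7, 2/7, 2/7],
    [(1, 2, 10/7)],
    [[1], [1, 3], [1, 3, 4], [1, 3, 4, 5], [2], [2, 3], [2, 3, 4], [2, 3, 4, 5]]⟩]

def tableRows : List TableRow := table34 ++ table5

/-- An entry of the tables: a row together with one of its metrics. -/
abbrev TableEntry : Type :=
  Σ r : Fin tableRows.length, Fin (tableRows.get r).signatures.length

namespace TableEntry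

def row (t : TableEntry) : TableRow := tableRows.get t.1

def timelike (t : TableEntry) : List ℕ := (tableRows.get t.1).signatures.get t.2

/-- `d` is the Lie algebra, derivation and metric described by the entry `t`. The structure
constants are `c i j k = e^k([e_i, e_j]) = -de^k(e_i, e_j)`. -/
def Describes (t : TableEntry) (d : Datum t.row.size) : Prop :=
  (∀ i j k : Fin t.row.size, d.L.c i j k =
    -(t.row.brackets.map fun b =>
      if b.2.2.1 = k.val + 1 then
        (if b.1 = i.val + 1 ∧ b.2.1 = j.val + 1 then b.2.2.2 else 0)
          - (if b.1 = j.val + 1 ∧ b.2.1 = i.val + 1 then b.2.2.2 else 0)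
      else 0).sum) ∧
  (∀ i j : Fin t.row.size, d.D j i =
    (if i = j then t.row.diagonal.getD i.val 0 else 0) +
    (t.row.offDiagonal.map fun a =>
      if a.1 = i.val + 1 ∧ a.2.1 = j.val + 1 then a.2.2 else 0).sum) ∧
  (∀ i : Fin t.row.size, d.ε i = if i.val + 1 ∈ t.timelike then -1 else 1)

end TableEntry

end NiceNil

end

/-! Both halves of the theorem rest on rewriting the definition of a solution without reference to a
triple. Attach to each bracket the weight ε_i ε_j ε_k c_{ijk}² and to each off-diagonal entry the
weight ε_i ε_j a_{ji}². The conditions on signs and absolute values say exactly that x_I is the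
weight of the row I and that 2 A^i_j Tr D is the weight of (i, j). What remains is a system in c, D
and ε alone, `Datum.NondiagonalEquations`, whose main member is a balance equation at every node. It
is equivalent to the definition by `IsNondiagonalSolution.equations` and
`NondiagonalEquations.isNondiagonalSolution`.

Geometry. In a nice basis the Ricci tensor is diagonal, and its entries are the weights transported
by the transposed root matrix. Pairing the balance equations with λ ∈ ker M gives Σ λ_i² = Tr D, and
with this they become the diagonal part of the nilsoliton equation. Off the diagonal, Tr D = λ_i −
λ_j makes ½[D, D*] cancel (Tr D) D^s. The Einstein condition on the extension is then read off in an
orthonormal frame; its mixed components vanish because no arrow of the diagram joins the two nodes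
of a pair in either direction. For pseudo-Iwasawa type, Tr ad x is Tr D times the e_0-component of
x, so every nilpotent ideal lies in 𝔤. Orthogonality and nondegeneracy then put e_0 into the abelian
factor, and D would be symmetric, whereas a_{ji} ≠ 0 = a_{ij} for some pair.

Classification. Numbering the nodes along the arrows leaves finitely many possible supports: a set S
of triples i < j < k carrying the brackets, and a set P of one or two disjoint pairs carrying the
off-diagonal entries, since three pairs would need six nodes. A support is discarded if some
derivation identity has a single nonzero term. The others agree, up to permutation, with the support
of a row of the tables or with one of six further supports (`classified_supports`). On a fixed
support, λ and the weights divided by 2 Tr D solve a linear system. In the cases that occur,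
elimination over ℚ leaves at most one free unknown, and a derivation identity with two terms,
squared so as to involve weights only, determines it. Thus the support determines λ and the weights;
only signs remain, and these are enumerated (`completeRow_supports`).

No square root enters the computation. The map x ↦ x|x| is injective and multiplicative, so the
identities to be tested, which are monomial or have two terms, can be tested on signed squares, and
these are rational. Finally, an equivalence is a permutation of the basis combined with signs
(`Equivalent.exists_signedPermutation`), so that both the matching of a solution with an entry and
the inequivalence of distinct entries are finite searches. -/

namespace NiceNil

/-! ### The tables in terms of rational signed squares -/

/-- A pair of arrows, given by source, label and target. -/
abbrev Tri : Type := ℕ × ℕ × ℕ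

/-- The nonzero structure constants, the diagonal and the off-diagonal entries of a datum; structure
constants and off-diagonal entries are replaced by their signed squares. -/
structure Profile where
  size : ℕ
  br : List (Tri × ℚ)
  diag : List ℚ
  off : List ((ℕ × ℕ) × ℚ)

/-- A row of the tables with rational entries, with nodes numbered from zero. -/
structure RatRow extends Profile where
  sigs : List (List ℕ)

/-- The rows of the tables, in the same order. -/
def ratRows : List RatRow := [
  ⟨⟨3, [((0, 1, 2), -16/49)],
    [6/7, -2/7, 4/7],
    [((0, 1), 64/49)]⟩,
    [[0, 2], [1, 2]]⟩,
  ⟨⟨3, [],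
    [1, -1/5, 2/5],
    [((0, 1), 36/25)]⟩,
    [[0], [0, 2], [1], [1, 2]]⟩,
  ⟨⟨4, [((0, 1, 2), -196/867), ((0, 2, 3), -98/153)],
    [28/51, -7/17, 7/51, 35/51],
    [((0, 1), 1078/867)]⟩,
    [[0, 2], [1, 2, 3]]⟩,
  ⟨⟨4, [((0, 1, 3), -88/289)],
    [15/17, -7/17, 6/17, 8/17],
    [((0, 1), 484/289)]⟩,
    [[0, 2, 3], [0, 3], [1, 2, 3], [1, 3]]⟩,
  ⟨⟨4, [((0, 1, 3), -2/3)],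
    [0, 0, 1, 0],
    [((2, 3), 4/3)]⟩,
    [[0, 1, 2], [0, 3], [2]]⟩,
  ⟨⟨4, [((0, 1, 3), -2/3)],
    [2/3, 0, -1/3, 2/3],
    [((0, 2), 4/3)]⟩,
    [[0, 1], [0, 3], [1, 2, 3], [2]]⟩,
  ⟨⟨4, [((0, 1, 3), -8/27)],
    [1/3, -1/3, 2/3, 0],
    [((0, 1), 4/9), ((2, 3), 16/27)]⟩,
    [[0, 3], [1, 3]]⟩,
  ⟨⟨4, [],
    [1, -1/3, 1/3, 1/3],
    [((0, 1), 16/9)]⟩,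
    [[0], [0, 2], [0, 2, 3], [1], [1, 2], [1, 2, 3]]⟩,
  ⟨⟨4, [],
    [3/5, 3/5, -1/5, -1/5],
    [((0, 2), 16/25), ((1, 3), 16/25)]⟩,
    [[0, 1], [0, 3], [2, 3]]⟩,
  ⟨⟨5, [((0, 1, 2), -9/20), ((0, 2, 3), -9/50), ((0, 3, 4), -9/20)],
    [-3/10, 3/4, 9/20, 3/20, -3/20],
    [((1, 4), 63/50)]⟩,
    [[0, 1, 3], [0, 2, 4]]⟩,
  ⟨⟨5, [((0, 1, 2), -242/8427), ((0, 2, 3), -242/477), ((0, 3, 4), -1452/2809)],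
    [55/159, -22/53, -11/159, 44/159, 33/53],
    [((0, 1), 9196/8427)]⟩,
    [[0, 3], [1]]⟩,
  ⟨⟨5, [((0, 1, 2), -100/961), ((0, 2, 3), -75/961), ((1, 2, 4), -75/961)],
    [15/31, -10/31, 5/31, 20/31, -5/31],
    [((0, 1), 625/961), ((3, 4), 625/961)]⟩,
    [[0, 2, 4], [1, 2, 3]]⟩,
  ⟨⟨5, [((0, 1, 3), -32/45), ((0, 3, 4), -16/75)],
    [-2/15, 2/3, -2/5, 8/15, 2/5],
    [((1, 2), 112/75)]⟩,
    [[0, 1, 4], [0, 2, 3], [1, 3, 4], [2]]⟩,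
  ⟨⟨5, [((0, 1, 3), -50/867), ((0, 3, 4), -50/153)],
    [10/51, -5/17, 10/17, -5/51, 5/51],
    [((0, 1), 350/867), ((2, 4), 350/867)]⟩,
    [[0, 2, 3], [1, 3, 4]]⟩,
  ⟨⟨5, [((0, 1, 3), -16/75), ((0, 3, 4), -32/45)],
    [-2/15, 1/5, 1, 1/15, -1/15],
    [((2, 4), 112/75)]⟩,
    [[0, 1, 4], [0, 2, 3], [1, 3, 4], [2]]⟩,
  ⟨⟨5, [((0, 1, 3), -32/63), ((0, 3, 4), -32/63)],
    [1/3, -1/21, -3/7, 2/7, 13/21],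
    [((0, 2), 160/147)]⟩,
    [[0, 1, 4], [0, 3], [1, 2, 3, 4], [2]]⟩,
  ⟨⟨5, [((0, 1, 3), -16/75), ((0, 3, 4), -32/45)],
    [17/30, -1/2, 3/10, 1/15, 19/30],
    [((0, 1), 112/75)]⟩,
    [[0, 2, 3], [0, 3], [1, 2, 3, 4], [1, 3, 4]]⟩,
  ⟨⟨5, [((0, 1, 3), -216/289), ((0, 2, 4), -36/289), ((1, 3, 4), -72/289)],
    [12/17, -3/17, -6/17, 9/17, 6/17],
    [((0, 2), 432/289)]⟩,
    [[1, 2, 3], [2]]⟩,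
  ⟨⟨5, [((0, 1, 3), -3888/13225), ((0, 2, 4), -405/11638), ((1, 3, 4), -1539/58190)],
    [-9/23, 36/115, 72/115, -9/115, 27/115],
    [((1, 0), 143127/290950), ((2, 3), -7533/11638)]⟩,
    [[0, 3, 4], [1, 3]]⟩,
  ⟨⟨5, [((0, 1, 3), -102/361), ((0, 2, 4), -36/361)],
    [3/19, 6/19, -6/19, 9/19, -3/19],
    [((0, 2), 132/361), ((1, 4), 150/361)]⟩,
    [[0, 3, 4], [2, 4]]⟩,
  ⟨⟨5, [((0, 1, 3), -9/121), ((0, 2, 4), -9/121)],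
    [1/11, 6/11, -3/11, 7/11, -2/11],
    [((1, 2), 81/121), ((3, 4), 81/121)]⟩,
    [[0, 1, 4], [0, 2, 3], [1, 3], [2, 4]]⟩,
  ⟨⟨5, [((0, 1, 3), -1/6), ((0, 2, 4), -1/6)],
    [-1/3, 1/3, 1/3, 0, 0],
    [((1, 4), 5/18), ((2, 3), -5/18)]⟩,
    [[0, 1, 2], [0, 3, 4], [1, 3]]⟩,
  ⟨⟨5, [((0, 1, 3), -1/6), ((0, 2, 4), -1/6)],
    [-1/3, 1/3, 1/3, 0, 0],
    [((1, 4), 5/18), ((2, 3), 5/18)]⟩,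
    [[0, 1, 2], [0, 3, 4], [1, 3]]⟩,
  ⟨⟨5, [((0, 1, 3), -13/28), ((0, 2, 4), -13/28)],
    [-3/14, 3/4, 1/28, 15/28, -5/28],
    [((1, 4), 65/49)]⟩,
    [[0, 1, 2], [0, 3, 4], [1, 3], [2, 4]]⟩,
  ⟨⟨5, [((0, 1, 3), -116/2809), ((0, 2, 4), -2088/2809)],
    [36/53, -22/53, -3/53, 14/53, 33/53],
    [((0, 1), 4408/2809)]⟩,
    [[0, 2], [0, 4], [1], [1, 2, 4]]⟩,
  ⟨⟨5, [((0, 1, 4), -1/3)],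
    [1/4, 1/4, -1/4, -1/4, 1/2],
    [((0, 2), 5/12), ((1, 3), 5/12)]⟩,
    [[0, 1], [0, 3, 4], [2, 3]]⟩,
  ⟨⟨5, [((0, 1, 4), -7/25)],
    [9/10, -1/2, 3/10, 3/10, 2/5],
    [((0, 1), 49/25)]⟩,
    [[0, 2, 3, 4], [0, 2, 4], [0, 4], [1, 2, 3, 4], [1, 2, 4], [1, 4]]⟩,
  ⟨⟨5, [((0, 1, 4), -7/25)],
    [1/5, 1/5, 1, -2/5, 2/5],
    [((2, 3), 49/25)]⟩,
    [[0, 1, 2], [0, 1, 3], [0, 2, 4], [0, 3, 4], [2], [3]]⟩,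
  ⟨⟨5, [((0, 1, 4), -46/63)],
    [2/3, -1/21, -3/7, 2/7, 13/21],
    [((0, 2), 230/147)]⟩,
    [[0, 1], [0, 1, 3], [0, 3, 4], [0, 4], [1, 2, 3, 4], [1, 2, 4], [2], [2, 3]]⟩,
  ⟨⟨5, [((0, 1, 4), -46/63)],
    [-1/21, -1/21, 1, 2/7, -2/21],
    [((2, 4), 230/147)]⟩,
    [[0, 1, 2], [0, 1, 2, 3], [0, 3, 4], [0, 4], [2], [2, 3]]⟩,
  ⟨⟨5, [((0, 1, 4), -1288/4225)],
    [21/65, -5/13, 42/65, 12/65, -4/65],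
    [((2, 4), 552/845), ((0, 1), 2116/4225)]⟩,
    [[0, 3, 4], [0, 4], [1, 3, 4], [1, 4]]⟩,
  ⟨⟨5, [((0, 1, 4), -1/3)],
    [1/4, -1/6, 7/12, -1/4, 1/12],
    [((0, 3), 5/12), ((2, 4), 5/12)]⟩,
    [[0, 1, 2], [0, 4], [1, 3, 4], [2, 3]]⟩,
  ⟨⟨5, [((0, 1, 4), -28/289)],
    [9/17, -5/17, 10/17, -4/17, 4/17],
    [((0, 1), 196/289), ((2, 3), 196/289)]⟩,
    [[0, 2, 4], [0, 3, 4], [1, 2, 4], [1, 3, 4]]⟩,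
  ⟨⟨5, [((0, 1, 4), -9/121), ((2, 3, 4), -9/121)],
    [6/11, -3/11, 6/11, -3/11, 3/11],
    [((0, 1), 81/121), ((2, 3), 81/121)]⟩,
    [[0, 2, 4], [0, 3, 4], [1, 3, 4]]⟩,
  ⟨⟨5, [((0, 1, 4), -9/121), ((2, 3, 4), -9/121)],
    [6/11, -3/11, 6/11, -3/11, 3/11],
    [((0, 1), 81/121), ((2, 3), -81/121)]⟩,
    [[0, 2, 4], [0, 3, 4], [1, 3, 4]]⟩,
  ⟨⟨5, [((0, 1, 4), -9/121), ((2, 3, 4), -9/121)],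
    [6/11, -3/11, 6/11, -3/11, 3/11],
    [((0, 3), 81/121), ((2, 1), 81/121)]⟩,
    [[0, 1], [0, 2, 4], [1, 3, 4]]⟩,
  ⟨⟨5, [((0, 1, 4), -36/169), ((2, 3, 4), -36/169)],
    [12/13, -6/13, 3/13, 3/13, 6/13],
    [((0, 1), 324/169)]⟩,
    [[0, 2, 4], [1, 2, 4]]⟩,
  ⟨⟨5, [],
    [7/12, 7/12, -1/4, -1/4, 1/6],
    [((0, 2), 25/36), ((1, 3), 25/36)]⟩,
    [[0, 1], [0, 1, 4], [0, 3], [0, 3, 4], [2, 3], [2, 3, 4]]⟩,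
  ⟨⟨5, [],
    [1, -3/7, 2/7, 2/7, 2/7],
    [((0, 1), 100/49)]⟩,
    [[0], [0, 2], [0, 2, 3], [0, 2, 3, 4], [1], [1, 2], [1, 2, 3], [1, 2, 3, 4]]⟩
]

/-! ### Diagrams, linear systems and their solutions by computation -/
/-- The increasing triples of nodes. -/
def triples (n : ℕ) : List Tri :=
  (List.range n).flatMap fun k => (List.range k).flatMap fun j => (List.range j).map fun i => (i, j, k)

/-- There is an arrow from `i` to `k` with label `j`. -/
def hasTri (S : List Tri) (i j k : ℕ) : Bool :=
  S.any fun t => t.2.2.beq k && ((t.1.beq i && t.2.1.beq j) || (t.1.beq j && t.2.1.beq i))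

/-- The pair `(i, j)` is listed. -/
def hasPair (P : List (ℕ × ℕ)) (i j : ℕ) : Bool := P.any fun p => p.1.beq i && p.2.beq j

/-- There are concatenated arrows from `{{i, j}, k}` to `l`. -/
def hasComp (S : List Tri) (i j k l : ℕ) : Bool :=
  S.any fun t => ((t.1.beq i && t.2.1.beq j) || (t.1.beq j && t.2.1.beq i)) && hasTri S t.2.2 k l

/-- Two pairs of arrows do not violate the uniqueness of labels, sources and targets. -/
def compatible (t u : Tri) : Bool :=
  !((t.1.beq u.1 && t.2.1.beq u.2.1) ||
    (t.2.2.beq u.2.2 && (t.1.beq u.1 || t.2.1.beq u.2.1 || t.1.beq u.2.1 || t.2.1.beq u.1)))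

/-- A relation holds between each element of a list and the later ones. -/
def pairwiseB {α : Type} (r : α → α → Bool) : List α → Bool
  | [] => true
  | a :: l => l.all (r a) && pairwiseB r l

/-- The condition on concatenated arrows in a nice diagram. -/
def concatOK (S : List Tri) : Bool :=
  S.all fun t => S.all fun u =>
    [(u.1, u.2.1), (u.2.1, u.1)].all fun p =>
      !(p.1.beq t.2.2) || p.2.beq t.1 || p.2.beq t.2.1 ||
        hasComp S t.2.1 p.2 t.1 u.2.2 || hasComp S p.2 t.1 t.2.1 u.2.2

/-- The nice diagrams whose arrows increase. -/
def diagramSets (n : ℕ) : List (List Tri) :=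
  ((triples n).sublists).filter fun S => pairwiseB compatible S && concatOK S

/-- The pairs of distinct nodes. -/
def pairs (n : ℕ) : List (ℕ × ℕ) :=
  (List.range n).flatMap fun i => ((List.range n).filter fun j => !(i.beq j)).map fun j => (i, j)

/-- Two pairs have no node in common. -/
def disjointPairs (p q : ℕ × ℕ) : Bool :=
  !(p.1.beq q.1 || p.1.beq q.2 || p.2.beq q.1 || p.2.beq q.2)

/-- The sets of one or two disjoint pairs. -/
def arrowSets (n : ℕ) : List (List (ℕ × ℕ)) :=
  (pairs n).flatMap fun p =>
    -- Disjoint pairs have different first nodes, so ordering by first nodes lists each set of two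
    -- pairs once.
    [p] :: ((pairs n).filter fun q => Nat.blt p.1 q.1 && disjointPairs p q).map fun q => [p, q]

/-- No arrow connects the nodes of a pair. -/
def noArrowOK (S : List Tri) (P : List (ℕ × ℕ)) : Bool :=
  P.all fun p => S.all fun t => !(t.2.2.beq p.2 && (t.1.beq p.1 || t.2.1.beq p.1))

/-- The nonzero terms of the derivation property at the nodes `i, j, l`. -/
def leibnizTerms (n : ℕ) (S : List Tri) (P : List (ℕ × ℕ)) (i j l : ℕ) :
    List (Bool × Tri × (ℕ × ℕ)) :=
  (List.range n).flatMap fun h =>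
    (bif hasTri S i j h && hasPair P h l then [(true, (i, j, h), (h, l))] else []) ++
    ((bif hasPair P i h && hasTri S h j l then [(false, (h, j, l), (i, h))] else []) ++
    (bif hasPair P j h && hasTri S i h l then [(false, (i, h, l), (j, h))] else []))

/-- The nodes at which the derivation property may have a nonzero term. -/
def triggers (S : List Tri) (P : List (ℕ × ℕ)) : List Tri :=
  (S.flatMap fun t => P.flatMap fun p =>
    (bif t.2.2.beq p.1 then [(t.1, t.2.1, p.2)] else []) ++
    ((bif t.1.beq p.2 then [(p.1, t.2.1, t.2.2)] else []) ++
    (bif t.2.1.beq p.2 then [(t.1, p.1, t.2.2)] else []))).filter fun t => !(t.1.beq t.2.1)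

/-- The lists of nonzero terms of the derivation property. -/
def relations (n : ℕ) (S : List Tri) (P : List (ℕ × ℕ)) : List (List (Bool × Tri × (ℕ × ℕ))) :=
  (triggers S P).map fun t => leibnizTerms n S P t.1 t.2.1 t.2.2

/-- The Kronecker symbol. -/
def delta (a b : ℕ) : ℚ := bif a.beq b then 1 else 0

/-- An entry of the root matrix. -/
def rootCoeff (l : ℕ) (t : Tri) : ℚ := delta l t.2.2 - delta l t.1 - delta l t.2.1

/-- A linear equation in the diagonal entries, the weights of the pairs and those of the triples. -/
def mkRow (n : ℕ) (S : List Tri) (P : List (ℕ × ℕ)) (f : ℕ → ℚ) (g : ℕ × ℕ → ℚ) (h : Tri → ℚ)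
    (c : ℚ) : List ℚ :=
  (List.range n).map f ++ (P.map g ++ (S.map h ++ [c]))

/-- The linear equations satisfied by a solution with given support, normalized by twice the trace. -/
def linearSystem (n : ℕ) (S : List Tri) (P : List (ℕ × ℕ)) : List (List ℚ) :=
  (S.map fun t => mkRow n S P (fun l => rootCoeff l t) (fun _ => 0) (fun _ => 0) 0) ++
  ((P.map fun p => mkRow n S P (fun l => 1 - delta l p.1 + delta l p.2) (fun _ => 0) (fun _ => 0) 0) ++
  -- Balance at the node l. Before division by 2 Tr D it contains the quadratic term (Tr D) λ_l;
  -- afterwards it is linear in λ and the normalized weights.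
  ((List.range n).map fun l => mkRow n S P (fun l' => - delta l l')
    (fun p => 1 - delta l p.1 + delta l p.2) (rootCoeff l) 1))

/-- Subtract `f` times the second row from the first. -/
def subRow (f : ℚ) : List ℚ → List ℚ → List ℚ
  | [], [] => []
  | [], b :: l => (- (f * b)) :: subRow f [] l
  | a :: l, [] => a :: l
  | a :: l, b :: l' => (a - f * b) :: subRow f l l'

/-- Clear the column `c` of `r` by means of the pivot row `p`. -/
def reduceBy (c : ℕ) (p r : List ℚ) : List ℚ :=
  bif r.getD c 0 == 0 then r else subRow (r.getD c 0) r p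

/-- Find a row with a nonzero entry in the column `c`. -/
def extractPivot (c : ℕ) : List (List ℚ) → Option (List ℚ × List (List ℚ))
  | [] => none
  | r :: rs => bif r.getD c 0 == 0 then (extractPivot c rs).map fun q => (q.1, r :: q.2)
      else some (r, rs)

/-- Gauss-Jordan elimination; the result is the reduced system with the list of free columns. -/
def gauss : List ℕ → List (List ℚ) → List (List ℚ) → List ℕ → List (List ℚ) × List ℕ
  | [], done, _, free => (done, free)
  | c :: cs, done, todo, free =>
    match extractPivot c todo with
    | none => gauss cs done todo (c :: free)
    | some (p, rest) =>
      let p' := p.map ((p.getD c 0)⁻¹ * ·)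
      gauss cs (p' :: done.map (reduceBy c p')) (rest.map (reduceBy c p')) free

/-- The value of the unknown `k` as an affine function of the unknown `f`. -/
def readAffine (N f : ℕ) (rows : List (List ℚ)) (k : ℕ) : Option (ℚ × ℚ) :=
  bif k.beq f then some (0, 1) else
  -- Only a row supported on the columns k, f and the constant column, with entry 1 at k, is
  -- accepted; a second free unknown occurring in it makes the reading fail.
  (rows.find? fun r => r ==
    (List.range (N + 1)).map fun c => bif c.beq k then 1 else bif c.beq f then r.getD f 0
      else bif c.beq N then r.getD N 0 else 0).map fun r => (- r.getD N 0, - r.getD f 0)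

/-- The position of a pair in a list. -/
def indexP (p : ℕ × ℕ) : List (ℕ × ℕ) → ℕ
  | [] => 0
  | q :: l => bif q.1.beq p.1 && q.2.beq p.2 then 0 else indexP p l + 1

/-- The position of a triple in a list, up to exchanging source and label. -/
def indexT (t : Tri) : List Tri → ℕ
  | [] => 0
  | u :: l => bif u.2.2.beq t.2.2 && ((u.1.beq t.1 && u.2.1.beq t.2.1) ||
      (u.1.beq t.2.1 && u.2.1.beq t.1)) then 0 else indexT t l + 1

/-- The value of the free unknown determined by the first quadratic relation. -/
def solveFree (n : ℕ) (S : List Tri) (P : List (ℕ × ℕ)) (aff : List (ℚ × ℚ)) :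
    List (List (Bool × Tri × (ℕ × ℕ))) → Option ℚ
  | [(_, t, p), (_, t', p')] :: _ =>
    -- The signs of the two terms do not matter, because the weights satisfy the squared identity.
    -- Each factor is affine in the free unknown t, and c0 + c1 t + c2 t² is the difference of the
    -- two products.
    let a := aff.getD (n + indexP p P) 0
    let y := aff.getD (n + P.length + indexT t S) 0
    let a' := aff.getD (n + indexP p' P) 0
    let y' := aff.getD (n + P.length + indexT t' S) 0
    let c0 := a.1 * y.1 - a'.1 * y'.1
    let c1 := a.1 * y.2 + a.2 * y.1 - (a'.1 * y'.2 + a'.2 * y'.1)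
    let c2 := a.2 * y.2 - a'.2 * y'.2
    -- The equation is used only when its quadratic part cancels, so that it has a unique root.
    bif c2 == 0 && !(c1 == 0) then some (-c0 / c1) else none
  | _ => none

/-- The only possible solution of the equations with given support. -/
def solveCase (n : ℕ) (S : List Tri) (P : List (ℕ × ℕ)) : Option (List ℚ) :=
  let N := n + P.length + S.length
  let g := gauss (List.range N) [] (linearSystem n S P) []
  -- The default N + 1 means that no unknown is free: it lies beyond the constant column N, where
  -- every row and the solution vector read as zero. Free columns are less than N, so the value N
  -- never occurs.
  let f := g.2.headD (N + 1)
  bif f.beq N then none else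
  ((List.range N).mapM (readAffine N f g.1)).bind fun aff =>
    (bif Nat.blt N f then some 0 else solveFree n S P aff (relations n S P)).map fun t =>
      aff.map fun a => a.1 + a.2 * t

end NiceNil

/-! ### Matching of supports and profiles, and the exhaustive checks -/

namespace NiceNil

/-- A permutation of the nodes maps one pair of arrows to another. -/
def keyMatch (p : List ℕ) (t t' : Tri) : Bool :=
  t'.2.2.beq (p.getD t.2.2 0) &&
    ((t'.1.beq (p.getD t.1 0) && t'.2.1.beq (p.getD t.2.1 0)) ||
      (t'.1.beq (p.getD t.2.1 0) && t'.2.1.beq (p.getD t.1 0)))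

/-- A permutation of the nodes maps one pair to another. -/
def pairMatch (p : List ℕ) (a a' : ℕ × ℕ) : Bool :=
  a'.1.beq (p.getD a.1 0) && a'.2.beq (p.getD a.2 0)

/-- A permutation of the nodes maps one support to another. -/
def supportMatch (S : List Tri) (P : List (ℕ × ℕ)) (S' : List Tri) (P' : List (ℕ × ℕ))
    (p : List ℕ) : Bool :=
  (P.all fun a => P'.any (pairMatch p a)) && (P'.all fun a' => P.any (pairMatch p · a')) &&
  (S.all fun t => S'.any (keyMatch p t)) && (S'.all fun t' => S.any (keyMatch p · t'))

/-- The triples of a profile. -/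
def Profile.S (q : Profile) : List Tri := q.br.map Prod.fst

/-- The pairs of a profile. -/
def Profile.P (q : Profile) : List (ℕ × ℕ) := q.off.map Prod.fst

/-- Supports that pass the combinatorial tests but carry no solution. -/
def obstructedSupports : List (ℕ × List Tri × List (ℕ × ℕ)) := [
  (4, [(0, 1, 2), (0, 2, 3)], [(1, 3)]),
  (5, [(0, 1, 2), (0, 2, 3)], [(0, 4), (1, 3)]),
  (5, [(0, 1, 2), (0, 2, 3)], [(1, 3)]),
  (5, [(0, 1, 2), (0, 2, 3), (1, 2, 4)], [(0, 4)]),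
  (5, [(0, 1, 2), (0, 2, 3), (1, 2, 4)], [(0, 4), (1, 3)]),
  (5, [(0, 1, 2), (0, 2, 3), (0, 3, 4)], [(1, 3), (2, 4)])]

/-- The supports of the rows of the tables, and the obstructed ones. -/
def supports : List (ℕ × List Tri × List (ℕ × ℕ)) :=
  (ratRows.map fun q => (q.size, q.S, q.P)) ++ obstructedSupports

/-- The support passes the combinatorial tests. -/
def admissible (n : ℕ) (S : List Tri) (P : List (ℕ × ℕ)) : Bool :=
  noArrowOK S P && (relations n S P).all fun r => !(r.length.beq 1)

/-- Each admissible support is listed up to permutation. -/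
def classified (cl : List (ℕ × List Tri × List (ℕ × ℕ))) (n : ℕ) : Bool :=
  (diagramSets n).all fun S =>
    (fun cS : List (ℕ × List Tri × List (ℕ × ℕ)) => (arrowSets n).all fun P => !(admissible n S P) ||
      cS.any fun q => q.2.2.length.beq P.length &&
        (List.range n).permutations'.any (supportMatch S P q.2.1 q.2.2))
    (cl.filter fun q => q.1.beq n && q.2.1.length.beq S.length)

/-- The choices of signs for a list of values. -/
def signChoices {α : Type} : List (α × ℚ) → List (List (α × ℚ))
  | [] => [[]]
  | a :: l => (signChoices l).flatMap fun c => [a :: c, (a.1, -a.2) :: c]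

/-- The lists of signs. -/
def signLists : ℕ → List (List ℚ)
  | 0 => [[]]
  | n + 1 => (signLists n).flatMap fun c => [1 :: c, (-1) :: c]

/-- A permutation with signs maps one bracket to another. -/
def brMatch (p : List ℕ) (s : List ℚ) (b b' : Tri × ℚ) : Bool :=
  b'.1.2.2.beq (p.getD b.1.2.2 0) &&
    ((b'.1.1.beq (p.getD b.1.1 0) && b'.1.2.1.beq (p.getD b.1.2.1 0) &&
        b'.2 == s.getD b.1.1 0 * s.getD b.1.2.1 0 * s.getD b.1.2.2 0 * b.2) ||
      (b'.1.1.beq (p.getD b.1.2.1 0) && b'.1.2.1.beq (p.getD b.1.1 0) &&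
        b'.2 == -(s.getD b.1.1 0 * s.getD b.1.2.1 0 * s.getD b.1.2.2 0 * b.2)))

/-- A permutation with signs maps one off-diagonal entry to another. -/
def offMatch (p : List ℕ) (s : List ℚ) (a a' : (ℕ × ℕ) × ℚ) : Bool :=
  pairMatch p a.1 a'.1 && a'.2 == s.getD a.1.1 0 * s.getD a.1.2 0 * a.2

/-- A permutation with signs maps the entries of one profile to those of another. -/
def signMatch (q q' : Profile) (p : List ℕ) (s : List ℚ) : Bool :=
  (q.br.all fun b => q'.br.any (brMatch p s b)) && (q.off.all fun b => q'.off.any (offMatch p s b))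

/-- A permutation maps one diagonal to the other. -/
def diagMatch (q q' : Profile) (p : List ℕ) : Bool :=
  (List.range q.size).all fun i => q.diag.getD i 0 == q'.diag.getD (p.getD i 0) 0

/-- The diagonal entries of one profile occur in the other. -/
def diagComparable (q q' : Profile) : Bool :=
  q.size.beq q'.size && q.diag.all fun x => q'.diag.any fun y => x == y

/-- The signed square of a structure constant. -/
def brValue : List (Tri × ℚ) → ℕ → ℕ → ℕ → ℚ
  | [], _, _, _ => 0
  | b :: l, i, j, k =>
    bif b.1.2.2.beq k && (b.1.1.beq i && b.1.2.1.beq j) then b.2 else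
    bif b.1.2.2.beq k && (b.1.1.beq j && b.1.2.1.beq i) then -b.2 else brValue l i j k

/-- The signed square of an off-diagonal entry. -/
def offValue : List ((ℕ × ℕ) × ℚ) → ℕ → ℕ → ℚ
  | [], _, _ => 0
  | a :: l, i, j => bif a.1.1.beq i && a.1.2.beq j then a.2 else offValue l i j

/-- The signed square of a term of the derivation property. -/
def termValue (br : List (Tri × ℚ)) (off : List ((ℕ × ℕ) × ℚ)) (r : Bool × Tri × (ℕ × ℕ)) : ℚ :=
  (bif r.1 then 1 else -1) * (brValue br r.2.1.1 r.2.1.2.1 r.2.1.2.2 * offValue off r.2.2.1 r.2.2.2)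

/-- The relation holds if it has two terms. -/
def relationOK (br : List (Tri × ℚ)) (off : List ((ℕ × ℕ) × ℚ))
    (r : List (Bool × Tri × (ℕ × ℕ))) : Bool :=
  !(r.length.beq 2) || (r.map (termValue br off)).sum == 0

/-- The sign of a node in the metric with timelike nodes `σ`. -/
def epsOf (σ : List ℕ) (i : ℕ) : ℚ := bif σ.any (Nat.beq i) then -1 else 1

/-- The signs of the nodes agree with the signs of the weights. -/
def epsValid (X : List (Tri × ℚ)) (b : List ((ℕ × ℕ) × ℚ)) (e : List ℚ) : Bool :=
  (X.all fun x => decide (0 < x.2 * e.getD x.1.1 0 * e.getD x.1.2.1 0 * e.getD x.1.2.2 0)) &&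
  (b.all fun x => decide (0 < x.2 * e.getD x.1.1 0 * e.getD x.1.2 0))

/-- Each solution with the given support matches a row of the list. -/
def completeRow (rr : List RatRow) (n : ℕ) (S : List Tri) (P : List (ℕ × ℕ)) : Bool :=
  match solveCase n S P with
  | none => false
  | some v =>
    let diag := v.take n
    let T := diag.sum
    let b := P.zip (((v.drop n).take P.length).map (2 * T * ·))
    let X := S.zip (((v.drop (n + P.length))).map (2 * T * ·))
    -- A solution has nonzero trace and nonzero weights on its support, so a degenerate vector
    -- excludes the support.
    (T == 0 || (b.any fun x => x.2 == 0) || (X.any fun x => x.2 == 0)) ||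
    (let q0 : Profile := ⟨n, X, diag, b⟩
     let keyCands : List (RatRow × List ℕ) := (rr.filter fun q' => diagComparable q0 q'.toProfile).flatMap
        fun q' => ((List.range n).permutations'.filter fun p => diagMatch q0 q'.toProfile p &&
          supportMatch S P q'.S q'.P p).map fun p => (q', p)
     let sl := signLists n
     let es := sl.filter (epsValid X b)
     -- The weights determine the brackets and off-diagonal entries up to sign. Each choice of signs
     -- compatible with the two-term derivation identities has to match a row.
     (signChoices X).all fun br => (signChoices b).all fun off =>
      let q : Profile := ⟨n, br, diag, off⟩
      !((relations n S P).all (relationOK br off)) ||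
      -- Changing the signs of basis vectors does not change ε, so the rescaling signs can be
      -- searched before any metric is considered.
      (let cands := keyCands.filter fun c => sl.any (signMatch q c.1.toProfile c.2)
       es.all fun e => cands.any fun c => c.1.sigs.any fun σ =>
        (List.range n).all fun i => e.getD i 0 == epsOf σ (c.2.getD i 0)))

end NiceNil

/-! ### Coordinates, and equivalences as signed permutations -/

noncomputable section

namespace NiceNil

namespace StructureConstants

variable {n : ℕ} (L : StructureConstants n)

/-- The basis `e_1, …, e_n`. -/
def basis : Module.Basis (Fin n) ℝ L.Carrier := Pi.basisFun ℝ (Fin n)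

@[simp] theorem basis_apply (i : Fin n) : L.basis i = L.e i := Pi.basisFun_apply ℝ (Fin n) i

@[simp] theorem basis_repr (x : L.Carrier) (i : Fin n) : L.basis.repr x i = L.coord x i :=
  rfl

theorem ext_coord {x y : L.Carrier} (h : ∀ k, L.coord x k = L.coord y k) : x = y := funext h

@[simp] theorem coord_e (i j : Fin n) : L.coord (L.e i) j = if j = i then 1 else 0 := by
  simp [coord, e, Pi.single_apply]

@[simp] theorem coord_add (x y : L.Carrier) (k : Fin n) :
    L.coord (x + y) k = L.coord x k + L.coord y k := rfl

@[simp] theorem coord_sub (x y : L.Carrier) (k : Fin n) :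
    L.coord (x - y) k = L.coord x k - L.coord y k := rfl

@[simp] theorem coord_neg (x : L.Carrier) (k : Fin n) : L.coord (-x) k = -L.coord x k := rfl

@[simp] theorem coord_zero (k : Fin n) : L.coord 0 k = 0 := rfl

@[simp] theorem coord_smul (t : ℝ) (x : L.Carrier) (k : Fin n) :
    L.coord (t • x) k = t * L.coord x k := rfl

@[simp] theorem coord_lie_e (i j k : Fin n) : L.coord ⁅L.e i, L.e j⁆ k = L.c i j k := by
  rw [lie_apply]
  simp

theorem coord_mapOf (M : Matrix (Fin n) (Fin n) ℝ) (x : L.Carrier) (k : Fin n) :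
    L.coord (L.mapOf M x) k = ∑ i, M k i * L.coord x i := rfl

@[simp] theorem coord_mapOf_e (M : Matrix (Fin n) (Fin n) ℝ) (i k : Fin n) :
    L.coord (L.mapOf M (L.e i)) k = M k i := by
  rw [coord_mapOf]
  simp

theorem coord_mapOf_lie_e (M : Matrix (Fin n) (Fin n) ℝ) (i j k : Fin n) :
    L.coord (L.mapOf M ⁅L.e i, L.e j⁆) k = ∑ h, L.c i j h * M k h := by
  rw [coord_mapOf]
  exact Finset.sum_congr rfl fun h _ => by rw [coord_lie_e, mul_comm]

theorem eq_sum (x : L.Carrier) : x = ∑ i, L.coord x i • L.e i := by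
  conv_lhs => rw [← L.basis.sum_repr x]
  simp

theorem coord_sum {ι : Type*} (s : Finset ι) (f : ι → L.Carrier) (k : Fin n) :
    L.coord (∑ i ∈ s, f i) k = ∑ i ∈ s, L.coord (f i) k :=
  Finset.sum_apply k s f

theorem coord_lie_e_left (i : Fin n) (y : L.Carrier) (k : Fin n) :
    L.coord ⁅L.e i, y⁆ k = ∑ h, L.coord y h * L.c i h k := by
  rw [lie_apply]
  simp

theorem coord_lie_e_right (i : Fin n) (y : L.Carrier) (k : Fin n) :
    L.coord ⁅y, L.e i⁆ k = ∑ h, L.coord y h * L.c h i k := by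
  rw [lie_apply]
  simp

/-- Bilinear maps are determined by their values on the basis. -/
theorem bilin_ext {M : Type*} [AddCommGroup M] [Module ℝ M] {f g : L.Carrier →ₗ[ℝ] L.Carrier →ₗ[ℝ] M}
    (h : ∀ i j, f (L.e i) (L.e j) = g (L.e i) (L.e j)) (x y : L.Carrier) : f x y = g x y := by
  have : f = g := LinearMap.ext_basis L.basis L.basis fun i j => by simpa using h i j
  rw [this]

/-- The bracket as a bilinear map. -/
def bracketMap {G : Type*} [LieRing G] [LieAlgebra ℝ G] : G →ₗ[ℝ] G →ₗ[ℝ] G :=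
  LinearMap.mk₂ ℝ (fun x y => ⁅x, y⁆) add_lie (fun t x y => smul_lie t x y) lie_add
    (fun t x y => lie_smul t x y)

theorem bracketMap_apply {G : Type*} [LieRing G] [LieAlgebra ℝ G] (x y : G) :
    bracketMap x y = ⁅x, y⁆ := rfl

/-- The derivation property in coordinates. -/
theorem leibniz_iff (D : Matrix (Fin n) (Fin n) ℝ) :
    (∀ x y : L.Carrier, L.mapOf D ⁅x, y⁆ = ⁅L.mapOf D x, y⁆ + ⁅x, L.mapOf D y⁆) ↔
      ∀ i j l, ∑ h, L.c i j h * D l h = ∑ h, D h i * L.c h j l + ∑ h, D h j * L.c i h l := by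
  have key : ∀ i j, (L.mapOf D ⁅L.e i, L.e j⁆ = ⁅L.mapOf D (L.e i), L.e j⁆ + ⁅L.e i, L.mapOf D (L.e j)⁆)
      ↔ ∀ l, ∑ h, L.c i j h * D l h = ∑ h, D h i * L.c h j l + ∑ h, D h j * L.c i h l := by
    intro i j
    refine ⟨fun h l => ?_, fun h => L.ext_coord fun l => ?_⟩
    · have := congrArg (fun v => L.coord v l) h
      simpa only [coord_add, coord_mapOf_lie_e, coord_lie_e_left, coord_lie_e_right,
        coord_mapOf_e] using this
    · simpa only [coord_add, coord_mapOf_lie_e, coord_lie_e_left, coord_lie_e_right,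
        coord_mapOf_e] using h l
  refine ⟨fun h i j => (key i j).1 (h _ _), fun h x y => ?_⟩
  have := L.bilin_ext (f := bracketMap.compr₂ (L.mapOf D))
    (g := bracketMap.comp (L.mapOf D) + bracketMap.compl₂ (L.mapOf D))
    (fun i j => (key i j).2 (h i j)) x y
  exact this

end StructureConstants

namespace Datum

variable {n : ℕ} (d : Datum n)

theorem leibniz_coord (i j l : Fin n) :
    ∑ h, d.L.c i j h * d.D l h = ∑ h, d.D h i * d.L.c h j l + ∑ h, d.D h j * d.L.c i h l :=
  (d.L.leibniz_iff d.D).1 d.leibniz i j l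

theorem derivation_apply (x : d.Alg) : d.derivation x = d.L.mapOf d.D x := rfl

/-- The sign `ε_i` as a real number. -/
def sgn (i : Fin n) : ℝ := ((d.ε i : ℤ) : ℝ)

theorem sgn_eq (i : Fin n) : d.sgn i = 1 ∨ d.sgn i = -1 := by
  rcases Int.units_eq_one_or (d.ε i) with h | h <;> simp [sgn, h]

@[simp] theorem sgn_mul_self (i : Fin n) : d.sgn i * d.sgn i = 1 := by
  rcases d.sgn_eq i with h | h <;> simp [h]

theorem sgn_ne_zero (i : Fin n) : d.sgn i ≠ 0 := by
  rcases d.sgn_eq i with h | h <;> simp [h]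

theorem metric_apply (x y : d.Alg) :
    d.metric x y = ∑ i, d.sgn i * (d.L.coord x i * d.L.coord y i) := by
  refine (Matrix.toBilin'_apply (Matrix.diagonal fun i => ((d.ε i : ℤ) : ℝ))
    (d.L.coord x) (d.L.coord y)).trans ?_
  refine Finset.sum_congr rfl fun i _ => ?_
  rw [Finset.sum_eq_single i]
  · simp only [Matrix.diagonal_apply_eq, sgn]; ring
  · intro j _ hj
    simp [Matrix.diagonal_apply_ne' _ hj]
  · simp

@[simp] theorem metric_e (i j : Fin n) :
    d.metric (d.L.e i) (d.L.e j) = if i = j then d.sgn i else 0 := by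
  rw [metric_apply]
  by_cases h : i = j
  · simp [h]
  · simp [h, Ne.symm h]

/-- Coordinates of an equivalence: a permutation of the basis together with signs. -/
structure IsSignedPermutation (d d' : Datum n) (σ : Equiv.Perm (Fin n)) (r : Fin n → ℝ) : Prop where
  sign : ∀ i, r i = 1 ∨ r i = -1
  bracket : ∀ i j k, d'.L.c (σ i) (σ j) (σ k) = r i * r j * r k * d.L.c i j k
  map : ∀ i j, d'.D (σ j) (σ i) = r i * r j * d.D j i
  eps : ∀ i, d'.ε (σ i) = d.ε i

theorem IsSignedPermutation.mul_self {d d' : Datum n} {σ : Equiv.Perm (Fin n)} {r : Fin n → ℝ}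
    (h : IsSignedPermutation d d' σ r) (i : Fin n) : r i * r i = 1 := by
  rcases h.sign i with h | h <;> simp [h]

theorem IsSignedPermutation.equivalent {d d' : Datum n} {σ : Equiv.Perm (Fin n)} {r : Fin n → ℝ}
    (h : IsSignedPermutation d d' σ r) : d.Equivalent d' := by
  let φ : d.Alg ≃ₗ[ℝ] d'.Alg :=
    { toFun := fun x => (fun j => r (σ.symm j) * d.L.coord x (σ.symm j) : Fin n → ℝ)
      invFun := fun y => (fun i => r i * d'.L.coord y (σ i) : Fin n → ℝ)
      map_add' := fun x y => by
        funext j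
        change r _ * (d.L.coord x _ + d.L.coord y _) = r _ * d.L.coord x _ + r _ * d.L.coord y _
        ring
      map_smul' := fun t x => by
        funext j
        change r _ * (t * d.L.coord x _) = t * (r _ * d.L.coord x _)
        ring
      left_inv := fun x => by
        funext i
        change r i * (r (σ.symm (σ i)) * d.L.coord x (σ.symm (σ i))) = d.L.coord x i
        rw [σ.symm_apply_apply, ← mul_assoc, h.mul_self, one_mul]
      right_inv := fun y => by
        funext j
        change r (σ.symm j) * (r (σ.symm j) * d'.L.coord y (σ (σ.symm j))) = d'.L.coord y j
        rw [σ.apply_symm_apply, ← mul_assoc, h.mul_self, one_mul] }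
  have hcoord : ∀ x j, d'.L.coord (φ x) (σ j) = r j * d.L.coord x j := fun x j => by
    change r (σ.symm (σ j)) * d.L.coord x (σ.symm (σ j)) = _
    rw [σ.symm_apply_apply]
  have hext : ∀ u v : d'.Alg, (∀ j, d'.L.coord u (σ j) = d'.L.coord v (σ j)) → u = v :=
    fun u v huv => d'.L.ext_coord fun k => by simpa using huv (σ.symm k)
  refine ⟨{ φ with map_lie' := ?_ }, fun i => ⟨σ i, r i, ?_, ?_⟩, fun x y => ?_, fun x => ?_⟩
  · intro x y
    refine hext _ _ fun k => ?_
    change d'.L.coord (φ ⁅x, y⁆) (σ k) = d'.L.coord ⁅φ x, φ y⁆ (σ k)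
    rw [hcoord, StructureConstants.lie_apply, StructureConstants.lie_apply, Finset.mul_sum]
    conv_rhs => rw [← Equiv.sum_comp σ]
    refine Finset.sum_congr rfl fun i _ => ?_
    rw [Finset.mul_sum]
    conv_rhs => rw [← Equiv.sum_comp σ]
    refine Finset.sum_congr rfl fun j _ => ?_
    rw [hcoord, hcoord, h.bracket]
    linear_combination (-d.L.coord x i * d.L.coord y j * d.L.c i j k * r k) *
      (r j * r j * h.mul_self i + h.mul_self j)
  · rcases h.sign i with h | h <;> simp [h]
  · refine hext _ _ fun j => ?_
    change d'.L.coord (φ (d.L.e i)) (σ j) = _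
    rw [hcoord]
    by_cases hij : j = i <;> simp [hij]
  · change d'.metric (φ x) (φ y) = _
    rw [metric_apply, metric_apply, ← Equiv.sum_comp σ]
    refine Finset.sum_congr rfl fun i _ => ?_
    rw [hcoord, hcoord, sgn, sgn, h.eps]
    linear_combination (((d.ε i : ℤ) : ℝ) * d.L.coord x i * d.L.coord y i) * h.mul_self i
  · change φ (d.derivation x) = d'.derivation (φ x)
    refine hext _ _ fun j => ?_
    rw [hcoord, derivation_apply, derivation_apply, StructureConstants.coord_mapOf,
      StructureConstants.coord_mapOf, Finset.mul_sum]
    conv_rhs => rw [← Equiv.sum_comp σ]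
    refine Finset.sum_congr rfl fun i _ => ?_
    rw [hcoord, h.map]
    linear_combination (-r j * d.D j i * d.L.coord x i) * h.mul_self i

/-- Linear independence makes the map on indices injective, hence a permutation. Preservation of the
metric gives r_i² ε'_{σ i} = ε_i; as r_i² > 0 and both signs are ±1, this forces r_i = ±1 and ε'_{σ
i} = ε_i. Brackets and D are then compared coordinate by coordinate. -/
theorem Equivalent.exists_signedPermutation {d d' : Datum n} (h : d.Equivalent d') :
    ∃ σ r, IsSignedPermutation d d' σ r := by
  obtain ⟨φ, hb, hm, hD⟩ := h
  choose τ r hr hφ using hb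
  have hτ : Function.Injective τ := by
    intro i j hij
    by_contra hne
    -- Two basis vectors with proportional images would give this nonzero combination in the kernel.
    have h1 : φ (r j • d.L.e i - r i • d.L.e j) = 0 := by
      rw [map_sub, map_smul, map_smul, hφ, hφ, hij, smul_smul, smul_smul, mul_comm, sub_self]
    have h2 : r j • d.L.e i - r i • d.L.e j = 0 := φ.injective (h1.trans (map_zero (φ : d.Alg ≃ₗ[ℝ] d'.Alg)).symm)
    have h3 := congrArg (fun v => d.L.coord v i) h2
    simp [hne] at h3
    exact hr j h3
  let σ : Equiv.Perm (Fin n) := Equiv.ofBijective τ (Finite.injective_iff_bijective.mp hτ)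
  have hσ : ∀ i, φ (d.L.e i) = r i • d'.L.e (σ i) := hφ
  have hmet : ∀ i, r i * r i * d'.sgn (σ i) = d.sgn i := fun i => by
    have := hm (d.L.e i) (d.L.e i)
    rw [hσ] at this
    simp only [map_smul, LinearMap.smul_apply, metric_e, if_true, smul_eq_mul] at this
    rw [← this]; ring
  have hpos : ∀ i, 0 < r i * r i := fun i => mul_self_pos.mpr (hr i)
  have hone : ∀ i, r i * r i = 1 ∧ d'.sgn (σ i) = d.sgn i := fun i => by
    have h1 := hmet i
    have h2 := hpos i
    rcases d.sgn_eq i with h | h <;> rcases d'.sgn_eq (σ i) with h' | h' <;> rw [h, h'] at h1 <;>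
      first
      | exact ⟨by linarith, h'.trans h.symm⟩
      | (exfalso; linarith)
  have hsign : ∀ i, r i = 1 ∨ r i = -1 := fun i => mul_self_eq_one_iff.mp (hone i).1
  have hcoord : ∀ x j, d'.L.coord (φ x) (σ j) = r j * d.L.coord x j := fun x j => by
    have hx : φ x = ∑ i, (d.L.coord x i * r i) • d'.L.e (σ i) := by
      conv_lhs => rw [d.L.eq_sum x]
      rw [map_sum]
      exact Finset.sum_congr rfl fun i _ => by rw [map_smul, hσ, smul_smul]
    rw [hx, StructureConstants.coord_sum]
    simp [mul_comm]
  refine ⟨σ, r, hsign, fun i j k => ?_, fun i j => ?_, fun i => ?_⟩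
  · have h1 := hcoord ⁅d.L.e i, d.L.e j⁆ k
    rw [LieEquiv.map_lie, hσ, hσ, smul_lie, lie_smul] at h1
    simp only [StructureConstants.coord_smul, StructureConstants.coord_lie_e] at h1
    linear_combination (r i * r j) * h1 - d'.L.c (σ i) (σ j) (σ k) * ((hone i).1 + r i * r i * (hone j).1)
  · have h1 := hcoord (d.derivation (d.L.e i)) j
    rw [hD, hσ, derivation_apply, derivation_apply, map_smul] at h1
    simp only [StructureConstants.coord_smul, StructureConstants.coord_mapOf_e] at h1
    linear_combination (r i) * h1 - d'.D (σ j) (σ i) * (hone i).1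
  · have h1 := (hone i).2
    simp only [sgn, Int.cast_inj] at h1
    exact Units.ext h1

theorem Equivalent.size_eq {m : ℕ} {d : Datum n} {d' : Datum m} (h : d.Equivalent d') : n = m := by
  obtain ⟨φ, -⟩ := h
  have h1 := LinearEquiv.finrank_eq (φ : d.Alg ≃ₗ[ℝ] d'.Alg)
  rwa [Module.finrank_eq_card_basis d.L.basis, Module.finrank_eq_card_basis d'.L.basis,
    Fintype.card_fin, Fintype.card_fin] at h1

theorem IsSignedPermutation.symm {d d' : Datum n} {σ : Equiv.Perm (Fin n)} {r : Fin n → ℝ}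
    (h : IsSignedPermutation d d' σ r) : IsSignedPermutation d' d σ.symm (r ∘ σ.symm) where
  sign i := h.sign _
  bracket i j k := by
    have h1 := h.bracket (σ.symm i) (σ.symm j) (σ.symm k)
    simp only [Equiv.apply_symm_apply] at h1
    rw [h1]
    simp only [Function.comp_apply]
    have a := h.mul_self (σ.symm i)
    have b := h.mul_self (σ.symm j)
    have c := h.mul_self (σ.symm k)
    generalize r (σ.symm i) = x at *
    generalize r (σ.symm j) = y at *
    generalize r (σ.symm k) = z at *
    linear_combination (-d.L.c (σ.symm i) (σ.symm j) (σ.symm k)) * (a + x * x * b + x * x * y * y * c)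
  map i j := by
    have h1 := h.map (σ.symm i) (σ.symm j)
    simp only [Equiv.apply_symm_apply] at h1
    rw [h1]
    simp only [Function.comp_apply]
    linear_combination (-d.D (σ.symm j) (σ.symm i)) *
      (h.mul_self (σ.symm i) + r (σ.symm i) * r (σ.symm i) * h.mul_self (σ.symm j))
  eps i := by
    have := h.eps (σ.symm i)
    rw [Equiv.apply_symm_apply] at this
    exact this.symm

theorem IsSignedPermutation.trans {d d' d'' : Datum n} {σ τ : Equiv.Perm (Fin n)} {r s : Fin n → ℝ}
    (h : IsSignedPermutation d d' σ r) (h' : IsSignedPermutation d' d'' τ s) :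
    IsSignedPermutation d d'' (σ.trans τ) (fun i => r i * s (σ i)) where
  sign i := by rcases h.sign i with h | h <;> rcases h'.sign (σ i) with h' | h' <;> simp [h, h']
  bracket i j k := by
    simp only [Equiv.trans_apply]
    rw [h'.bracket, h.bracket]; ring
  map i j := by
    simp only [Equiv.trans_apply]
    rw [h'.map, h.map]; ring
  eps i := by
    simp only [Equiv.trans_apply]
    rw [h'.eps, h.eps]

theorem Equivalent.trans {m l : ℕ} {d : Datum n} {d' : Datum m} {d'' : Datum l}
    (h : d.Equivalent d') (h' : d'.Equivalent d'') : d.Equivalent d'' := by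
  obtain rfl := h.size_eq
  obtain rfl := h'.size_eq
  obtain ⟨σ, r, hσ⟩ := h.exists_signedPermutation
  obtain ⟨τ, s, hτ⟩ := h'.exists_signedPermutation
  exact (hσ.trans hτ).equivalent

theorem Equivalent.symm {m : ℕ} {d : Datum n} {d' : Datum m} (h : d.Equivalent d') :
    d'.Equivalent d := by
  obtain rfl := h.size_eq
  obtain ⟨σ, r, hσ⟩ := h.exists_signedPermutation
  exact hσ.symm.equivalent

/-- The same datum with the nodes relabelled by a permutation. -/
def relabel (σ : Equiv.Perm (Fin n)) : Datum n where
  L :=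
    { c := fun i j k => d.L.c (σ i) (σ j) (σ k)
      skew := fun i j k => d.L.skew _ _ _
      jacobi := fun i j k l => by
        rw [← d.L.jacobi (σ i) (σ j) (σ k) (σ l)]
        exact Equiv.sum_comp σ (fun h => d.L.c (σ i) (σ j) h * d.L.c h (σ k) (σ l) +
          d.L.c (σ j) (σ k) h * d.L.c h (σ i) (σ l) + d.L.c (σ k) (σ i) h * d.L.c h (σ j) (σ l)) }
  D := d.D.submatrix σ σ
  leibniz := by
    rw [StructureConstants.leibniz_iff]
    intro i j l
    have := d.leibniz_coord (σ i) (σ j) (σ l)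
    rw [← Equiv.sum_comp σ, ← Equiv.sum_comp σ (fun h => d.D h (σ i) * d.L.c h (σ j) (σ l)),
      ← Equiv.sum_comp σ (fun h => d.D h (σ j) * d.L.c (σ i) h (σ l))] at this
    exact this
  ε := d.ε ∘ σ

theorem isSignedPermutation_relabel (σ : Equiv.Perm (Fin n)) :
    IsSignedPermutation (d.relabel σ) d σ (fun _ => 1) where
  sign _ := Or.inl rfl
  bracket i j k := by simp [relabel]
  map i j := by simp [relabel]
  eps i := rfl

end Datum

end NiceNil

namespace NiceNil

/-! ### Curvature in an orthonormal frame -/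

section Frame

variable {ι G : Type*} [Fintype ι] [DecidableEq ι] [LieRing G] [LieAlgebra ℝ G]

/-- `b` is an orthonormal basis for `B`, with signs `s` and structure constants `C`. -/
structure IsOrthonormalFrame (B : LinearMap.BilinForm ℝ G) (b : Module.Basis ι ℝ G) (s : ι → ℝ)
    (C : ι → ι → ι → ℝ) : Prop where
  sq : ∀ i, s i * s i = 1
  metric : ∀ i j, B (b i) (b j) = if i = j then s i else 0
  bracket : ∀ i j, ⁅b i, b j⁆ = ∑ k, C i j k • b k

/-- The Christoffel symbols in an orthonormal frame. -/
def christoffel (s : ι → ℝ) (C : ι → ι → ι → ℝ) (i j k : ι) : ℝ :=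
  (1 / 2) * (C i j k - s k * s i * C j k i + s k * s j * C k i j)

/-- The Ricci tensor in an orthonormal frame. -/
def frameRicci (s : ι → ℝ) (C : ι → ι → ι → ℝ) (j k : ι) : ℝ :=
  -(∑ m, christoffel s C j k m * ∑ a, C m a a)
    - ∑ a, ∑ m, christoffel s C a j m * christoffel s C m k a

/-- The connection with given Christoffel symbols. -/
def frameConnection (b : Module.Basis ι ℝ G) (Γ : ι → ι → ι → ℝ) : G →ₗ[ℝ] G →ₗ[ℝ] G :=
  b.constr ℝ fun i => b.constr ℝ fun j => ∑ k, Γ i j k • b k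

theorem frameConnection_apply (b : Module.Basis ι ℝ G) (Γ : ι → ι → ι → ℝ) (i j : ι) :
    frameConnection b Γ (b i) (b j) = ∑ k, Γ i j k • b k := by
  simp [frameConnection]

/-- The Ricci tensor as a sum over a basis. -/
theorem ricci_eq_sum (b : Module.Basis ι ℝ G) (nabla : G →ₗ[ℝ] G →ₗ[ℝ] G) (y z : G) :
    ricci nabla y z = ∑ a, b.repr (curvature nabla (b a) y z) a := by
  rw [ricci, LinearMap.trace_eq_matrix_trace ℝ b, Matrix.trace]
  simp [LinearMap.toMatrix_apply]

omit [DecidableEq ι] in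
theorem repr_sum_smul (b : Module.Basis ι ℝ G) (f : ι → ℝ) (k : ι) :
    b.repr (∑ i, f i • b i) k = f k := by
  rw [b.repr_sum_self]

theorem ricci_frameConnection (b : Module.Basis ι ℝ G) (Γ C : ι → ι → ι → ℝ)
    (hC : ∀ i j, ⁅b i, b j⁆ = ∑ k, C i j k • b k) (j k : ι) :
    ricci (frameConnection b Γ) (b j) (b k) =
      ∑ a, (∑ m, Γ j k m * Γ a m a - ∑ m, Γ a k m * Γ j m a - ∑ m, C a j m * Γ m k a) := by
  rw [ricci_eq_sum b]
  refine Finset.sum_congr rfl fun a _ => ?_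
  have h : ∀ (f : ι → ℝ) (i : ι), frameConnection b Γ (b i) (∑ m, f m • b m) =
      ∑ l, (∑ m, f m * Γ i m l) • b l := by
    intro f i
    simp only [map_sum, map_smul, frameConnection_apply, Finset.smul_sum, smul_smul,
      Finset.sum_smul]
    exact Finset.sum_comm
  have h' : ∀ (f : ι → ℝ) (i : ι), frameConnection b Γ (∑ m, f m • b m) (b i) =
      ∑ l, (∑ m, f m * Γ m i l) • b l := by
    intro f i
    simp only [map_sum, map_smul, LinearMap.sum_apply, LinearMap.smul_apply, frameConnection_apply,
      Finset.smul_sum, smul_smul, Finset.sum_smul]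
    exact Finset.sum_comm
  rw [curvature, frameConnection_apply, frameConnection_apply, hC, h, h, h']
  simp only [map_sub, Finsupp.sub_apply, repr_sum_smul]

variable {B : LinearMap.BilinForm ℝ G} {b : Module.Basis ι ℝ G} {s : ι → ℝ} {C : ι → ι → ι → ℝ}

namespace IsOrthonormalFrame

variable (F : IsOrthonormalFrame B b s C)
include F

theorem skew (i j k : ι) : C i j k = -C j i k := by
  have h := lie_skew (b i) (b j)
  rw [F.bracket, F.bracket] at h
  have := congrArg (fun v => b.repr v k) h
  simp only [map_neg, Finsupp.neg_apply, repr_sum_smul] at this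
  exact this.symm

theorem metric_sum_left (f : ι → ℝ) (k : ι) : B (∑ i, f i • b i) (b k) = s k * f k := by
  simp [F.metric, mul_comm]

theorem metric_sum_right (f : ι → ℝ) (k : ι) : B (b k) (∑ i, f i • b i) = s k * f k := by
  simp [F.metric, mul_comm]

/-- The symbols come from the Koszul formula 2⟨∇_x y, z⟩ = ⟨[x, y], z⟩ − ⟨[y, z], x⟩ + ⟨[z, x], y⟩
evaluated on the frame, where raising the index k multiplies by s_k. -/
theorem isLeviCivita : IsLeviCivita B (frameConnection b (christoffel s C)) := by
  constructor
  · intro x y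
    have : frameConnection b (christoffel s C) - (frameConnection b (christoffel s C)).flip =
        StructureConstants.bracketMap := LinearMap.ext_basis b b fun i j => by
      rw [LinearMap.sub_apply, LinearMap.sub_apply, LinearMap.flip_apply, frameConnection_apply,
        frameConnection_apply, StructureConstants.bracketMap_apply, F.bracket,
        ← Finset.sum_sub_distrib]
      refine Finset.sum_congr rfl fun k _ => ?_
      rw [← sub_smul]
      congr 1
      simp only [christoffel]
      rw [F.skew j i k, F.skew k i j, F.skew k j i]
      ring
    exact congrArg (fun f => f x y) this
  · intro x y z
    have h0 : ∀ i j k, B (frameConnection b (christoffel s C) (b i) (b j)) (b k) +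
        B (b j) (frameConnection b (christoffel s C) (b i) (b k)) = 0 := by
      intro i j k
      rw [frameConnection_apply, frameConnection_apply, F.metric_sum_left, F.metric_sum_right]
      simp only [christoffel]
      rw [F.skew k i j, F.skew k j i, F.skew j i k]
      linear_combination (1 / 2) * ((-s i * C j k i - s j * C i k j) * F.sq k
        + (s i * C j k i - s k * C i j k) * F.sq j)
    have h1 : ∀ x j k, B (frameConnection b (christoffel s C) x (b j)) (b k) +
        B (b j) (frameConnection b (christoffel s C) x (b k)) = 0 := by
      intro x j k
      have : (LinearMap.flip B (b k)) ∘ₗ ((frameConnection b (christoffel s C)).flip (b j)) +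
          (B (b j)) ∘ₗ ((frameConnection b (christoffel s C)).flip (b k)) = 0 :=
        b.ext fun i => h0 i j k
      exact congrArg (fun f => f x) this
    have h2 : LinearMap.comp B (frameConnection b (christoffel s C) x) +
        LinearMap.compl₂ B (frameConnection b (christoffel s C) x) = 0 :=
      LinearMap.ext_basis b b fun j k => h1 x j k
    exact congrArg (fun f => f y z) h2

theorem christoffel_self (m a : ι) : christoffel s C m a a = 0 := by
  simp only [christoffel]
  rw [F.skew a m a, F.skew a a m, self_eq_neg.mp (F.skew a a m), F.sq]
  ring

/-- Substituting C_{aj}^m = Γ_{aj}^m − Γ_{ja}^m in the bracket term of the curvature produces one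
sum that cancels against −∇_y∇_x. The first term becomes a trace of ad because Γ_{ma}^a = 0 for a
metric connection. -/
theorem ricci_eq (j k : ι) :
    ricci (frameConnection b (christoffel s C)) (b j) (b k) = frameRicci s C j k := by
  have hC : ∀ i j k, C i j k = christoffel s C i j k - christoffel s C j i k := fun i j k => by
    simp only [christoffel]
    rw [F.skew j i k, F.skew k i j, F.skew k j i]
    ring
  rw [ricci_frameConnection b _ C F.bracket, frameRicci, Finset.sum_sub_distrib,
    Finset.sum_sub_distrib]
  have h1 : ∀ a m, christoffel s C a m a = - C m a a := fun a m => by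
    rw [hC m a a, F.christoffel_self]; ring
  have h2 : ∑ a, ∑ m, C a j m * christoffel s C m k a =
      ∑ a, ∑ m, christoffel s C a j m * christoffel s C m k a -
        ∑ a, ∑ m, christoffel s C a k m * christoffel s C j m a := by
    rw [Finset.sum_comm (f := fun a m => christoffel s C a k m * christoffel s C j m a),
      ← Finset.sum_sub_distrib]
    refine Finset.sum_congr rfl fun a _ => ?_
    rw [← Finset.sum_sub_distrib]
    refine Finset.sum_congr rfl fun m _ => ?_
    rw [hC a j m]; ring
  rw [h2, Finset.sum_comm]
  simp only [h1, mul_neg, Finset.sum_neg_distrib, Finset.mul_sum]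
  ring

/-- An operator whose matrix is given by the Ricci tensor is the Ricci operator. -/
theorem isRicciOperator {Rc : G →ₗ[ℝ] G} (h : ∀ j k, B (Rc (b j)) (b k) = frameRicci s C j k) :
    IsRicciOperator B Rc := by
  refine ⟨_, F.isLeviCivita, fun y z => ?_⟩
  set N := frameConnection b (christoffel s C)
  have hr := ricci_eq_sum b N
  let R : G →ₗ[ℝ] G →ₗ[ℝ] ℝ := LinearMap.mk₂ ℝ (fun y z => ricci N y z)
    (fun y y' z => by
      simp only [hr, ← Finset.sum_add_distrib, ← Finsupp.add_apply, ← map_add]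
      refine Finset.sum_congr rfl fun a _ => congrArg (fun v => b.repr v a) ?_
      simp only [curvature, map_add, LinearMap.add_apply, lie_add]
      abel)
    (fun t y z => by
      simp only [hr, smul_eq_mul, Finset.mul_sum]
      refine Finset.sum_congr rfl fun a _ => ?_
      rw [← smul_eq_mul, ← Finsupp.smul_apply, ← map_smul]
      refine congrArg (fun v => b.repr v a) ?_
      simp only [curvature, map_smul, LinearMap.smul_apply, lie_smul, smul_sub])
    (fun y z z' => by
      simp only [hr, ← Finset.sum_add_distrib, ← Finsupp.add_apply, ← map_add]
      refine Finset.sum_congr rfl fun a _ => congrArg (fun v => b.repr v a) ?_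
      simp only [curvature, map_add]
      abel)
    (fun t y z => by
      simp only [hr, smul_eq_mul, Finset.mul_sum]
      refine Finset.sum_congr rfl fun a _ => ?_
      rw [← smul_eq_mul, ← Finsupp.smul_apply, ← map_smul]
      refine congrArg (fun v => b.repr v a) ?_
      simp only [curvature, map_smul, smul_sub])
  have : LinearMap.comp B Rc = R := LinearMap.ext_basis b b fun j k => by
    exact (h j k).trans (F.ricci_eq j k).symm
  exact congrArg (fun f => f y z) this

theorem isMetric : IsMetric B := by
  have hflip : LinearMap.flip B = B := LinearMap.ext_basis b b fun i j => by
    rw [LinearMap.flip_apply, F.metric, F.metric]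
    by_cases h : i = j
    · simp [h]
    · simp [h, Ne.symm h]
  have hs : ∀ x y, B x y = B y x := fun x y => congrArg (fun f => f y x) hflip
  have hz : ∀ x, (∀ y, B x y = 0) → x = 0 := by
    intro x hx
    rw [← b.sum_repr x]
    refine Finset.sum_eq_zero fun i _ => ?_
    have h := hx (b i)
    rw [← b.sum_repr x, F.metric_sum_left] at h
    have hi : s i ≠ 0 := fun h0 => by have := F.sq i; simp [h0] at this
    rw [(mul_eq_zero.mp h).resolve_left hi, zero_smul]
  refine ⟨⟨fun x y => hs x y⟩, ?_⟩
  exact ⟨fun x hx => hz x hx, fun x hx => hz x fun y => (hs x y).trans (hx y)⟩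

end IsOrthonormalFrame

end Frame

end NiceNil

/-! ### The equations of a solution, Ricci curvature and the nilsoliton equation -/

namespace NiceNil

namespace Datum

variable {n : ℕ} (d : Datum n)

/-- `ε_i ε_j ε_k c_{ijk}²`. -/
def weight (i j k : Fin n) : ℝ := d.sgn i * d.sgn j * d.sgn k * d.L.c i j k ^ 2

/-- `ε_i ε_j a_{ji}²` for `i ≠ j`. -/
def offWeight (i j : Fin n) : ℝ := if i = j then 0 else d.sgn i * d.sgn j * d.D j i ^ 2

/-- The column `l` of the root matrix on the row of `i, j, k`. -/
def rootEntry (l i j k : Fin n) : ℝ :=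
  (if l = k then 1 else 0) - (if l = i then 1 else 0) - (if l = j then 1 else 0)

/-- The conditions on a nondiagonal solution, expressed through the structure constants, the
matrix of the derivation and the signs of the metric only. -/
structure NondiagonalEquations : Prop where
  trace_ne_zero : d.D.trace ≠ 0
  exists_off : ∃ i j, i ≠ j ∧ d.D j i ≠ 0
  disjoint : ∀ i j i' j', i ≠ j → i' ≠ j' → d.D j i ≠ 0 → d.D j' i' ≠ 0 → (i, j) ≠ (i', j') →
    i ≠ i' ∧ i ≠ j' ∧ j ≠ i' ∧ j ≠ j'
  no_arrow : ∀ i j, i ≠ j → d.D j i ≠ 0 → ∀ k, d.L.c i k j = 0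
  trace_eq : ∀ i j, i ≠ j → d.D j i ≠ 0 → d.D.trace = d.D i i - d.D j j
  diag_eq : ∀ i j k, d.L.c i j k ≠ 0 → d.D k k = d.D i i + d.D j j
  balance : ∀ l, ∑ i, ∑ j, ∑ k, rootEntry l i j k * d.weight i j k =
    4 * d.D.trace * (d.D l l - 1) - 2 * ∑ i, ∑ j, d.offWeight i j
      + 2 * (∑ j, d.offWeight l j - ∑ i, d.offWeight i l)
  label_unique : ∀ i j j' k, d.L.c i j k ≠ 0 → d.L.c i j' k ≠ 0 → j = j'
  target_unique : ∀ i j k k', d.L.c i j k ≠ 0 → d.L.c i j k' ≠ 0 → k = k'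
  acyclic : ∀ i, ¬ Relation.TransGen (fun a b => ∃ j, d.L.c a j b ≠ 0) i i
  concat : ∀ i j k l, i ≠ j → j ≠ k → i ≠ k →
    (∃ h, d.L.c i j h ≠ 0 ∧ d.L.c h k l ≠ 0) →
      (∃ h, d.L.c j k h ≠ 0 ∧ d.L.c h i l ≠ 0) ∨ (∃ h, d.L.c k i h ≠ 0 ∧ d.L.c h j l ≠ 0)

/-- The matrix of the metric adjoint of `D`. -/
def adjointMatrix : Matrix (Fin n) (Fin n) ℝ := fun i j => d.sgn i * d.sgn j * d.D j i

theorem metric_adjoint (x y : d.Alg) :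
    d.metric (d.L.mapOf d.adjointMatrix x) y = d.metric x (d.L.mapOf d.D y) := by
  simp only [metric_apply, StructureConstants.coord_mapOf, Finset.mul_sum, Finset.sum_mul]
  rw [Finset.sum_comm]
  refine Finset.sum_congr rfl fun i _ => Finset.sum_congr rfl fun j _ => ?_
  simp only [adjointMatrix]
  linear_combination (d.sgn i * d.D i j * d.L.coord x i * d.L.coord y j) * d.sgn_mul_self j

theorem trace_mapOf (M : Matrix (Fin n) (Fin n) ℝ) :
    LinearMap.trace ℝ d.Alg (d.L.mapOf M) = M.trace := by
  rw [LinearMap.trace_eq_matrix_trace ℝ d.L.basis, Matrix.trace, Matrix.trace]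
  refine Finset.sum_congr rfl fun i _ => ?_
  simp [LinearMap.toMatrix_apply]

theorem isOrthonormalFrame : IsOrthonormalFrame d.metric d.L.basis d.sgn d.L.c where
  sq := d.sgn_mul_self
  metric i j := by simp
  bracket i j := d.L.ext_coord fun k => by
    rw [StructureConstants.coord_sum]
    simp

theorem c_self (i k : Fin n) : d.L.c i i k = 0 := self_eq_neg.mp (d.L.skew i i k)

theorem sum_offWeight : ∑ a, ∑ m, d.sgn a * d.sgn m * d.D m a ^ 2 =
    ∑ a, d.D a a ^ 2 + ∑ a, ∑ m, d.offWeight a m := by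
  rw [← Finset.sum_add_distrib]
  refine Finset.sum_congr rfl fun a _ => ?_
  rw [← Finset.add_sum_erase _ _ (Finset.mem_univ a), ← Finset.add_sum_erase _ (d.offWeight a)
    (Finset.mem_univ a)]
  simp only [offWeight, if_true, zero_add, sgn_mul_self, one_mul]
  congr 1
  refine Finset.sum_congr rfl fun m hm => ?_
  rw [if_neg (Finset.ne_of_mem_erase hm).symm]

namespace NondiagonalEquations

variable {d} (H : d.NondiagonalEquations)
include H

theorem c_loop (i j : Fin n) : d.L.c i j i = 0 := by
  by_contra h
  exact H.acyclic i (Relation.TransGen.single ⟨j, h⟩)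

theorem c_loop' (i j : Fin n) : d.L.c j i i = 0 := by
  rw [d.L.skew, H.c_loop, neg_zero]

/-- Two such arrows would close a cycle. These products are the Killing form terms in the Ricci
tensor. -/
theorem c_two_loop (a m j k : Fin n) : d.L.c a j m * d.L.c m k a = 0 := by
  by_contra h
  obtain ⟨h1, h2⟩ := mul_ne_zero_iff.mp h
  exact H.acyclic a ((Relation.TransGen.single ⟨j, h1⟩).tail ⟨k, h2⟩)

theorem source_mul {j k : Fin n} (hjk : j ≠ k) (a m : Fin n) : d.L.c j a m * d.L.c k a m = 0 := by
  by_contra h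
  obtain ⟨h1, h2⟩ := mul_ne_zero_iff.mp h
  rw [d.L.skew, neg_ne_zero] at h1 h2
  exact hjk (H.label_unique _ _ _ _ h1 h2)

theorem target_mul {j k : Fin n} (hjk : j ≠ k) (a m : Fin n) : d.L.c a m j * d.L.c a m k = 0 := by
  by_contra h
  obtain ⟨h1, h2⟩ := mul_ne_zero_iff.mp h
  exact hjk (H.target_unique _ _ _ _ h1 h2)

theorem D_mul_comm_zero {i j : Fin n} (hij : i ≠ j) : d.D i j * d.D j i = 0 := by
  by_contra h
  obtain ⟨h1, h2⟩ := mul_ne_zero_iff.mp h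
  exact (H.disjoint j i i j hij.symm hij h1 h2 (fun e => hij (Prod.ext_iff.mp e).1.symm)).2.1 rfl

theorem D_mul_source {i j k : Fin n} (hij : i ≠ j) (hik : i ≠ k) (hjk : j ≠ k) :
    d.D j i * d.D k i = 0 := by
  by_contra h
  obtain ⟨h1, h2⟩ := mul_ne_zero_iff.mp h
  exact (H.disjoint i j i k hij hik h1 h2 (fun e => hjk (Prod.ext_iff.mp e).2)).1 rfl

theorem D_mul_target {i j k : Fin n} (hij : j ≠ i) (hik : k ≠ i) (hjk : j ≠ k) :
    d.D i j * d.D i k = 0 := by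
  by_contra h
  obtain ⟨h1, h2⟩ := mul_ne_zero_iff.mp h
  exact (H.disjoint j i k i hij hik h1 h2 (fun e => hjk (Prod.ext_iff.mp e).1)).2.2.2 rfl

theorem trace_mul {i j : Fin n} (hij : i ≠ j) :
    (d.D i i - d.D j j) * d.D j i = d.D.trace * d.D j i := by
  by_cases h : d.D j i = 0
  · rw [h, mul_zero, mul_zero]
  · rw [H.trace_eq i j hij h]

/-- Pair the balance equations with λ. The root matrix side vanishes because λ ∈ ker M. On the other
side the off-diagonal weights, with sum B, contribute 2 Σ b_{ij}(λ_i − λ_j) = 2 (Tr D) B, which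
cancels −2B Tr D. What is left is 4 (Tr D)(Σ λ_l² − Tr D) = 0. -/
theorem sum_diag_sq : ∑ l, d.D l l ^ 2 = d.D.trace := by
  have h1 : ∑ l, d.D l l * (∑ i, ∑ j, ∑ k, rootEntry l i j k * d.weight i j k) = 0 := by
    simp only [Finset.mul_sum]
    rw [Finset.sum_comm]
    refine Finset.sum_eq_zero fun i _ => ?_
    rw [Finset.sum_comm]
    refine Finset.sum_eq_zero fun j _ => ?_
    rw [Finset.sum_comm]
    refine Finset.sum_eq_zero fun k _ => ?_
    by_cases h : d.L.c i j k = 0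
    · simp [weight, h]
    · have := H.diag_eq i j k h
      have h2 : ∑ l, d.D l l * rootEntry l i j k = 0 := by
        simp only [rootEntry, mul_sub, Finset.sum_sub_distrib, mul_ite, mul_one, mul_zero,
          Finset.sum_ite_eq', Finset.mem_univ, if_true]
        linarith
      simp only [← mul_assoc]
      rw [← Finset.sum_mul, h2, zero_mul]
  have h2 : ∑ l, d.D l l * (∑ j, d.offWeight l j - ∑ i, d.offWeight i l) =
      d.D.trace * ∑ i, ∑ j, d.offWeight i j := by
    simp only [mul_sub, Finset.sum_sub_distrib, Finset.mul_sum]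
    rw [Finset.sum_comm (f := fun l i => d.D l l * d.offWeight i l), ← Finset.sum_sub_distrib]
    refine Finset.sum_congr rfl fun i _ => ?_
    rw [← Finset.sum_sub_distrib]
    refine Finset.sum_congr rfl fun j _ => ?_
    by_cases hij : i = j
    · simp [offWeight, hij]
    · simp only [offWeight, if_neg hij]
      linear_combination (d.sgn i * d.sgn j * d.D j i) * H.trace_mul hij
  have h3 : ∑ l, d.D l l * (4 * d.D.trace * (d.D l l - 1) - 2 * ∑ i, ∑ j, d.offWeight i j
      + 2 * (∑ j, d.offWeight l j - ∑ i, d.offWeight i l)) = 0 := by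
    rw [← h1]
    exact Finset.sum_congr rfl fun l _ => by rw [H.balance l]
  have h4 : ∑ l, d.D l l * (4 * d.D.trace * (d.D l l - 1) - 2 * ∑ i, ∑ j, d.offWeight i j
      + 2 * (∑ j, d.offWeight l j - ∑ i, d.offWeight i l)) =
      4 * d.D.trace * ∑ l, d.D l l ^ 2 - (4 * d.D.trace + 2 * ∑ i, ∑ j, d.offWeight i j)
        * ∑ l, d.D l l + 2 * ∑ l, d.D l l * (∑ j, d.offWeight l j - ∑ i, d.offWeight i l) := by
    have aux : ∀ (u w : Fin n → ℝ) (α β : ℝ), ∑ l, u l * (α * (u l - 1) - β + 2 * w l) =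
        α * ∑ l, u l ^ 2 - (α + β) * ∑ l, u l + 2 * ∑ l, u l * w l := by
      intro u w α β
      rw [Finset.mul_sum, Finset.mul_sum, Finset.mul_sum, ← Finset.sum_sub_distrib,
        ← Finset.sum_add_distrib]
      exact Finset.sum_congr rfl fun l _ => by ring
    exact aux _ _ _ _
  have h5 : ∑ l, d.D l l = d.D.trace := rfl
  rw [h4, h2, h5] at h3
  have h6 : d.D.trace * (∑ l, d.D l l ^ 2 - d.D.trace) = 0 := by linear_combination h3 / 4
  linarith [(mul_eq_zero.mp h6).resolve_left H.trace_ne_zero]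

/-- The Ricci tensor of the nilpotent Lie algebra. -/
theorem frameRicci_eq (j k : Fin n) : frameRicci d.sgn d.L.c j k =
    -(1 / 2) * ∑ a, ∑ m, d.sgn a * d.sgn m * (d.L.c j a m * d.L.c k a m) +
      (1 / 4) * ∑ a, ∑ m, d.sgn j * d.sgn k * d.sgn a * d.sgn m * (d.L.c a m j * d.L.c a m k) := by
  let s := d.sgn
  let c := d.L.c
  let G : Fin n → Fin n → ℝ := fun a m => s a * s m * (c j a m * c k a m)
  let K : Fin n → Fin n → ℝ := fun a m => s j * s k * s a * s m * (c a m j * c a m k)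
  -- `E` and `F` enter the expansion antisymmetrically in a and m, hence drop out of the double sum;
  -- the remaining mixed products vanish by acyclicity.
  let E : Fin n → Fin n → ℝ := fun a m => s a * s k * c a j m * c a m k
  let F : Fin n → Fin n → ℝ := fun a m => s m * s j * c m a j * c m k a
  have hsw : ∀ f : Fin n → Fin n → ℝ, ∑ a, ∑ m, f m a = ∑ a, ∑ m, f a m := fun f =>
    Finset.sum_comm
  have hpt : ∀ a m, christoffel s c a j m * christoffel s c m k a =
      (1 / 4) * (G a m + G m a - K a m + (E a m - E m a) + (F a m - F m a)) := by
    intro a m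
    have z1 := H.c_two_loop a m j k
    have z2 := H.c_two_loop m a j k
    have sa := d.sgn_mul_self a
    have sm := d.sgn_mul_self m
    simp only [christoffel, G, K, E, F, s, c]
    rw [d.L.skew j m a, d.L.skew k a m, d.L.skew m a j, d.L.skew j a m, d.L.skew k m a,
      d.L.skew m a k]
    linear_combination (1 / 4) * z1 + (1 / 4) * z2 +
      (1 / 4) * (d.L.c m j a * d.L.c a k m * d.sgn m * d.sgn m
        - d.sgn k * d.sgn m * d.L.c m j a * (-d.L.c a m k)) * sa
      + (1 / 4) * (d.L.c m j a * d.L.c a k m - d.sgn j * d.sgn a * d.L.c a m j * d.L.c a k m) * sm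
  have htr : ∀ m, ∑ a, d.L.c m a a = 0 := fun m => Finset.sum_eq_zero fun a _ => H.c_loop' a m
  rw [frameRicci]
  simp only [htr, mul_zero, Finset.sum_const_zero, neg_zero]
  change 0 - ∑ a, ∑ m, christoffel s c a j m * christoffel s c m k a =
    -(1 / 2) * (∑ a, ∑ m, G a m) + (1 / 4) * ∑ a, ∑ m, K a m
  simp only [hpt, ← Finset.mul_sum, Finset.sum_add_distrib, Finset.sum_sub_distrib]
  rw [hsw G, hsw E, hsw F]
  ring

/-- This is what a nice basis provides: two different arrows share neither label and target nor
source and label, so each product in the Ricci formula is zero. -/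
theorem frameRicci_off {j k : Fin n} (hjk : j ≠ k) : frameRicci d.sgn d.L.c j k = 0 := by
  rw [H.frameRicci_eq]
  simp [H.source_mul hjk, H.target_mul hjk]

/-- The factor 1/4 belongs to the sum over all ordered pairs (i, j), in which every row of the root
matrix is counted twice. -/
theorem frameRicci_diag (l : Fin n) : frameRicci d.sgn d.L.c l l =
    d.sgn l * ((1 / 4) * ∑ i, ∑ j, ∑ k, rootEntry l i j k * d.weight i j k) := by
  rw [H.frameRicci_eq]
  have h1 : ∑ i, ∑ j, ∑ k, rootEntry l i j k * d.weight i j k =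
      ∑ i, ∑ j, d.weight i j l - ∑ j, ∑ k, d.weight l j k - ∑ i, ∑ k, d.weight i l k := by
    have e1 : ∀ i j, ∑ k, rootEntry l i j k * d.weight i j k =
        d.weight i j l - (if l = i then 1 else 0) * ∑ k, d.weight i j k
          - (if l = j then 1 else 0) * ∑ k, d.weight i j k := by
      intro i j
      simp only [rootEntry, sub_mul, Finset.sum_sub_distrib, ite_mul, one_mul, zero_mul,
        Finset.sum_ite_eq, Finset.mem_univ, if_true, Finset.mul_sum]
    simp only [e1, Finset.sum_sub_distrib, ite_mul, one_mul, zero_mul, Finset.sum_ite_eq,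
      Finset.mem_univ, if_true]
    congr 2
    rw [Finset.sum_comm]
    simp
  have h2 : ∑ i, ∑ k, d.weight i l k = ∑ j, ∑ k, d.weight l j k := by
    refine Finset.sum_congr rfl fun i _ => Finset.sum_congr rfl fun k _ => ?_
    simp only [weight]
    rw [d.L.skew i l k]; ring
  rw [h1, h2]
  have h3 : ∑ a, ∑ m, d.sgn a * d.sgn m * (d.L.c l a m * d.L.c l a m) =
      d.sgn l * ∑ j, ∑ k, d.weight l j k := by
    simp only [Finset.mul_sum]
    refine Finset.sum_congr rfl fun a _ => Finset.sum_congr rfl fun m _ => ?_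
    simp only [weight]
    linear_combination (-d.sgn a * d.sgn m * d.L.c l a m ^ 2) * d.sgn_mul_self l
  have h4 : ∑ a, ∑ m, d.sgn l * d.sgn l * d.sgn a * d.sgn m * (d.L.c a m l * d.L.c a m l) =
      d.sgn l * ∑ i, ∑ j, d.weight i j l := by
    simp only [Finset.mul_sum]
    refine Finset.sum_congr rfl fun a _ => Finset.sum_congr rfl fun m _ => ?_
    simp only [weight]
    ring
  rw [h3, h4]
  ring

/-- The generalized nilsoliton equation in coordinates. -/
theorem nilsoliton_coord (j k : Fin n) : frameRicci d.sgn d.L.c j k =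
    d.sgn k * (-(d.D.trace + (1 / 2) * ∑ a, ∑ m, d.offWeight a m) * (if k = j then 1 else 0)
      - (1 / 2) * ∑ m, (d.D k m * d.adjointMatrix m j - d.adjointMatrix k m * d.D m j)
      + d.D.trace * ((1 / 2) * (d.D k j + d.adjointMatrix k j))) := by
  by_cases hjk : j = k
  · subst hjk
    rw [H.frameRicci_diag, H.balance]
    have h1 : ∑ m, (d.D j m * d.adjointMatrix m j - d.adjointMatrix j m * d.D m j) =
        ∑ i, d.offWeight i j - ∑ m, d.offWeight j m := by
      rw [← Finset.sum_sub_distrib]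
      refine Finset.sum_congr rfl fun m _ => ?_
      by_cases hm : m = j
      · subst hm; simp [offWeight, adjointMatrix]
      · simp only [offWeight, adjointMatrix, if_neg hm, if_neg (Ne.symm hm)]; ring
    rw [h1]
    simp only [if_true, adjointMatrix]
    linear_combination (-d.sgn j * d.D.trace * (1 / 2) * d.D j j) * d.sgn_mul_self j
  · rw [H.frameRicci_off hjk, if_neg (Ne.symm hjk)]
    -- Off the diagonal the claim is [D, D*] = (Tr D)(D + D*). Disjointness of the pairs leaves only
    -- m = j and m = k in the commutator, and there λ_i − λ_j = Tr D applies.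
    have h1 : ∑ m, (d.D k m * d.adjointMatrix m j - d.adjointMatrix k m * d.D m j) =
        d.D.trace * (d.D k j + d.adjointMatrix k j) := by
      rw [← Finset.sum_subset (Finset.subset_univ {k, j})]
      · rw [Finset.sum_pair (Ne.symm hjk)]
        simp only [adjointMatrix]
        linear_combination (-(d.D k k * d.D k j)) * d.sgn_mul_self k
          + (d.D k j * d.D j j) * d.sgn_mul_self j
          + d.sgn k * d.sgn j * H.trace_mul (Ne.symm hjk) + H.trace_mul hjk
      · intro m _ hm
        simp only [Finset.mem_insert, Finset.mem_singleton, not_or] at hm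
        have z1 := H.D_mul_source hm.1 hm.2 (Ne.symm hjk)
        have z2 := H.D_mul_target (Ne.symm hm.1) (Ne.symm hm.2) (Ne.symm hjk)
        simp only [adjointMatrix]
        linear_combination d.sgn m * d.sgn j * z1 - d.sgn k * d.sgn m * z2
    rw [h1]; ring

/-- The products D_{am} D_{ma} vanish for a ≠ m, so Tr((D^s)²) is Σ λ_l² plus half the sum of the
off-diagonal weights, and Σ λ_l² = Tr D. -/
theorem trace_symmetrized_sq :
    (((1 / 2 : ℝ) • (d.D + d.adjointMatrix)) * ((1 / 2 : ℝ) • (d.D + d.adjointMatrix))).trace =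
      d.D.trace + (1 / 2) * ∑ a, ∑ m, d.offWeight a m := by
  have h0 : ∀ a m, d.D a m * d.D m a = if a = m then d.D a a ^ 2 else 0 := by
    intro a m
    by_cases h : a = m
    · subst h; simp [sq]
    · rw [if_neg h, H.D_mul_comm_zero h]
  have h1 : ∀ a m, ((1 / 2 : ℝ) • (d.D + d.adjointMatrix)) a m *
      ((1 / 2 : ℝ) • (d.D + d.adjointMatrix)) m a =
      (1 / 2) * (if a = m then d.D a a ^ 2 else 0) + (1 / 4) * (d.sgn a * d.sgn m * d.D m a ^ 2)
        + (1 / 4) * (d.sgn m * d.sgn a * d.D a m ^ 2) := by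
    intro a m
    rw [← h0]
    simp only [Matrix.smul_apply, Matrix.add_apply, adjointMatrix, smul_eq_mul]
    linear_combination (1 / 4 * d.D m a * d.D a m) * (d.sgn_mul_self a + d.sgn a * d.sgn a * d.sgn_mul_self m)
  simp only [Matrix.trace, Matrix.diag_apply, Matrix.mul_apply, h1, Finset.sum_add_distrib,
    ← Finset.mul_sum]
  rw [Finset.sum_comm (f := fun a m => d.sgn m * d.sgn a * d.D a m ^ 2), d.sum_offWeight]
  simp only [Finset.sum_ite_eq, Finset.mem_univ, if_true, H.sum_diag_sq]
  simp only [Matrix.trace, Matrix.diag_apply]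
  ring

/-- The Ricci equation is the coordinate identity `nilsoliton_coord`. The trace condition holds term
by term: D* carries e_a to e_h only when h = a or (h, a) is a pair, and then e_a does not occur in
[e_i, e_h], by acyclicity or by the absence of arrows from h to a. -/
theorem solvesGeneralizedNilsoliton :
    SolvesGeneralizedNilsoliton d.metric (d.derivation : d.Alg →ₗ[ℝ] d.Alg) := by
  have hd : (d.derivation : d.Alg →ₗ[ℝ] d.Alg) = d.L.mapOf d.D := rfl
  have hadd : (1 / 2 : ℝ) • (d.L.mapOf d.D + d.L.mapOf d.adjointMatrix) =
      d.L.mapOf ((1 / 2 : ℝ) • (d.D + d.adjointMatrix)) := by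
    refine d.L.basis.ext fun i => d.L.ext_coord fun k => ?_
    simp
  have hmul : ∀ M N : Matrix (Fin n) (Fin n) ℝ, d.L.mapOf M ∘ₗ d.L.mapOf N = d.L.mapOf (M * N) :=
    fun M N => (Matrix.mulVecLin_mul M N).symm
  refine ⟨_, d.L.mapOf d.adjointMatrix, _, ?_, fun x y => d.metric_adjoint x y, rfl, rfl, fun v => ?_⟩
  · refine d.isOrthonormalFrame.isRicciOperator fun j k => ?_
    rw [H.nilsoliton_coord, hd, hadd, hmul, hmul, hmul, d.trace_mapOf, d.trace_mapOf,
      H.trace_symmetrized_sq, StructureConstants.basis_apply, StructureConstants.basis_apply,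
      metric_apply]
    rw [Finset.sum_eq_single k]
    · simp only [StructureConstants.coord_e, if_true, mul_one, LinearMap.add_apply,
        LinearMap.sub_apply, LinearMap.smul_apply, StructureConstants.coord_add,
        StructureConstants.coord_sub, StructureConstants.coord_smul,
        StructureConstants.coord_mapOf_e, LinearMap.id_apply, Matrix.mul_apply, Matrix.smul_apply,
        Matrix.add_apply, smul_eq_mul, Finset.sum_sub_distrib]
    · intro i _ hi
      simp [hi]
    · simp
  · have h0 : ∀ i, LinearMap.trace ℝ d.Alg
        ((LieAlgebra.ad ℝ d.Alg (d.L.e i) : d.Alg →ₗ[ℝ] d.Alg) ∘ₗ d.L.mapOf d.adjointMatrix) = 0 := by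
      intro i
      rw [LinearMap.trace_eq_matrix_trace ℝ d.L.basis, Matrix.trace]
      refine Finset.sum_eq_zero fun a _ => ?_
      simp only [Matrix.diag_apply, LinearMap.toMatrix_apply, StructureConstants.basis_repr,
        StructureConstants.basis_apply, LinearMap.comp_apply, LieAlgebra.ad_apply,
        StructureConstants.coord_lie_e_left, StructureConstants.coord_mapOf_e, adjointMatrix]
      refine Finset.sum_eq_zero fun h _ => ?_
      by_cases hha : h = a
      · rw [hha, H.c_loop', mul_zero]
      · by_cases hz : d.D a h = 0
        · rw [hz, mul_zero, zero_mul]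
        · rw [d.L.skew, H.no_arrow h a hha hz, neg_zero, mul_zero]
    have h1 : LinearMap.trace ℝ d.Alg ∘ₗ LinearMap.lcomp ℝ d.Alg (d.L.mapOf d.adjointMatrix) ∘ₗ
        (LieAlgebra.ad ℝ d.Alg : d.Alg →ₗ[ℝ] Module.End ℝ d.Alg) = 0 :=
      d.L.basis.ext fun i => by
        rw [StructureConstants.basis_apply]
        exact h0 i
    exact congrArg (fun f => f v) h1

end NondiagonalEquations

end Datum

end NiceNil

namespace NiceNil

namespace Datum

variable {n : ℕ} (d : Datum n)

attribute [local instance] LieRing.ofAssociativeRing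

open LieAlgebra

/-! ### The solvable extension -/

/-- The basis `e_1, …, e_n, e_0` of the extension. -/
def extBasis : Module.Basis (Fin n ⊕ Unit) ℝ d.Ext :=
  (d.L.basis.prod (Module.Basis.singleton Unit ℝ)).map (SemiDirectSum.toProdl d.action).symm

/-- The signs of the metric of the extension. -/
def extSign : Fin n ⊕ Unit → ℝ := Sum.elim d.sgn fun _ => 1

/-- The structure constants of the extension. -/
def extConst : Fin n ⊕ Unit → Fin n ⊕ Unit → Fin n ⊕ Unit → ℝ
  | .inl i, .inl j, .inl k => d.L.c i j k
  | .inr _, .inl i, .inl j => d.D j i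
  | .inl i, .inr _, .inl j => -d.D j i
  | _, _, _ => 0

theorem extBasis_inl (i : Fin n) : d.extBasis (.inl i) = ⟨d.L.e i, 0⟩ := by
  rw [extBasis, Module.Basis.map_apply, Module.Basis.prod_apply]
  simp only [Sum.elim_inl, Function.comp_apply, LinearMap.inl_apply, StructureConstants.basis_apply]
  rfl

theorem extBasis_inr (u : Unit) : d.extBasis (.inr u) = ⟨0, 1⟩ := by
  rw [extBasis, Module.Basis.map_apply, Module.Basis.prod_apply]
  simp only [Sum.elim_inr, Function.comp_apply, LinearMap.inr_apply, Module.Basis.singleton_apply]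
  rfl

theorem ext_lie (x y : d.Ext) : ⁅x, y⁆ =
    ⟨⁅x.left, y.left⁆ + x.right • d.L.mapOf d.D y.left - y.right • d.L.mapOf d.D x.left, 0⟩ := by
  rw [SemiDirectSum.lie_eq_mk]
  congr 1
  rw [LieRing.of_associative_ring_bracket]; ring

theorem extMetric_apply (x y : d.Ext) :
    d.extMetric x y = d.metric x.left y.left + x.right * y.right := rfl

theorem sum_left {ι : Type*} (s : Finset ι) (f : ι → d.Ext) : (∑ i ∈ s, f i).left =
    ∑ i ∈ s, (f i).left := map_sum (SemiDirectSum.projl d.action) f s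

theorem sum_right {ι : Type*} (s : Finset ι) (f : ι → d.Ext) : (∑ i ∈ s, f i).right =
    ∑ i ∈ s, (f i).right :=
  map_sum (SemiDirectSum.projr d.action : d.Ext →ₗ[ℝ] ℝ) f s

theorem action_one (x : d.Alg) : d.action 1 x = d.L.mapOf d.D x := by
  change ((1 : ℝ) • d.derivation) x = _
  rw [one_smul]; rfl

theorem isOrthonormalFrame_ext :
    IsOrthonormalFrame d.extMetric d.extBasis d.extSign d.extConst where
  sq i := by rcases i with i | i <;> simp [extSign]
  metric i j := by
    rcases i with i | i <;> rcases j with j | j <;>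
      simp [extBasis_inl, extBasis_inr, extMetric_apply, extSign]
  bracket i j := by
    refine SemiDirectSum.ext (d.L.ext_coord fun k => ?_) ?_
    · rw [sum_left, StructureConstants.coord_sum, Fintype.sum_sum_type]
      rcases i with i | i <;> rcases j with j | j <;>
        simp [extBasis_inl, extBasis_inr, extConst, action_one]
    · rw [sum_right, Fintype.sum_sum_type]
      rcases i with i | i <;> rcases j with j | j <;>
        simp [extBasis_inl, extBasis_inr, extConst]

theorem finrank_ext : Module.finrank ℝ d.Ext = n + 1 := by
  rw [Module.finrank_eq_card_basis d.extBasis]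
  simp

theorem isMetric : IsMetric d.metric := d.isOrthonormalFrame.isMetric

theorem isMetric_ext : IsMetric d.extMetric := d.isOrthonormalFrame_ext.isMetric

namespace NondiagonalEquations

variable {d} (H : d.NondiagonalEquations)
include H

/-- The Ricci tensor of the extension splits into three blocks. On 𝔤 the additional terms are the
ones in the nilsoliton equation, the e_0-component is −Tr((D^s)²), and the mixed components are
zero. The hypothesis `hrev` excludes arrows from j to i for a pair (i, j) and is needed only for the
mixed block. -/
theorem isEinstein (hrev : ∀ i j, i ≠ j → d.D j i ≠ 0 → ∀ k, d.L.c j k i = 0) :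
    IsEinstein d.extMetric := by
  have htr : ∀ m, ∑ a, d.L.c m a a = 0 := fun m => Finset.sum_eq_zero fun a _ => H.c_loop' a m
  refine ⟨-(d.D.trace + (1 / 2) * ∑ a, ∑ m, d.offWeight a m),
    d.isOrthonormalFrame_ext.isRicciOperator fun j k => ?_⟩
  have hg : ∀ i j k, christoffel d.extSign d.extConst (.inl i) (.inl j) (.inl k) =
      christoffel d.sgn d.L.c i j k := fun i j k => rfl
  have h1 : ∀ i j, christoffel d.extSign d.extConst (.inl i) (.inl j) (.inr ()) =
      (1 / 2) * (d.sgn i * d.D i j + d.sgn j * d.D j i) := fun i j => by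
    simp only [christoffel, extSign, extConst, Sum.elim_inl, Sum.elim_inr]; ring
  have h2 : ∀ i k, christoffel d.extSign d.extConst (.inl i) (.inr ()) (.inl k) =
      -(1 / 2) * (d.D k i + d.sgn k * d.sgn i * d.D i k) := fun i k => by
    simp only [christoffel, extSign, extConst, Sum.elim_inl, Sum.elim_inr]; ring
  have h3 : ∀ j k, christoffel d.extSign d.extConst (.inr ()) (.inl j) (.inl k) =
      (1 / 2) * (d.D k j - d.sgn k * d.sgn j * d.D j k) := fun j k => by
    simp only [christoffel, extSign, extConst, Sum.elim_inl, Sum.elim_inr]; ring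
  have h4 : ∀ k, christoffel d.extSign d.extConst (.inr ()) (.inr ()) (k) = 0 := fun k => by
    rcases k with k | k <;>
    simp [christoffel, extSign, extConst, Sum.elim_inl, Sum.elim_inr]
  have h5 : ∀ k, christoffel d.extSign d.extConst (.inl k) (.inr ()) (.inr ()) = 0 := fun k => by
    simp [christoffel, extSign, extConst, Sum.elim_inl, Sum.elim_inr]
  have h6 : ∀ k, christoffel d.extSign d.extConst (.inr ()) (.inl k) (.inr ()) = 0 := fun k => by
    simp [christoffel, extSign, extConst, Sum.elim_inl, Sum.elim_inr]
  have hric : ∀ J K, frameRicci d.extSign d.extConst J K =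
      -(christoffel d.extSign d.extConst J K (.inr ()) * d.D.trace)
      - (∑ a, ∑ m, christoffel d.extSign d.extConst (.inl a) J (.inl m) *
            christoffel d.extSign d.extConst (.inl m) K (.inl a)
        + ∑ a, christoffel d.extSign d.extConst (.inl a) J (.inr ()) *
            christoffel d.extSign d.extConst (.inr ()) K (.inl a)
        + ∑ m, christoffel d.extSign d.extConst (.inr ()) J (.inl m) *
            christoffel d.extSign d.extConst (.inl m) K (.inr ())
        + christoffel d.extSign d.extConst (.inr ()) J (.inr ()) *
            christoffel d.extSign d.extConst (.inr ()) K (.inr ())) := by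
    intro J K
    have ht1 : ∀ m, ∑ a, d.extConst (.inl m) a a = 0 := fun m => by
      rw [Fintype.sum_sum_type]
      simpa [extConst] using htr m
    have ht2 : ∑ a, d.extConst (.inr ()) a a = d.D.trace := by
      rw [Fintype.sum_sum_type]
      simp [extConst, Matrix.trace]
    have e1 : ∑ m, christoffel d.extSign d.extConst J K m * ∑ a, d.extConst m a a =
        christoffel d.extSign d.extConst J K (.inr ()) * d.D.trace := by
      rw [Fintype.sum_sum_type, Finset.sum_eq_zero fun m _ => by rw [ht1, mul_zero]]
      rw [Fintype.sum_unique, zero_add]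
      exact congrArg _ ht2
    rw [frameRicci, e1]
    simp only [Fintype.sum_sum_type, Fintype.sum_unique, PUnit.default_eq_unit,
      Finset.sum_add_distrib]
    ring
  -- the mixed components vanish
  have hmix : ∀ k, ∑ a, ∑ m, (d.D m a + d.sgn m * d.sgn a * d.D a m) *
      christoffel d.sgn d.L.c m k a = 0 := by
    intro k
    have hz : ∀ a m, d.D m a * d.L.c m k a = 0 ∧ d.D a m * d.L.c m k a = 0 := by
      intro a m
      by_cases ham : a = m
      · subst ham
        rw [H.c_loop]; simp
      · constructor
        · by_cases h : d.D m a = 0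
          · rw [h, zero_mul]
          · rw [hrev a m ham h, mul_zero]
        · by_cases h : d.D a m = 0
          · rw [h, zero_mul]
          · rw [H.no_arrow m a (Ne.symm ham) h, mul_zero]
    -- Four of the six products vanish by the absence of arrows. The coefficient that survives is
    -- symmetric in a and m while c_{amk} is skew, so the double sum is its own negative.
    have hpt : ∀ a m, (d.D m a + d.sgn m * d.sgn a * d.D a m) * christoffel d.sgn d.L.c m k a =
        (1 / 2) * d.sgn k * (d.sgn a * d.D m a + d.sgn m * d.D a m) * d.L.c a m k := by
      intro a m
      have z1 := hz a m
      have z2 := hz m a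
      simp only [christoffel]
      rw [d.L.skew k a m]
      have sa := d.sgn_mul_self a
      linear_combination (1 / 2) * (z1.1 + d.sgn m * d.sgn a * z1.2 + d.sgn a * d.sgn m * z2.2
        + d.sgn m * d.sgn a * d.sgn a * d.sgn m * z2.1) +
        (1 / 2) * d.sgn k * d.sgn m * d.D a m * d.L.c a m k * sa
    simp only [hpt]
    have hsum : ∑ a, ∑ m, 1 / 2 * d.sgn k * (d.sgn a * d.D m a + d.sgn m * d.D a m) * d.L.c a m k =
        -∑ a, ∑ m, 1 / 2 * d.sgn k * (d.sgn a * d.D m a + d.sgn m * d.D a m) * d.L.c a m k := by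
      conv_lhs => rw [Finset.sum_comm]
      rw [← Finset.sum_neg_distrib]
      refine Finset.sum_congr rfl fun a _ => ?_
      rw [← Finset.sum_neg_distrib]
      refine Finset.sum_congr rfl fun m _ => ?_
      rw [d.L.skew m a k]; ring
    linarith
  rw [LinearMap.smul_apply, LinearMap.id_apply, LinearMap.map_smul₂,
    d.isOrthonormalFrame_ext.metric, smul_eq_mul, hric]
  rcases j with j | ⟨⟩ <;> rcases k with k | ⟨⟩
  · have hns := H.nilsoliton_coord j k
    rw [frameRicci] at hns
    simp only [htr, mul_zero, Finset.sum_const_zero, neg_zero] at hns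
    simp only [hg, h1, h3, h6]
    -- The terms through e_0 assemble to ½[D, D*] − (Tr D) D^s. They cancel the corresponding part
    -- of the Ricci tensor of 𝔤, leaving the Einstein constant −Tr((D^s)²).
    have e1 : ∑ m, (1 / 2) * (d.sgn m * d.D m j + d.sgn j * d.D j m) *
        ((1 / 2) * (d.D m k - d.sgn m * d.sgn k * d.D k m)) +
        ∑ m, (1 / 2) * (d.D m j - d.sgn m * d.sgn j * d.D j m) *
          ((1 / 2) * (d.sgn m * d.D m k + d.sgn k * d.D k m)) =
        (1 / 2) * d.sgn k * -∑ m, (d.D k m * d.adjointMatrix m j - d.adjointMatrix k m * d.D m j) := by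
      rw [← Finset.sum_add_distrib, ← Finset.sum_neg_distrib, Finset.mul_sum]
      refine Finset.sum_congr rfl fun m _ => ?_
      simp only [adjointMatrix]
      linear_combination (-(1 / 2) * d.D m k * d.D m j * d.sgn m) * d.sgn_mul_self k
        - (1 / 4) * (d.D m j * d.sgn k * d.D k m + d.sgn j * d.D j m * d.D m k) * d.sgn_mul_self m
    have e2 : (if (Sum.inl j : Fin n ⊕ Unit) = Sum.inl k then d.extSign (Sum.inl j) else 0) =
        d.sgn k * (if k = j then 1 else 0) := by
      by_cases hjk : j = k
      · simp [hjk, extSign]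
      · simp [hjk, Ne.symm hjk]
    have e3 : d.sgn k * d.adjointMatrix k j = d.sgn j * d.D j k := by
      simp only [adjointMatrix]
      linear_combination (d.sgn j * d.D j k) * d.sgn_mul_self k
    rw [e2]
    linear_combination (-1 : ℝ) * hns + e1 - (1 / 2) * d.D.trace * e3
  · have e1 := hmix j
    rw [Finset.sum_comm] at e1
    have e2 : ∑ a, ∑ m, christoffel d.sgn d.L.c a j m *
        (-(1 / 2) * (d.D a m + d.sgn a * d.sgn m * d.D m a)) = 0 := by
      rw [← neg_eq_zero, ← mul_eq_zero_iff_left (two_ne_zero : (2 : ℝ) ≠ 0), ← e1]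
      simp only [Finset.mul_sum, ← Finset.sum_neg_distrib]
      refine Finset.sum_congr rfl fun a _ => Finset.sum_congr rfl fun m _ => ?_
      ring
    simp only [hg, h2, h5, h6, h4, mul_zero, zero_mul, Finset.sum_const_zero, add_zero, e2,
      reduceCtorEq, if_false, neg_zero, sub_zero]
  · have e1 := hmix k
    have e2 : ∑ a, ∑ m, -(1 / 2) * (d.D m a + d.sgn m * d.sgn a * d.D a m) *
        christoffel d.sgn d.L.c m k a = 0 := by
      simp only [mul_assoc, ← Finset.mul_sum]
      simp only [← mul_assoc, e1, mul_zero]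
    simp only [hg, h2, h5, h6, h4, mul_zero, zero_mul, Finset.sum_const_zero, add_zero, e2,
      reduceCtorEq, if_false, neg_zero, sub_zero]
  · have e1 := H.trace_symmetrized_sq
    have hs : ∀ u, d.extSign (.inr u) = 1 := fun _ => rfl
    simp only [h2, h5, h4, mul_zero, zero_mul, Finset.sum_const_zero, add_zero, neg_zero,
      if_true, hs, mul_one, zero_sub, neg_inj]
    rw [← e1, Matrix.trace]
    refine Finset.sum_congr rfl fun a _ => ?_
    rw [Matrix.diag_apply, Matrix.mul_apply]
    refine Finset.sum_congr rfl fun m _ => ?_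
    simp only [Matrix.smul_apply, Matrix.add_apply, adjointMatrix, smul_eq_mul]
    ring

/-- A nilpotent ideal consists of ad-nilpotent elements, and Tr ad x = x_0 Tr D with Tr D ≠ 0, so it
lies in 𝔤. Hence the complement contains e_0, and symmetry of ad e_0 would make D symmetric. -/
theorem not_isPseudoIwasawa : ¬ ∃ (N : LieIdeal ℝ d.Ext) (A : LieSubalgebra ℝ d.Ext),
    IsPseudoIwasawa d.extMetric N A := by
  rintro ⟨N, A, hNA, hsym⟩
  have htrace : ∀ x : d.Ext, LinearMap.trace ℝ d.Ext (LieAlgebra.ad ℝ d.Ext x) =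
      x.right * d.D.trace := by
    have : LinearMap.trace ℝ d.Ext ∘ₗ (LieAlgebra.ad ℝ d.Ext : d.Ext →ₗ[ℝ] Module.End ℝ d.Ext) =
        d.D.trace • (SemiDirectSum.projr d.action : d.Ext →ₗ[ℝ] ℝ) := by
      refine d.extBasis.ext fun i => ?_
      have h1 : LinearMap.trace ℝ d.Ext (LieAlgebra.ad ℝ d.Ext (d.extBasis i)) =
          ∑ a, d.extConst i a a := by
        rw [LinearMap.trace_eq_matrix_trace ℝ d.extBasis, Matrix.trace]
        refine Finset.sum_congr rfl fun a _ => ?_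
        rw [Matrix.diag_apply, LinearMap.toMatrix_apply, LieAlgebra.ad_apply,
          d.isOrthonormalFrame_ext.bracket, repr_sum_smul]
      refine h1.trans ?_
      rw [Fintype.sum_sum_type]
      rcases i with i | i
      · simp [extConst, extBasis_inl, H.c_loop']
      · simp [extConst, extBasis_inr, Matrix.trace]
    intro x
    have h := congrArg (fun f => f x) this
    exact h.trans (mul_comm _ _)
  have hN : ∀ x ∈ N, x.right = 0 := by
    intro x hx
    have hnil : IsNilpotent (LieAlgebra.ad ℝ d.Ext x) := by
      have h0 := hNA.nilpotent
      obtain ⟨k, hk⟩ := LieModule.isNilpotent_toEnd_of_isNilpotent ℝ N N (⟨x, hx⟩ : N)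
      have hcoe : ∀ (m : ℕ) (y : N), (((LieModule.toEnd ℝ N N ⟨x, hx⟩) ^ m) y : d.Ext) =
          ((LieAlgebra.ad ℝ d.Ext x) ^ m) (y : d.Ext) := by
        intro m
        induction m with
        | zero => intro y; rfl
        | succ m ih => intro y; rw [pow_succ, pow_succ, Module.End.mul_apply, Module.End.mul_apply, ih]; rfl
      -- Nilpotency is known only on N; since ad x maps the whole algebra into N, one more power
      -- suffices.
      refine ⟨k + 1, LinearMap.ext fun y => ?_⟩
      have h1 := hcoe k ⟨⁅x, y⁆, lie_mem_left ℝ d.Ext N x y hx⟩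
      rw [hk] at h1
      rw [pow_succ, Module.End.mul_apply, LieAlgebra.ad_apply, ← h1]
      rfl
    have h1 := (LinearMap.isNilpotent_trace_of_isNilpotent hnil).eq_zero
    rw [htrace] at h1
    exact (mul_eq_zero.mp h1).resolve_right H.trace_ne_zero
  let e : d.Ext := ⟨0, 1⟩
  have hmem : ∀ y : d.Ext, ∃ x ∈ N, ∃ a ∈ A, x + a = y := by
    intro y
    have : y ∈ N.toSubmodule ⊔ A.toSubmodule := by
      rw [hNA.compl.sup_eq_top]; trivial
    obtain ⟨x, hx, a, ha, h⟩ := Submodule.mem_sup.mp this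
    exact ⟨x, hx, a, ha, h⟩
  obtain ⟨ν, hν, α, hα, hsum⟩ := hmem e
  -- Write e_0 = ν + α with ν ∈ N and α ∈ A. Since N lies in 𝔤, both e_0 and α are orthogonal to N,
  -- hence so is ν; being in N it is also orthogonal to A, and nondegeneracy gives ν = 0.
  have hperp : ∀ x ∈ N, d.extMetric ν x = 0 := by
    intro x hx
    have h1 : d.extMetric x (ν + α) = 0 := by
      rw [hsum, extMetric_apply, hN x hx]
      simp [e]
    rw [map_add, hNA.orthogonal x hx α hα, add_zero] at h1
    rw [← h1]
    exact d.isMetric_ext.1.eq ν x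
  have hν0 : ν = 0 := by
    refine d.isMetric_ext.2.1 ν fun y => ?_
    obtain ⟨x, hx, a, ha, rfl⟩ := hmem y
    rw [map_add, hperp x hx, hNA.orthogonal ν hν a ha, add_zero]
  rw [hν0, zero_add] at hsum
  obtain ⟨i, j, hij, hD⟩ := H.exists_off
  have h1 := hsym e (hsum ▸ hα) ⟨d.L.e i, 0⟩ ⟨d.L.e j, 0⟩
  -- At an off-diagonal entry D_{ji} ≠ 0 the opposite entry is zero, so ⟨D e_i, e_j⟩ ≠ 0 = ⟨e_i, D
  -- e_j⟩.
  have h2 : d.D i j = 0 := by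
    have := H.D_mul_comm_zero hij
    exact (mul_eq_zero.mp this).resolve_right hD
  rw [ext_lie, ext_lie, extMetric_apply, extMetric_apply] at h1
  simp only [e, zero_lie, one_smul, zero_add, zero_smul, sub_zero, mul_zero, add_zero,
    metric_apply, StructureConstants.coord_mapOf_e, StructureConstants.coord_e] at h1
  simp only [mul_ite, mul_one, mul_zero, ite_mul, one_mul, zero_mul, Finset.sum_ite_eq',
    Finset.mem_univ, if_true, h2] at h1
  exact hD ((mul_eq_zero.mp h1).resolve_left (d.sgn_ne_zero j))

end NondiagonalEquations

end Datum

end NiceNil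

/-! ### Nilpotency, solvability and the standard decomposition -/

namespace NiceNil

namespace Datum

variable {n : ℕ} (d : Datum n)

attribute [local instance] LieRing.ofAssociativeRing

open LieAlgebra

/-- The ideal `𝔤` is nilpotent when the structure constants are strictly triangular. -/
theorem isNilpotent_nilIdeal (hinc : ∀ i j k, d.L.c i j k ≠ 0 → i < k ∧ j < k) :
    LieRing.IsNilpotent d.nilIdeal := by
  have : Module.Finite ℝ d.Ext := .of_basis d.extBasis
  have : IsNoetherian ℝ d.nilIdeal := inferInstanceAs (IsNoetherian ℝ d.nilIdeal.toSubmodule)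
  refine (LieAlgebra.isNilpotent_iff_forall (R := ℝ)).2 fun x => ⟨n, LinearMap.ext fun y => ?_⟩
  -- By Engel's theorem it is enough that each ad x be nilpotent. Brackets strictly raise the index,
  -- so after m applications the first m coordinates vanish.
  have key : ∀ (m : ℕ) (k : Fin n), (k : ℕ) < m →
      d.L.coord (((LieAlgebra.ad ℝ d.nilIdeal x) ^ m) y : d.Ext).left k = 0 := by
    intro m
    induction m with
    | zero => intro k hk; omega
    | succ m ih =>
      intro k hk
      rw [pow_succ', Module.End.mul_apply, LieAlgebra.ad_apply]
      set z := ((LieAlgebra.ad ℝ d.nilIdeal x) ^ m) y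
      have hx : (x : d.Ext).right = 0 := x.2
      have hz : (z : d.Ext).right = 0 := z.2
      change d.L.coord ⁅(x : d.Ext), (z : d.Ext)⁆.left k = 0
      rw [ext_lie, hx, hz]
      simp only [zero_smul, add_zero, sub_zero]
      rw [StructureConstants.lie_apply]
      refine Finset.sum_eq_zero fun i _ => Finset.sum_eq_zero fun j _ => ?_
      by_cases hc : d.L.c i j k = 0
      · rw [hc, mul_zero]
      · rw [ih j (by have := (hinc i j k hc).2; omega), mul_zero, zero_mul]
  exact Subtype.ext (SemiDirectSum.ext (d.L.ext_coord fun k => key n k k.2) (((LieAlgebra.ad ℝ d.nilIdeal x) ^ n) y).2)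

theorem isSolvable_ext (hinc : ∀ i j k, d.L.c i j k ≠ 0 → i < k ∧ j < k) :
    LieAlgebra.IsSolvable d.Ext := by
  have := d.isNilpotent_nilIdeal hinc
  obtain ⟨k, hk⟩ := (LieAlgebra.isSolvable_iff ℝ d.nilIdeal).1 inferInstance
  refine (LieAlgebra.isSolvable_iff ℝ d.Ext).2 ⟨k + 1, ?_⟩
  -- Brackets in the extension have no e_0-component, so solvability follows from that of the
  -- nilpotent ideal with one more derived step.
  have hle : derivedSeriesOfIdeal ℝ d.Ext 1 ⊤ ≤ d.nilIdeal := by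
    rw [derivedSeriesOfIdeal_succ, derivedSeriesOfIdeal_zero, LieSubmodule.lieIdeal_oper_eq_span,
      LieSubmodule.lieSpan_le]
    rintro _ ⟨x, y, rfl⟩
    change (⁅(x : d.Ext), (y : d.Ext)⁆ : d.Ext).right = 0
    rw [ext_lie]
  have hk' := (LieIdeal.derivedSeries_eq_bot_iff d.nilIdeal k).1 hk
  rw [derivedSeries_def, derivedSeriesOfIdeal_add, eq_bot_iff, ← hk']
  exact derivedSeriesOfIdeal_le hle le_rfl

theorem isStandardDecomposition (hinc : ∀ i j k, d.L.c i j k ≠ 0 → i < k ∧ j < k) :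
    IsStandardDecomposition d.extMetric d.nilIdeal d.line where
  compl := by
    constructor
    · rw [Submodule.disjoint_def]
      rintro x hx ⟨t, rfl⟩
      have : t = 0 := hx
      subst this
      exact map_zero (SemiDirectSum.inr d.action)
    · rw [codisjoint_iff, eq_top_iff]
      intro x _
      refine Submodule.mem_sup.2 ⟨⟨x.left, 0⟩, rfl, ⟨0, x.right⟩, ⟨x.right, rfl⟩, ?_⟩
      exact SemiDirectSum.ext (add_zero _) (zero_add _)
  orthogonal := by
    rintro x hx _ ⟨t, rfl⟩
    have hx' : x.right = 0 := hx
    rw [extMetric_apply, hx', zero_mul, add_zero]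
    exact map_zero _
  nilpotent := d.isNilpotent_nilIdeal hinc
  abelian := by
    refine ⟨?_⟩
    rintro ⟨_, s, rfl⟩ ⟨_, t, rfl⟩
    refine Subtype.ext ?_
    change ⁅(SemiDirectSum.inr d.action s), (SemiDirectSum.inr d.action t)⁆ = 0
    rw [← LieHom.map_lie, LieRing.of_associative_ring_bracket, mul_comm, sub_self, map_zero]

end Datum

end NiceNil

/-! ### Solutions arising from a triple, and the equations without one -/

namespace NiceNil

/-- Rows of the root matrix are indexed by i < j, whereas curvature sums run over all i and j. This
is the source of the factors 2 and 4 in the balance equations. -/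
theorem sum_eq_two_mul_sum_lt {n : ℕ} (f : Fin n → Fin n → Fin n → ℝ)
    (hs : ∀ i j k, f i j k = f j i k) (h0 : ∀ i k, f i i k = 0) :
    ∑ i, ∑ j, ∑ k, f i j k = 2 * ∑ i, ∑ j, ∑ k, if i < j then f i j k else 0 := by
  have h2 : ∑ i, ∑ j, ∑ k, (if i < j then f i j k else 0) =
      ∑ i, ∑ j, ∑ k, if j < i then f i j k else 0 := by
    rw [Finset.sum_comm]
    refine Finset.sum_congr rfl fun i _ => Finset.sum_congr rfl fun j _ =>
      Finset.sum_congr rfl fun k _ => ?_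
    rw [hs]
  rw [two_mul]
  conv_rhs => arg 2; rw [h2]
  simp only [← Finset.sum_add_distrib]
  refine Finset.sum_congr rfl fun i _ => Finset.sum_congr rfl fun j _ =>
    Finset.sum_congr rfl fun k _ => ?_
  rcases lt_trichotomy i j with h | h | h
  · simp [h, h.not_gt]
  · subst h
    simp [h0]
  · simp [h, h.not_gt]

theorem NiceDiagram.sum_row {n : ℕ} (Δ : NiceDiagram n) (f : Fin n → Fin n → Fin n → ℝ)
    (hs : ∀ i j k, f i j k = f j i k) (h0 : ∀ i j k, (i, j, k) ∉ Δ.arrows → f i j k = 0) :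
    ∑ i, ∑ j, ∑ k, f i j k = 2 * ∑ I : Δ.Row, f I.1.1 I.1.2.1 I.1.2.2 := by
  have h1 : ∑ I : Δ.Row, f I.1.1 I.1.2.1 I.1.2.2 =
      ∑ i, ∑ j, ∑ k, if i < j then f i j k else 0 := by
    have e := Finset.sum_subtype (F := (inferInstance : Fintype Δ.Row)) (Δ.arrows.filter fun I => I.1 < I.2.1)
      (fun I => Finset.mem_filter) (fun I => f I.1 I.2.1 I.2.2)
    rw [← e, Finset.sum_filter]
    rw [Finset.sum_subset (Finset.subset_univ Δ.arrows)]
    · rw [Fintype.sum_prod_type]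
      refine Finset.sum_congr rfl fun i _ => ?_
      rw [Fintype.sum_prod_type]
    · intro I _ hI
      rw [h0 _ _ _ hI, ite_self]
  rw [h1]
  exact sum_eq_two_mul_sum_lt f hs fun i k => h0 i i k fun hI => (Δ.swap _ _ _ hI).1 rfl

theorem logsign_eq {x y : ℝ} (h : logsign x = logsign y) (hx : x ≠ 0) (hy : y ≠ 0) :
    0 < x * y := by
  unfold logsign at h
  rcases hx.lt_or_gt with h1 | h1 <;> rcases hy.lt_or_gt with h2 | h2 <;>
    simp [h1, h2, h1.not_gt, h2.not_gt] at h
  · exact mul_pos_of_neg_of_neg h1 h2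
  · exact mul_pos h1 h2

theorem logsign_sign {s : ℝ} (hs : s = 1 ∨ s = -1) {x : ℝ} (hx : 0 < x) :
    logsign (s * x) = logsign s := by
  rcases hs with rfl | rfl <;> simp [logsign, hx, hx.not_gt, show ¬ (1 : ℝ) < 0 by norm_num]

theorem logsign_mul {s t : ℝ} (hs : s = 1 ∨ s = -1) (ht : t = 1 ∨ t = -1) :
    logsign (s * t) = logsign s + logsign t := by
  rcases hs with rfl | rfl <;> rcases ht with rfl | rfl <;>
    simp [logsign, show ¬ (1 : ℝ) < 0 by norm_num]
  decide

namespace Datum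

variable {n : ℕ} (d : Datum n)

theorem weight_symm (i j k : Fin n) : d.weight i j k = d.weight j i k := by
  rw [weight, weight, d.L.skew i j k]; ring

theorem sum_pairs (𝒜 : Finset (Fin n × Fin n)) (h : ∀ i j, i ≠ j → d.D j i ≠ 0 → (i, j) ∈ 𝒜)
    (F : Fin n → Fin n → ℝ) :
    ∑ p : {p // p ∈ 𝒜}, d.offWeight p.1.1 p.1.2 * F p.1.1 p.1.2 =
      ∑ i, ∑ j, d.offWeight i j * F i j := by
  rw [Finset.sum_coe_sort 𝒜 fun p => d.offWeight p.1 p.2 * F p.1 p.2,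
    Finset.sum_subset (Finset.subset_univ 𝒜), Fintype.sum_prod_type]
  rintro ⟨i, j⟩ _ hp
  by_cases hij : i = j
  · simp [offWeight, hij]
  · have : d.D j i = 0 := by
      by_contra h0
      exact hp (h i j hij h0)
    simp [offWeight, this]

/-- The auxiliary data are determined by c, D and ε: the entry and sign conditions identify 2 A^i_j
Tr D with the weight of the pair, and the bracket and log sign conditions identify x_I with the
weight of the row. Substituting both turns the equation for X into the balance equations. -/
theorem IsNondiagonalSolution.equations {d : Datum n} (hd : d.IsNondiagonalSolution) :
    d.NondiagonalEquations := by
  obtain ⟨Δ, T, hΔ, hD, X, hX, hsign, hpair, hsq⟩ := hd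
  have hT : d.D.trace ≠ 0 := by
    obtain ⟨p, hp⟩ := T.nonempty
    have := (T.entry_sq ⟨p, hp⟩).2
    rw [hD]
    intro h
    rw [h] at this
    simp at this
  have hoff : ∀ i j, i ≠ j → d.D j i ≠ 0 → (i, j) ∈ T.𝒜 := fun i j hij h => by
    by_contra h0
    exact h (hD ▸ T.off_diagonal i j hij h0)
  have hne : ∀ p ∈ T.𝒜, d.D p.2 p.1 ≠ 0 := fun p hp h => by
    have := T.entry_sq ⟨p, hp⟩
    rw [← hD, h] at this
    exact this.2 (by rw [← this.1]; simp)
  -- Multiply |2 A Tr D| = a² by the sign of A Tr D, which is ε_i/ε_j = ε_i ε_j.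
  have hA : ∀ p : {p // p ∈ T.𝒜}, 2 * T.A p * d.D.trace = d.offWeight p.1.1 p.1.2 := by
    intro p
    have h1 := (T.entry_sq p).1
    have h2 := hpair p
    rw [← hD] at h1 h2
    rw [offWeight, if_neg (T.ne p.1 p.2), h1]
    change d.sgn p.1.1 / d.sgn p.1.2 = _ at h2
    have h3 : d.sgn p.1.1 * d.sgn p.1.2 = Real.sign (T.A p * d.D.trace) := by
      rw [← h2]
      field_simp [d.sgn_ne_zero]
      rw [sq, d.sgn_mul_self]
    have h4 : Real.sign (T.A p * d.D.trace) * |T.A p * d.D.trace| = T.A p * d.D.trace := by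
      rw [mul_comm]
      rcases lt_trichotomy (T.A p * d.D.trace) 0 with h | h | h
      · rw [Real.sign_of_neg h, abs_of_neg h]; ring
      · rw [h]; simp
      · rw [Real.sign_of_pos h, abs_of_pos h]; ring
    rw [h3, mul_assoc, abs_mul, abs_two]
    linear_combination -2 * h4
  have hrow : ∀ (l : Fin n) (I : Δ.Row), Δ.rootMatrixReal I l =
      rootEntry l I.1.1 I.1.2.1 I.1.2.2 := fun l I => by
    simp [NiceDiagram.rootMatrixReal, NiceDiagram.rootMatrix, rootEntry]
  have hXw : ∀ I : Δ.Row, X I = d.weight I.1.1 I.1.2.1 I.1.2.2 := by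
    intro I
    have h1 := hsq I
    have hc : d.L.c I.1.1 I.1.2.1 I.1.2.2 ≠ 0 := (hΔ _ _ _).2 I.2.1
    have hX0 : X I ≠ 0 := fun h => by
      rw [h, abs_zero] at h1
      exact hc (pow_eq_zero_iff two_ne_zero |>.1 h1)
    have h2 := congrFun hsign I
    have h3 : (Δ.rootMatrixMod2 *ᵥ fun i => logsign ((d.ε i : ℤ) : ℝ)) I =
        logsign (d.sgn I.1.1 * d.sgn I.1.2.1 * d.sgn I.1.2.2) := by
      have hm : ∀ i j : Fin n, d.sgn i * d.sgn j = 1 ∨ d.sgn i * d.sgn j = -1 := fun i j => by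
        rcases d.sgn_eq i with h | h <;> rcases d.sgn_eq j with h' | h' <;> simp [h, h']
      rw [logsign_mul (hm _ _) (d.sgn_eq _), logsign_mul (d.sgn_eq _) (d.sgn_eq _)]
      -- Modulo 2 the entries −1 and 1 of the root matrix coincide, so its row gives the log sign of
      -- the product ε_i ε_j ε_k.
      have h4 : ∀ z : ZMod 2, -z = z := by decide
      simp only [Matrix.mulVec, dotProduct, NiceDiagram.rootMatrixMod2, NiceDiagram.rootMatrix,
        Matrix.map_apply, Int.cast_sub, Int.cast_ite, Int.cast_one, Int.cast_zero, sub_mul,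
        Finset.sum_sub_distrib, ite_mul, one_mul, zero_mul, Finset.sum_ite_eq', Finset.mem_univ,
        if_true, sgn]
      rw [sub_eq_add_neg, sub_eq_add_neg, h4, h4]
      ring
    rw [h3] at h2
    set s := d.sgn I.1.1 * d.sgn I.1.2.1 * d.sgn I.1.2.2 with hs
    have hs1 : s = 1 ∨ s = -1 := by
      rcases d.sgn_eq I.1.1 with h | h <;> rcases d.sgn_eq I.1.2.1 with h' | h' <;>
        rcases d.sgn_eq I.1.2.2 with h'' | h'' <;> simp [hs, h, h', h'']
    have h5 := logsign_eq h2 (by rcases hs1 with h | h <;> simp [h]) hX0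
    rw [weight, ← hs, h1]
    rcases hs1 with h | h <;> rw [h] at h5 ⊢
    · rw [one_mul] at *
      exact (abs_of_pos h5).symm
    · rw [abs_of_neg (by linarith)]; ring
  refine ⟨hT, ?_, ?_, ?_, ?_, ?_, ?_, ?_, ?_, ?_, ?_⟩
  · obtain ⟨p, hp⟩ := T.nonempty
    exact ⟨p.1, p.2, T.ne p hp, hne p hp⟩
  · intro i j i' j' hij hij' h h' hpq
    exact T.disjoint _ (hoff i j hij h) _ (hoff i' j' hij' h') hpq
  · intro i j hij h k
    by_contra hc
    exact T.no_arrow _ (hoff i j hij h) k ((hΔ _ _ _).1 hc)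
  · intro i j hij h
    rw [hD]
    exact T.trace_eq _ (hoff i j hij h)
  · have key : ∀ i j k, i < j → d.L.c i j k ≠ 0 → d.D k k = d.D i i + d.D j j := by
      intro i j k hij hc
      have h1 := congrFun T.diag_mem_ker ⟨(i, j, k), (hΔ _ _ _).1 hc, hij⟩
      simp only [Matrix.mulVec, dotProduct, hrow, rootEntry, sub_mul, Finset.sum_sub_distrib,
        ite_mul, one_mul, zero_mul, Finset.sum_ite_eq', Finset.mem_univ, if_true, ← hD,
        Pi.zero_apply] at h1
      linarith
    intro i j k hc
    rcases lt_trichotomy i j with h | h | h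
    · exact key i j k h hc
    · exact absurd h ((Δ.swap _ _ _ ((hΔ _ _ _).1 hc)).1)
    · rw [key j i k h (by rw [d.L.skew, neg_ne_zero]; exact hc), add_comm]
  · intro l
    have h1 := congrFun hX l
    rw [Pi.smul_apply, smul_eq_mul, ← hD] at h1
    rw [Δ.sum_row (fun i j k => rootEntry l i j k * d.weight i j k)
      (fun i j k => by rw [weight_symm, rootEntry, rootEntry]; ring)
      (fun i j k h => by rw [weight, not_not.1 (mt (hΔ i j k).1 h)]; ring)]
    have h2 : (Δ.rootMatrixRealᵀ *ᵥ X) l =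
        ∑ I : Δ.Row, rootEntry l I.1.1 I.1.2.1 I.1.2.2 * d.weight I.1.1 I.1.2.1 I.1.2.2 :=
      Finset.sum_congr rfl fun I _ => by
        change Δ.rootMatrixReal I l * X I = _
        rw [hrow, hXw]
    have h3 : ∑ p : {p // p ∈ T.𝒜}, 2 * T.A p * d.D.trace = ∑ i, ∑ j, d.offWeight i j := by
      have := d.sum_pairs T.𝒜 hoff fun _ _ => 1
      simp only [mul_one] at this
      rw [← this]
      exact Finset.sum_congr rfl fun p _ => hA p
    have h4 : ∑ p : {p // p ∈ T.𝒜}, 2 * T.A p * d.D.trace *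
        ((if l = p.1.1 then 1 else 0) - (if l = p.1.2 then 1 else 0)) =
        ∑ j, d.offWeight l j - ∑ i, d.offWeight i l := by
      have := d.sum_pairs T.𝒜 hoff fun i j => (if l = i then 1 else 0) - (if l = j then 1 else 0)
      rw [Finset.sum_congr rfl fun p _ => by rw [hA p], this]
      simp only [mul_sub, mul_ite, mul_one, mul_zero, Finset.sum_sub_distrib, Finset.sum_ite_eq,
        Finset.mem_univ, if_true]
      rw [Finset.sum_comm]
      simp only [Finset.sum_ite_eq, Finset.mem_univ, if_true]
    have h5 : ∑ p : {p // p ∈ T.𝒜}, 2 * T.A p * d.D.trace = 2 * d.D.trace * ∑ p, T.A p := by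
      rw [Finset.mul_sum]; exact Finset.sum_congr rfl fun p _ => by ring
    have h6 : ∑ p : {p // p ∈ T.𝒜}, 2 * T.A p * d.D.trace *
        ((if l = p.1.1 then 1 else 0) - (if l = p.1.2 then 1 else 0)) = 2 * d.D.trace *
        ∑ p : {p // p ∈ T.𝒜}, T.A p * ((if l = p.1.1 then 1 else 0) -
          (if l = p.1.2 then 1 else 0)) := by
      rw [Finset.mul_sum]; exact Finset.sum_congr rfl fun p _ => by ring
    rw [h2] at h1
    rw [← h3, ← h4, h5, h6]
    have h7 : (1 / (2 * d.D.trace)) * (2 * d.D.trace) = 1 := by field_simp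
    set Sx := ∑ I : Δ.Row, rootEntry l I.1.1 I.1.2.1 I.1.2.2 * d.weight I.1.1 I.1.2.1 I.1.2.2
    linear_combination (4 * d.D.trace) * h1 - 2 * Sx * h7
  · intro i j j' k h h'
    exact Δ.label_unique _ _ _ _ ((hΔ _ _ _).1 h) ((hΔ _ _ _).1 h')
  · intro i j k k' h h'
    exact Δ.target_unique _ _ _ _ ((hΔ _ _ _).1 h) ((hΔ _ _ _).1 h')
  · have : (fun a b => ∃ j, d.L.c a j b ≠ 0) = fun a b => ∃ j, (a, j, b) ∈ Δ.arrows := by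
      funext a b
      exact propext (exists_congr fun j => hΔ _ _ _)
    rw [this]
    exact Δ.acyclic
  · intro i j k l
    simp only [hΔ _ _ _]
    exact Δ.concat i j k l

namespace NondiagonalEquations

variable {d} (H : d.NondiagonalEquations)
include H

open scoped Classical in
/-- The diagram of the Lie algebra. -/
def diagram : NiceDiagram n where
  arrows := Finset.univ.filter fun I => d.L.c I.1 I.2.1 I.2.2 ≠ 0
  acyclic := by simpa using H.acyclic
  label_unique i j j' k h h' := H.label_unique i j j' k (by simpa using h) (by simpa using h')
  target_unique i j k k' h h' := H.target_unique i j k k' (by simpa using h) (by simpa using h')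
  source_unique i i' j k h h' := by
    refine H.label_unique j i i' k ?_ ?_ <;> rw [d.L.skew, neg_ne_zero]
    · simpa using h
    · simpa using h'
  swap i j k h := by
    have h' : d.L.c i j k ≠ 0 := by simpa using h
    refine ⟨fun e => h' (by rw [e, d.c_self]), ?_⟩
    simpa using (by rw [d.L.skew, neg_ne_zero]; exact h' : d.L.c j i k ≠ 0)
  concat := by simpa using H.concat

theorem mem_diagram (i j k : Fin n) : d.L.c i j k ≠ 0 ↔ (i, j, k) ∈ H.diagram.arrows := by
  simp [diagram]

theorem mulVec_diagram (μ : Fin n → ℝ) (I : H.diagram.Row) :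
    (H.diagram.rootMatrixReal *ᵥ μ) I = μ I.1.2.2 - μ I.1.1 - μ I.1.2.1 := by
  simp only [Matrix.mulVec, dotProduct, NiceDiagram.rootMatrixReal, NiceDiagram.rootMatrix,
    Matrix.map_apply, Int.cast_sub, Int.cast_ite, Int.cast_one, Int.cast_zero, sub_mul,
    Finset.sum_sub_distrib, ite_mul, one_mul, zero_mul, Finset.sum_ite_eq', Finset.mem_univ,
    if_true]

open scoped Classical in
/-- The support of the off-diagonal part of the derivation. -/
def offSupport (_H : d.NondiagonalEquations) : Finset (Fin n × Fin n) :=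
  Finset.univ.filter fun p => p.1 ≠ p.2 ∧ d.D p.2 p.1 ≠ 0

theorem mem_offSupport (p : Fin n × Fin n) : p ∈ H.offSupport ↔ p.1 ≠ p.2 ∧ d.D p.2 p.1 ≠ 0 := by
  simp [offSupport]

theorem offWeight_ne_zero {p : Fin n × Fin n} (hp : p ∈ H.offSupport) :
    d.offWeight p.1 p.2 ≠ 0 := by
  obtain ⟨h1, h2⟩ := (H.mem_offSupport p).1 hp
  rw [offWeight, if_neg h1]
  exact mul_ne_zero (mul_ne_zero (d.sgn_ne_zero _) (d.sgn_ne_zero _)) (pow_ne_zero 2 h2)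

theorem sum_offSupport (F : Fin n → Fin n → ℝ) :
    ∑ p : {p // p ∈ H.offSupport}, d.offWeight p.1.1 p.1.2 / (2 * d.D.trace) * F p.1.1 p.1.2 =
      (∑ i, ∑ j, d.offWeight i j * F i j) / (2 * d.D.trace) := by
  rw [← d.sum_pairs H.offSupport (fun i j hij h => (H.mem_offSupport _).2 ⟨hij, h⟩) F,
    Finset.sum_div]
  exact Finset.sum_congr rfl fun p _ => by ring

/-- The nondiagonal triple of a solution. -/
def triple : NondiagonalTriple H.diagram where
  D := d.D
  𝒜 := H.offSupport
  A := fun p => d.offWeight p.1.1 p.1.2 / (2 * d.D.trace)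
  nonempty := by
    obtain ⟨i, j, hij, h⟩ := H.exists_off
    exact ⟨(i, j), (H.mem_offSupport _).2 ⟨hij, h⟩⟩
  A_ne_zero p := div_ne_zero (H.offWeight_ne_zero p.2) (mul_ne_zero two_ne_zero H.trace_ne_zero)
  ne p hp := ((H.mem_offSupport p).1 hp).1
  disjoint p hp q hq hpq := by
    obtain ⟨h1, h2⟩ := (H.mem_offSupport p).1 hp
    obtain ⟨h3, h4⟩ := (H.mem_offSupport q).1 hq
    exact H.disjoint _ _ _ _ h1 h3 h2 h4 hpq
  no_arrow p hp k hk := by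
    obtain ⟨h1, h2⟩ := (H.mem_offSupport p).1 hp
    exact (H.mem_diagram _ _ _).2 hk (H.no_arrow _ _ h1 h2 k)
  nik μ hμ := by
    have hT := H.trace_ne_zero
    have hker : ∀ i j k, d.L.c i j k ≠ 0 → μ k - μ i - μ j = 0 := by
      intro i j k hc
      have hmem := (H.mem_diagram i j k).1 hc
      rcases lt_trichotomy i j with h | h | h
      · rw [← H.mulVec_diagram μ ⟨(i, j, k), hmem, h⟩, hμ, Pi.zero_apply]
      · exact absurd h (H.diagram.swap _ _ _ hmem).1
      · have := H.mulVec_diagram μ ⟨(j, i, k), (H.diagram.swap _ _ _ hmem).2, h⟩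
        rw [hμ, Pi.zero_apply] at this
        linarith
    have e1 := H.sum_offSupport fun _ _ => 1
    have e2 := H.sum_offSupport fun i j => μ j - μ i
    simp only [mul_one] at e1
    rw [e1, e2]
    -- For μ ∈ ker M, pairing the balance equations with μ annihilates the root matrix side; the
    -- other side is, up to a multiple of Tr D, the required identity.
    have hb : ∑ l, (∑ i, ∑ j, ∑ k, rootEntry l i j k * d.weight i j k) * μ l = 0 := by
      simp only [Finset.sum_mul]
      rw [Finset.sum_comm]
      refine Finset.sum_eq_zero fun i _ => ?_
      rw [Finset.sum_comm]
      refine Finset.sum_eq_zero fun j _ => ?_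
      rw [Finset.sum_comm]
      refine Finset.sum_eq_zero fun k _ => ?_
      by_cases hc : d.L.c i j k = 0
      · exact Finset.sum_eq_zero fun l _ => by rw [weight, hc]; ring
      · have : ∑ l, rootEntry l i j k * d.weight i j k * μ l =
            d.weight i j k * (μ k - μ i - μ j) := by
          simp only [rootEntry, sub_mul, ite_mul, one_mul, zero_mul, Finset.sum_sub_distrib,
            Finset.sum_ite_eq', Finset.mem_univ, if_true]
          ring
        rw [this, hker i j k hc, mul_zero]
    have hc : ∑ l, (4 * d.D.trace * (d.D l l - 1) - 2 * ∑ i, ∑ j, d.offWeight i j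
        + 2 * (∑ j, d.offWeight l j - ∑ i, d.offWeight i l)) * μ l = 0 := by
      rw [← hb]
      exact Finset.sum_congr rfl fun l _ => by rw [H.balance l]
    have hd : ∑ l, (∑ j, d.offWeight l j - ∑ i, d.offWeight i l) * μ l =
        -∑ i, ∑ j, d.offWeight i j * (μ j - μ i) := by
      have h1 : ∑ l, (∑ i, d.offWeight i l) * μ l = ∑ i, ∑ j, d.offWeight i j * μ j := by
        simp only [Finset.sum_mul]
        exact Finset.sum_comm
      have h2 : ∑ l, (∑ j, d.offWeight l j) * μ l = ∑ i, ∑ j, d.offWeight i j * μ i := by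
        simp only [Finset.sum_mul]
      simp only [sub_mul, Finset.sum_sub_distrib, mul_sub, h1, h2]
      ring
    have he : ∑ l, (4 * d.D.trace * (d.D l l - 1) - 2 * ∑ i, ∑ j, d.offWeight i j
        + 2 * (∑ j, d.offWeight l j - ∑ i, d.offWeight i l)) * μ l =
        4 * d.D.trace * (∑ i, d.D i i * μ i - ∑ i, μ i) -
        2 * (∑ i, ∑ j, d.offWeight i j) * ∑ i, μ i +
        2 * ∑ l, (∑ j, d.offWeight l j - ∑ i, d.offWeight i l) * μ l := by
      have hg : ∀ (S : ℝ) (g : Fin n → ℝ),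
          ∑ l, (4 * d.D.trace * (d.D l l - 1) - 2 * S + 2 * g l) * μ l =
          4 * d.D.trace * (∑ i, d.D i i * μ i - ∑ i, μ i) - 2 * S * ∑ i, μ i +
            2 * ∑ l, g l * μ l := fun S g => by
        simp only [mul_sub, Finset.mul_sum, ← Finset.sum_sub_distrib, ← Finset.sum_add_distrib]
        exact Finset.sum_congr rfl fun l _ => by ring
      exact hg _ _
    rw [he, hd] at hc
    field_simp
    linear_combination (1 / 2) * hc
  trace_eq p hp := by
    obtain ⟨h1, h2⟩ := (H.mem_offSupport p).1 hp
    exact H.trace_eq _ _ h1 h2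
  off_diagonal i j hij h := by
    by_contra h0
    exact h ((H.mem_offSupport _).2 ⟨hij, h0⟩)
  entry_sq p := by
    have hT := H.trace_ne_zero
    have e : 2 * (d.offWeight p.1.1 p.1.2 / (2 * d.D.trace)) * d.D.trace =
        d.offWeight p.1.1 p.1.2 := by field_simp
    rw [e]
    refine ⟨?_, abs_ne_zero.2 (H.offWeight_ne_zero p.2)⟩
    rw [offWeight, if_neg ((H.mem_offSupport p.1).1 p.2).1]
    rcases d.sgn_eq p.1.1 with h | h <;> rcases d.sgn_eq p.1.2 with h' | h' <;> simp [h, h']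
  diag_mem_ker := by
    funext I
    rw [H.mulVec_diagram, H.diag_eq _ _ _ ((H.mem_diagram _ _ _).2 I.2.1), Pi.zero_apply]
    ring

/-- Take the weights themselves as X, and A = weight/(2 Tr D). Dividing the balance equation by 4 Tr
D gives the equation for X, and the sign and modulus conditions hold because weights are signs times
nonzero squares. -/
theorem isNondiagonalSolution : d.IsNondiagonalSolution := by
  refine ⟨H.diagram, H.triple, H.mem_diagram, rfl,
    fun I => d.weight I.1.1 I.1.2.1 I.1.2.2, ?_, ?_, ?_, ?_⟩
  · funext l
    have hT := H.trace_ne_zero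
    have h1 := H.balance l
    rw [H.diagram.sum_row (fun i j k => rootEntry l i j k * d.weight i j k)
      (fun i j k => by rw [weight_symm, rootEntry, rootEntry]; ring)
      (fun i j k h => by rw [weight, not_not.1 (mt (H.mem_diagram i j k).1 h)]; ring)] at h1
    have h2 : (H.diagram.rootMatrixRealᵀ *ᵥ fun I => d.weight I.1.1 I.1.2.1 I.1.2.2) l =
        ∑ I : H.diagram.Row, rootEntry l I.1.1 I.1.2.1 I.1.2.2 * d.weight I.1.1 I.1.2.1 I.1.2.2 :=
      Finset.sum_congr rfl fun I _ => by
        simp [NiceDiagram.rootMatrixReal, NiceDiagram.rootMatrix, rootEntry]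
    have e1 := H.sum_offSupport fun _ _ => 1
    have e2 := H.sum_offSupport fun i j => (if l = i then 1 else 0) - (if l = j then 1 else 0)
    have e3 : ∑ i, ∑ j, d.offWeight i j * ((if l = i then 1 else 0) - (if l = j then 1 else 0)) =
        ∑ j, d.offWeight l j - ∑ i, d.offWeight i l := by
      simp only [mul_sub, mul_ite, mul_one, mul_zero, Finset.sum_sub_distrib, Finset.sum_ite_eq,
        Finset.mem_univ, if_true]
      rw [Finset.sum_comm]
      simp only [Finset.sum_ite_eq, Finset.mem_univ, if_true]
    simp only [mul_one] at e1
    rw [e3] at e2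
    rw [Pi.smul_apply, smul_eq_mul, h2]
    change 1 / (2 * d.D.trace) * _ = -1 - (∑ p : {p // p ∈ H.offSupport},
      d.offWeight p.1.1 p.1.2 / (2 * d.D.trace)) + ∑ p : {p // p ∈ H.offSupport},
      d.offWeight p.1.1 p.1.2 / (2 * d.D.trace) * _ + d.D l l
    rw [e1, e2]
    field_simp
    linear_combination (1 / 2) * h1
  · funext I
    have hc := (H.mem_diagram _ _ _).2 I.2.1
    have hm : ∀ i j : Fin n, d.sgn i * d.sgn j = 1 ∨ d.sgn i * d.sgn j = -1 := fun i j => by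
      rcases d.sgn_eq i with h | h <;> rcases d.sgn_eq j with h' | h' <;> simp [h, h']
    have hm3 : ∀ i j k : Fin n, d.sgn i * d.sgn j * d.sgn k = 1 ∨
        d.sgn i * d.sgn j * d.sgn k = -1 := fun i j k => by
      rcases hm i j with h | h <;> rcases d.sgn_eq k with h' | h' <;> simp [h, h']
    change _ = logsign (d.weight I.1.1 I.1.2.1 I.1.2.2)
    rw [weight, logsign_sign (hm3 _ _ _) (by positivity), logsign_mul (hm _ _) (d.sgn_eq _),
      logsign_mul (d.sgn_eq _) (d.sgn_eq _)]
    have h4 : ∀ z : ZMod 2, -z = z := by decide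
    simp only [Matrix.mulVec, dotProduct, NiceDiagram.rootMatrixMod2, NiceDiagram.rootMatrix,
      Matrix.map_apply, Int.cast_sub, Int.cast_ite, Int.cast_one, Int.cast_zero, sub_mul,
      Finset.sum_sub_distrib, ite_mul, one_mul, zero_mul, Finset.sum_ite_eq', Finset.mem_univ,
      if_true, sgn]
    rw [sub_eq_add_neg, sub_eq_add_neg, h4, h4]
    ring
  · intro p
    have hT := H.trace_ne_zero
    obtain ⟨h1, h2⟩ := (H.mem_offSupport p.1).1 p.2
    have e : (d.offWeight p.1.1 p.1.2 / (2 * d.D.trace)) * d.D.trace =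
        d.offWeight p.1.1 p.1.2 / 2 := by field_simp
    change d.sgn p.1.1 / d.sgn p.1.2 =
      Real.sign ((d.offWeight p.1.1 p.1.2 / (2 * d.D.trace)) * d.D.trace)
    rw [e, offWeight, if_neg h1]
    have hpos : 0 < d.D p.1.2 p.1.1 ^ 2 / 2 := by positivity
    rcases d.sgn_eq p.1.1 with h | h <;> rcases d.sgn_eq p.1.2 with h' | h' <;> simp only [h, h']
    · rw [Real.sign_of_pos (by linarith)]; norm_num
    · rw [Real.sign_of_neg (by linarith)]; norm_num
    · rw [Real.sign_of_neg (by linarith)]; norm_num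
    · rw [Real.sign_of_pos (by linarith)]; norm_num
  · intro I
    change _ = |d.weight I.1.1 I.1.2.1 I.1.2.2|
    rw [weight]
    rcases d.sgn_eq I.1.1 with h | h <;> rcases d.sgn_eq I.1.2.1 with h' | h' <;>
      rcases d.sgn_eq I.1.2.2 with h'' | h'' <;> simp [h, h', h'']

end NondiagonalEquations

end Datum

end NiceNil

namespace NiceNil

/-! ### Signed squares -/

/-- The signed square `x |x|`. -/
def ssq (x : ℝ) : ℝ := x * |x|

theorem ssq_mul (x y : ℝ) : ssq (x * y) = ssq x * ssq y := by
  simp only [ssq, abs_mul]; ring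

theorem ssq_neg (x : ℝ) : ssq (-x) = -ssq x := by simp [ssq]

@[simp] theorem ssq_zero : ssq 0 = 0 := by simp [ssq]

@[simp] theorem ssq_one : ssq 1 = 1 := by simp [ssq]

@[simp] theorem ssq_eq_zero {x : ℝ} : ssq x = 0 ↔ x = 0 := by simp [ssq]

theorem abs_ssq (x : ℝ) : |ssq x| = x ^ 2 := by
  rw [ssq, abs_mul, abs_abs, ← sq, sq_abs]

theorem ssq_of_nonneg {x : ℝ} (h : 0 ≤ x) : ssq x = x ^ 2 := by
  rw [ssq, abs_of_nonneg h, sq]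

/-- The signed square keeps both the modulus and the sign. Together with multiplicativity this
reduces monomial identities and two-term cancellations between square roots to identities between
rational numbers. -/
theorem ssq_injective : Function.Injective ssq := by
  intro x y h
  have h2 : x ^ 2 = y ^ 2 := by rw [← abs_ssq, h, abs_ssq]
  rcases sq_eq_sq_iff_eq_or_eq_neg.1 h2 with e | e
  · exact e
  · rw [e, ssq_neg] at h
    have : ssq y = 0 := by linarith
    rw [e, ssq_eq_zero.1 this, neg_zero]

theorem ssq_sign {s : ℝ} (hs : s = 1 ∨ s = -1) : ssq s = s := by
  rcases hs with rfl | rfl <;> simp [ssq]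

theorem mul_sign {s t : ℝ} (hs : s = 1 ∨ s = -1) (ht : t = 1 ∨ t = -1) :
    s * t = 1 ∨ s * t = -1 := by
  rcases hs with rfl | rfl <;> rcases ht with rfl | rfl <;> simp

/-! ### Supports -/

theorem hasTri_iff {S : List Tri} {i j k : ℕ} :
    hasTri S i j k = true ↔ (i, j, k) ∈ S ∨ (j, i, k) ∈ S := by
  simp only [hasTri, List.any_eq_true, Bool.and_eq_true, Bool.or_eq_true, Nat.beq_eq]
  constructor
  · rintro ⟨⟨a, b, c⟩, hm, hk, ⟨h1, h2⟩ | ⟨h1, h2⟩⟩ <;> simp only at hk h1 h2 <;> subst hk h1 h2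
    · exact Or.inl hm
    · exact Or.inr hm
  · rintro (h | h)
    · exact ⟨_, h, rfl, Or.inl ⟨rfl, rfl⟩⟩
    · exact ⟨_, h, rfl, Or.inr ⟨rfl, rfl⟩⟩

theorem hasPair_iff {P : List (ℕ × ℕ)} {i j : ℕ} : hasPair P i j = true ↔ (i, j) ∈ P := by
  simp only [hasPair, List.any_eq_true, Bool.and_eq_true, Nat.beq_eq]
  constructor
  · rintro ⟨⟨a, b⟩, hm, h1, h2⟩
    simp only at h1 h2
    subst h1 h2
    exact hm
  · intro h
    exact ⟨_, h, rfl, rfl⟩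

/-- The structure constants `c` and the matrix entries `m i j`, the coefficients of
`e^i ⊗ e_j`, vanish outside the lists `S` and `P`, and nowhere else for the off-diagonal `m`. -/
structure IsSupport (c : ℕ → ℕ → ℕ → ℝ) (m : ℕ → ℕ → ℝ) (S : List Tri) (P : List (ℕ × ℕ)) :
    Prop where
  skew : ∀ i j k, c i j k = -c j i k
  tri : ∀ i j k, c i j k ≠ 0 ↔ hasTri S i j k = true
  pair : ∀ i j, i ≠ j → (m i j ≠ 0 ↔ hasPair P i j = true)
  irrefl : ∀ i, hasPair P i i = false
  diag : ∀ i j k, c i j k ≠ 0 → m k k = m i i + m j j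

/-- The product of a structure constant and a matrix entry in the derivation property. -/
def termReal (c : ℕ → ℕ → ℕ → ℝ) (m : ℕ → ℕ → ℝ) (r : Bool × Tri × (ℕ × ℕ)) : ℝ :=
  (bif r.1 then 1 else -1) * (c r.2.1.1 r.2.1.2.1 r.2.1.2.2 * m r.2.2.1 r.2.2.2)

theorem sum_map_range {M : Type*} [AddCommMonoid M] (n : ℕ) (f : ℕ → M) :
    ((List.range n).map f).sum = ∑ h ∈ Finset.range n, f h := by
  induction n with
  | zero => simp
  | succ n ih => rw [List.range_succ, List.map_append, List.sum_append, ih, Finset.sum_range_succ]; simp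

namespace IsSupport

variable {c : ℕ → ℕ → ℕ → ℝ} {m : ℕ → ℕ → ℝ} {S : List Tri} {P : List (ℕ × ℕ)}
  (H : IsSupport c m S P)
include H

/-- Diagonal entries never belong to P, so the case u = v has to be excluded on the right; those
terms are treated separately. -/
theorem block_sum (b : Bool) (i j k u v : ℕ) :
    ((bif hasTri S i j k && hasPair P u v then [(b, (i, j, k), (u, v))] else []).map
      (termReal c m)).sum = if u = v then 0 else (bif b then 1 else -1) * (c i j k * m u v) := by
  by_cases huv : u = v
  · subst huv
    simp [H.irrefl]
  · rw [if_neg huv]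
    by_cases h1 : c i j k = 0
    · have : hasTri S i j k = false := by
        rw [← Bool.not_eq_true, ← H.tri]; simp [h1]
      simp [this, h1]
    · by_cases h2 : m u v = 0
      · have : hasPair P u v = false := by
          rw [← Bool.not_eq_true, ← H.pair u v huv]; simp [h2]
        simp [this, h2]
      · simp [(H.tri _ _ _).1 h1, (H.pair _ _ huv).1 h2, termReal]

/-- The terms involving a diagonal entry add up to c_{ijl}(λ_l − λ_i − λ_j) = 0. All other terms
outside the support vanish, so the list of supported terms carries the whole derivation identity. -/
theorem sum_leibnizTerms (n : ℕ) {i j l : ℕ} (hi : i < n) (hj : j < n) (hl : l < n) :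
    ((leibnizTerms n S P i j l).map (termReal c m)).sum =
      ∑ h ∈ Finset.range n, c i j h * m h l -
        (∑ h ∈ Finset.range n, m i h * c h j l + ∑ h ∈ Finset.range n, m j h * c i h l) := by
  have h0 : c i j l * m l l - (m i i * c i j l + m j j * c i j l) = 0 := by
    by_cases h : c i j l = 0
    · rw [h]; ring
    · rw [H.diag i j l h]; ring
  have e1 : ∑ h ∈ Finset.range n, c i j h * m h l =
      (∑ h ∈ Finset.range n, if h = l then 0 else c i j h * m h l) + c i j l * m l l := by
    rw [← Finset.sum_erase_add _ _ (Finset.mem_range.2 hl), ← Finset.sum_erase_add _ (fun h =>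
      if h = l then 0 else c i j h * m h l) (Finset.mem_range.2 hl), if_pos rfl, add_zero]
    congr 1
    exact Finset.sum_congr rfl fun h hh => by rw [if_neg (Finset.ne_of_mem_erase hh)]
  have e2 : ∑ h ∈ Finset.range n, m i h * c h j l =
      (∑ h ∈ Finset.range n, if i = h then 0 else m i h * c h j l) + m i i * c i j l := by
    rw [← Finset.sum_erase_add _ _ (Finset.mem_range.2 hi), ← Finset.sum_erase_add _ (fun h =>
      if i = h then 0 else m i h * c h j l) (Finset.mem_range.2 hi), if_pos rfl, add_zero]
    congr 1
    exact Finset.sum_congr rfl fun h hh => by rw [if_neg (Finset.ne_of_mem_erase hh).symm]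
  have e3 : ∑ h ∈ Finset.range n, m j h * c i h l =
      (∑ h ∈ Finset.range n, if j = h then 0 else m j h * c i h l) + m j j * c i j l := by
    rw [← Finset.sum_erase_add _ _ (Finset.mem_range.2 hj), ← Finset.sum_erase_add _ (fun h =>
      if j = h then 0 else m j h * c i h l) (Finset.mem_range.2 hj), if_pos rfl, add_zero]
    congr 1
    exact Finset.sum_congr rfl fun h hh => by rw [if_neg (Finset.ne_of_mem_erase hh).symm]
  have e4 : ((leibnizTerms n S P i j l).map (termReal c m)).sum =
      ∑ h ∈ Finset.range n, ((if h = l then 0 else c i j h * m h l) -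
        ((if i = h then 0 else m i h * c h j l) + if j = h then 0 else m j h * c i h l)) := by
    rw [leibnizTerms, List.map_flatMap, List.flatMap_def, List.sum_flatten, List.map_map,
      sum_map_range]
    refine Finset.sum_congr rfl fun h _ => ?_
    have hf := H.block_sum false h j l i h
    have hf' := H.block_sum false i h l j h
    rw [Bool.and_comm] at hf hf'
    simp only [Function.comp_apply, List.map_append, List.sum_append, H.block_sum, hf, hf']
    simp only [cond_true, cond_false, one_mul]
    split_ifs <;> ring
  rw [e4, e1, e2, e3, Finset.sum_sub_distrib, Finset.sum_add_distrib]
  linear_combination -h0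

/-- This makes a relation with exactly one term contradictory. -/
theorem termReal_ne_zero {n i j l : ℕ} {r : Bool × Tri × (ℕ × ℕ)}
    (hr : r ∈ leibnizTerms n S P i j l) : termReal c m r ≠ 0 := by
  have key : ∀ (b : Bool) (i j k u v : ℕ), hasTri S i j k = true → hasPair P u v = true →
      termReal c m (b, (i, j, k), (u, v)) ≠ 0 := by
    intro b i j k u v h1 h2
    have huv : u ≠ v := by
      rintro rfl
      rw [H.irrefl] at h2
      cases h2
    refine mul_ne_zero (by cases b <;> simp) (mul_ne_zero ((H.tri _ _ _).2 h1)
      ((H.pair _ _ huv).2 h2))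
  simp only [leibnizTerms, List.mem_flatMap, List.mem_append] at hr
  obtain ⟨h, -, hr | hr | hr⟩ := hr
  · cases hb : hasTri S i j h && hasPair P h l <;> simp only [hb, cond_true, cond_false,
      List.mem_singleton, List.not_mem_nil] at hr
    subst hr
    exact key _ _ _ _ _ _ (Bool.and_eq_true_iff.1 hb).1 (Bool.and_eq_true_iff.1 hb).2
  · cases hb : hasPair P i h && hasTri S h j l <;> simp only [hb, cond_true, cond_false,
      List.mem_singleton, List.not_mem_nil] at hr
    subst hr
    exact key _ _ _ _ _ _ (Bool.and_eq_true_iff.1 hb).2 (Bool.and_eq_true_iff.1 hb).1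
  · cases hb : hasPair P j h && hasTri S i h l <;> simp only [hb, cond_true, cond_false,
      List.mem_singleton, List.not_mem_nil] at hr
    subst hr
    exact key _ _ _ _ _ _ (Bool.and_eq_true_iff.1 hb).2 (Bool.and_eq_true_iff.1 hb).1

end IsSupport

/-- The product of the signs of the nodes in a term of the derivation property. -/
theorem sign_of_mem_leibnizTerms {e : ℕ → ℝ} (he : ∀ i, e i * e i = 1) {n i j l : ℕ} {S : List Tri}
    {P : List (ℕ × ℕ)} {r : Bool × Tri × (ℕ × ℕ)} (hr : r ∈ leibnizTerms n S P i j l) :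
    e r.2.1.1 * e r.2.1.2.1 * e r.2.1.2.2 * (e r.2.2.1 * e r.2.2.2) = e i * e j * e l := by
  simp only [leibnizTerms, List.mem_flatMap, List.mem_append] at hr
  obtain ⟨h, -, hr | hr | hr⟩ := hr
  · cases hb : hasTri S i j h && hasPair P h l <;> simp only [hb, cond_true, cond_false,
      List.mem_singleton, List.not_mem_nil] at hr
    subst hr
    -- The intermediate node h occurs both in the bracket and in the matrix entry, so its sign is
    -- squared. Hence all terms of one relation carry the same sign e_i e_j e_l.
    linear_combination (e i * e j * e l) * he h
  · cases hb : hasPair P i h && hasTri S h j l <;> simp only [hb, cond_true, cond_false,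
      List.mem_singleton, List.not_mem_nil] at hr
    subst hr
    linear_combination (e i * e j * e l) * he h
  · cases hb : hasPair P j h && hasTri S i h l <;> simp only [hb, cond_true, cond_false,
      List.mem_singleton, List.not_mem_nil] at hr
    subst hr
    linear_combination (e i * e j * e l) * he h

theorem mem_of_mem_leibnizTerms {n i j l : ℕ} {S : List Tri} {P : List (ℕ × ℕ)}
    {r : Bool × Tri × (ℕ × ℕ)} (hr : r ∈ leibnizTerms n S P i j l) :
    hasTri S r.2.1.1 r.2.1.2.1 r.2.1.2.2 = true ∧ r.2.2 ∈ P := by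
  simp only [leibnizTerms, List.mem_flatMap, List.mem_append] at hr
  obtain ⟨h, -, hr | hr | hr⟩ := hr
  · cases hb : hasTri S i j h && hasPair P h l <;> simp only [hb, cond_true, cond_false,
      List.mem_singleton, List.not_mem_nil] at hr
    subst hr
    exact ⟨(Bool.and_eq_true_iff.1 hb).1, hasPair_iff.1 (Bool.and_eq_true_iff.1 hb).2⟩
  · cases hb : hasPair P i h && hasTri S h j l <;> simp only [hb, cond_true, cond_false,
      List.mem_singleton, List.not_mem_nil] at hr
    subst hr
    exact ⟨(Bool.and_eq_true_iff.1 hb).2, hasPair_iff.1 (Bool.and_eq_true_iff.1 hb).1⟩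
  · cases hb : hasPair P j h && hasTri S i h l <;> simp only [hb, cond_true, cond_false,
      List.mem_singleton, List.not_mem_nil] at hr
    subst hr
    exact ⟨(Bool.and_eq_true_iff.1 hb).2, hasPair_iff.1 (Bool.and_eq_true_iff.1 hb).1⟩

/-! ### Data with nodes indexed by natural numbers -/

namespace Datum

variable {n : ℕ} (d : Datum n)

/-- The structure constants, extended by zero. -/
def coeff (i j k : ℕ) : ℝ :=
  if h : i < n ∧ j < n ∧ k < n then d.L.c ⟨i, h.1⟩ ⟨j, h.2.1⟩ ⟨k, h.2.2⟩ else 0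

/-- The coefficients of `e^i ⊗ e_j` in the derivation, extended by zero. -/
def entry (i j : ℕ) : ℝ := if h : i < n ∧ j < n then d.D ⟨j, h.2⟩ ⟨i, h.1⟩ else 0

/-- The signs of the metric, extended by one. -/
def eps (i : ℕ) : ℝ := if h : i < n then d.sgn ⟨i, h⟩ else 1

@[simp] theorem coeff_val (i j k : Fin n) : d.coeff i j k = d.L.c i j k := by simp [coeff]

@[simp] theorem entry_val (i j : Fin n) : d.entry i j = d.D j i := by simp [entry]

@[simp] theorem eps_val (i : Fin n) : d.eps i = d.sgn i := by simp [eps]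

theorem eps_eq (i : ℕ) : d.eps i = 1 ∨ d.eps i = -1 := by
  unfold eps
  split_ifs
  · exact d.sgn_eq _
  · exact Or.inl rfl

theorem eps_mul_self (i : ℕ) : d.eps i * d.eps i = 1 := by
  rcases d.eps_eq i with h | h <;> rw [h] <;> norm_num

theorem coeff_skew (i j k : ℕ) : d.coeff i j k = -d.coeff j i k := by
  unfold coeff
  by_cases h : i < n ∧ j < n ∧ k < n
  · rw [dif_pos h, dif_pos ⟨h.2.1, h.1, h.2.2⟩, d.L.skew]
  · rw [dif_neg h, dif_neg fun h' => h ⟨h'.2.1, h'.1, h'.2.2⟩, neg_zero]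

theorem lt_of_coeff {i j k : ℕ} (h : d.coeff i j k ≠ 0) : i < n ∧ j < n ∧ k < n := by
  by_contra h'
  exact h (by rw [coeff, dif_neg h'])

theorem lt_of_entry {i j : ℕ} (h : d.entry i j ≠ 0) : i < n ∧ j < n := by
  by_contra h'
  exact h (by rw [entry, dif_neg h'])

theorem leibnizTerms_sum {S : List Tri} {P : List (ℕ × ℕ)} (h : IsSupport d.coeff d.entry S P)
    {i j l : ℕ} (hi : i < n) (hj : j < n) (hl : l < n) :
    ((leibnizTerms n S P i j l).map (termReal d.coeff d.entry)).sum = 0 := by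
  rw [h.sum_leibnizTerms n hi hj hl, Finset.sum_range, Finset.sum_range, Finset.sum_range]
  have := d.leibniz_coord ⟨i, hi⟩ ⟨j, hj⟩ ⟨l, hl⟩
  lift i to Fin n using hi
  lift j to Fin n using hj
  lift l to Fin n using hl
  simp only [coeff_val, entry_val]
  exact sub_eq_zero.2 this

end Datum

end NiceNil

/-! ### Relabelling of nodes and triangular form -/

namespace NiceNil

namespace Datum

variable {n : ℕ} (d : Datum n)

namespace NondiagonalEquations

variable {d} (H : d.NondiagonalEquations)
include H

theorem relabel (σ : Equiv.Perm (Fin n)) : (d.relabel σ).NondiagonalEquations := by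
  have hc : ∀ i j k, (d.relabel σ).L.c i j k = d.L.c (σ i) (σ j) (σ k) := fun _ _ _ => rfl
  have hD : ∀ i j, (d.relabel σ).D i j = d.D (σ i) (σ j) := fun _ _ => rfl
  have hT : (d.relabel σ).D.trace = d.D.trace := Equiv.sum_comp σ fun i => d.D i i
  have hb : ∀ i j, (d.relabel σ).offWeight i j = d.offWeight (σ i) (σ j) := fun i j => by
    by_cases h : i = j
    · simp [offWeight, h]
    · rw [offWeight, offWeight, if_neg h, if_neg (σ.injective.ne h)]; rfl
  constructor
  · rw [hT]; exact H.trace_ne_zero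
  · obtain ⟨i, j, hij, h⟩ := H.exists_off
    refine ⟨σ.symm i, σ.symm j, σ.symm.injective.ne hij, ?_⟩
    rwa [hD, σ.apply_symm_apply, σ.apply_symm_apply]
  · intro i j i' j' hij hij' h h' hne
    have := H.disjoint (σ i) (σ j) (σ i') (σ j') (σ.injective.ne hij) (σ.injective.ne hij') h h'
      (fun e => hne (by simpa using e))
    simpa using this
  · intro i j hij h k
    exact H.no_arrow _ _ (σ.injective.ne hij) h _
  · intro i j hij h
    rw [hT]
    exact H.trace_eq _ _ (σ.injective.ne hij) h
  · intro i j k h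
    exact H.diag_eq _ _ _ h
  · intro l
    have h := H.balance (σ l)
    have e1 : ∑ i, ∑ j, ∑ k, rootEntry l i j k * (d.relabel σ).weight i j k =
        ∑ i, ∑ j, ∑ k, rootEntry (σ l) i j k * d.weight i j k := by
      symm
      rw [← Equiv.sum_comp σ]
      refine Finset.sum_congr rfl fun i _ => ?_
      rw [← Equiv.sum_comp σ]
      refine Finset.sum_congr rfl fun j _ => ?_
      rw [← Equiv.sum_comp σ]
      refine Finset.sum_congr rfl fun k _ => ?_
      simp only [rootEntry, σ.injective.eq_iff]
      rfl
    rw [e1, h, hT]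
    simp only [hb]
    rw [Equiv.sum_comp σ fun j => d.offWeight (σ l) j, Equiv.sum_comp σ fun i => d.offWeight i (σ l),
      Equiv.sum_comp σ fun i => ∑ j, d.offWeight i (σ j),
      Finset.sum_congr rfl fun i _ => Equiv.sum_comp σ fun j => d.offWeight i j]
    rfl
  · intro i j j' k h h'
    exact σ.injective (H.label_unique _ _ _ _ h h')
  · intro i j k k' h h'
    exact σ.injective (H.target_unique _ _ _ _ h h')
  · intro i h
    refine H.acyclic (σ i) (h.lift σ ?_)
    rintro a b ⟨j, hj⟩
    exact ⟨σ j, hj⟩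
  · intro i j k l hij hjk hik
    have := H.concat (σ i) (σ j) (σ k) (σ l) (σ.injective.ne hij) (σ.injective.ne hjk)
      (σ.injective.ne hik)
    have e : ∀ p : Fin n → Prop, (∃ h, p (σ h)) ↔ ∃ h, p h := fun p => σ.surjective.exists.symm
    simp only [hc]
    rw [e fun h => d.L.c (σ i) (σ j) h ≠ 0 ∧ d.L.c h (σ k) (σ l) ≠ 0,
      e fun h => d.L.c (σ j) (σ k) h ≠ 0 ∧ d.L.c h (σ i) (σ l) ≠ 0,
      e fun h => d.L.c (σ k) (σ i) h ≠ 0 ∧ d.L.c h (σ j) (σ l) ≠ 0]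
    exact this

/-- The nodes can be numbered so that arrows increase. -/
theorem exists_increasing : ∃ σ : Equiv.Perm (Fin n),
    ∀ i j k, (d.relabel σ).L.c i j k ≠ 0 → i < k ∧ j < k := by
  classical
  let R : Fin n → Fin n → Prop := fun a b => ∃ j, d.L.c a j b ≠ 0
  -- The number of proper ancestors strictly increases along an arrow, since acyclicity excludes a
  -- from its own ancestors; sorting the nodes by it makes all arrows increase.
  let f : Fin n → ℕ := fun a => (Finset.univ.filter fun b => Relation.TransGen R b a).card
  have hf : ∀ a b, R a b → f a < f b := by
    intro a b hab
    refine Finset.card_lt_card (Finset.ssubset_iff_subset_ne.2 ⟨fun x hx => ?_, fun h => ?_⟩)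
    · simp only [Finset.mem_filter, Finset.mem_univ, true_and] at hx ⊢
      exact hx.tail hab
    · have : a ∈ Finset.univ.filter fun x => Relation.TransGen R x a := by
        rw [h]
        simpa using Relation.TransGen.single hab
      exact H.acyclic a (by simpa using this)
  refine ⟨Tuple.sort f, fun i j k h => ?_⟩
  have hm := Tuple.monotone_sort f
  have key : ∀ i j, d.L.c (Tuple.sort f i) (Tuple.sort f j) (Tuple.sort f k) ≠ 0 → i < k := by
    intro i j h
    by_contra hle
    exact absurd (hm (not_lt.1 hle)) (not_le.2 (hf _ _ ⟨_, h⟩))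
  exact ⟨key i j h, key j i (by rw [d.L.skew, neg_ne_zero]; exact h)⟩

end NondiagonalEquations

/-- The increasing triples on which the structure constants do not vanish. -/
def tripleSupport : List Tri := by
  classical exact (triples n).filter fun t => d.coeff t.1 t.2.1 t.2.2 ≠ 0

theorem mem_triples {t : Tri} : t ∈ triples n ↔ t.1 < t.2.1 ∧ t.2.1 < t.2.2 ∧ t.2.2 < n := by
  obtain ⟨i, j, k⟩ := t
  simp only [triples, List.mem_flatMap, List.mem_map, List.mem_range, Prod.mk.injEq]
  constructor
  · rintro ⟨c, hc, b, hb, a, ha, rfl, rfl, rfl⟩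
    exact ⟨ha, hb, hc⟩
  · rintro ⟨h1, h2, h3⟩
    exact ⟨k, h3, j, h2, i, h1, rfl, rfl, rfl⟩

theorem mem_tripleSupport {t : Tri} : t ∈ d.tripleSupport ↔
    (t.1 < t.2.1 ∧ t.2.1 < t.2.2 ∧ t.2.2 < n) ∧ d.coeff t.1 t.2.1 t.2.2 ≠ 0 := by
  classical
  simp only [tripleSupport, List.mem_filter, mem_triples, decide_eq_true_eq]

theorem nodup_triples : (triples n).Nodup := by
  refine List.nodup_flatMap.2 ⟨fun k _ => List.nodup_flatMap.2 ⟨fun j _ =>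
    List.nodup_range.map fun a b h => (Prod.mk.inj h).1, ?_⟩, ?_⟩
  · refine List.nodup_range.imp fun {a b} hab x hx hx' => ?_
    simp only [List.mem_map] at hx hx'
    obtain ⟨i, -, rfl⟩ := hx
    obtain ⟨j, -, h⟩ := hx'
    exact hab (Prod.mk.inj (Prod.mk.inj h).2).1.symm
  · refine List.nodup_range.imp fun {a b} hab x hx hx' => ?_
    simp only [List.mem_map, List.mem_flatMap] at hx hx'
    obtain ⟨_, -, i, -, rfl⟩ := hx
    obtain ⟨_, -, j, -, h⟩ := hx'
    exact hab (Prod.mk.inj (Prod.mk.inj h).2).2.symm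

theorem coeff_ne_zero_iff (hinc : ∀ i j k, d.L.c i j k ≠ 0 → i < k ∧ j < k) (i j k : ℕ) :
    d.coeff i j k ≠ 0 ↔ hasTri d.tripleSupport i j k = true := by
  rw [hasTri_iff, mem_tripleSupport, mem_tripleSupport]
  constructor
  · intro h
    obtain ⟨h1, h2, h3⟩ := d.lt_of_coeff h
    lift i to Fin n using h1
    lift j to Fin n using h2
    lift k to Fin n using h3
    have h' := h
    rw [coeff_val] at h'
    obtain ⟨h4, h5⟩ := hinc _ _ _ h'
    rcases lt_trichotomy i j with hij | hij | hij
    · exact Or.inl ⟨⟨hij, h5, k.2⟩, h⟩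
    · subst hij
      exact absurd (d.c_self _ _) h'
    · refine Or.inr ⟨⟨hij, h4, k.2⟩, ?_⟩
      rw [coeff_skew, neg_ne_zero]
      exact h
  · rintro (h | h)
    · exact h.2
    · rw [coeff_skew, neg_ne_zero]
      exact h.2

theorem pairwiseB_iff {α : Type} (r : α → α → Bool) (l : List α) :
    pairwiseB r l = true ↔ l.Pairwise fun a b => r a b = true := by
  induction l with
  | nil => simp [pairwiseB]
  | cons a l ih => simp [pairwiseB, ih]

/-- With increasing arrows each bracket is represented once by a triple i < j < k, and the nice
diagram axioms become the two Boolean tests. Only this direction is needed: the enumeration may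
contain sets carrying no solution. -/
theorem mem_diagramSets {d : Datum n} (H : d.NondiagonalEquations)
    (hinc : ∀ i j k, d.L.c i j k ≠ 0 → i < k ∧ j < k) : d.tripleSupport ∈ diagramSets n := by
  classical
  have hlabel : ∀ i j j' k, d.coeff i j k ≠ 0 → d.coeff i j' k ≠ 0 → j = j' := by
    intro i j j' k h h'
    obtain ⟨h1, h2, h3⟩ := d.lt_of_coeff h
    obtain ⟨-, h4, -⟩ := d.lt_of_coeff h'
    lift i to Fin n using h1
    lift j to Fin n using h2
    lift k to Fin n using h3
    lift j' to Fin n using h4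
    rw [coeff_val] at h h'
    rw [H.label_unique _ _ _ _ h h']
  have htarget : ∀ i j k k', d.coeff i j k ≠ 0 → d.coeff i j k' ≠ 0 → k = k' := by
    intro i j k k' h h'
    obtain ⟨h1, h2, h3⟩ := d.lt_of_coeff h
    obtain ⟨-, -, h4⟩ := d.lt_of_coeff h'
    lift i to Fin n using h1
    lift j to Fin n using h2
    lift k to Fin n using h3
    lift k' to Fin n using h4
    rw [coeff_val] at h h'
    rw [H.target_unique _ _ _ _ h h']
  have hcomp : ∀ i j k l h, d.coeff i j h ≠ 0 → d.coeff h k l ≠ 0 →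
      hasComp d.tripleSupport i j k l = true := by
    intro i j k l h h1 h2
    have h3 := (d.coeff_ne_zero_iff hinc _ _ _).1 h1
    simp only [hasComp, List.any_eq_true, Bool.and_eq_true, Bool.or_eq_true, Nat.beq_eq]
    rcases hasTri_iff.1 h3 with h4 | h4
    · exact ⟨_, h4, Or.inl ⟨rfl, rfl⟩, (d.coeff_ne_zero_iff hinc _ _ _).1 h2⟩
    · exact ⟨_, h4, Or.inr ⟨rfl, rfl⟩, (d.coeff_ne_zero_iff hinc _ _ _).1 h2⟩
  have hconcat : ∀ i j k l h, i ≠ j → j ≠ k → i ≠ k → d.coeff i j h ≠ 0 → d.coeff h k l ≠ 0 →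
      hasComp d.tripleSupport j k i l = true ∨ hasComp d.tripleSupport k i j l = true := by
    intro i j k l h hij hjk hik h1 h2
    obtain ⟨hi, hj, hh⟩ := d.lt_of_coeff h1
    obtain ⟨-, hk, hl⟩ := d.lt_of_coeff h2
    lift i to Fin n using hi
    lift j to Fin n using hj
    lift k to Fin n using hk
    lift l to Fin n using hl
    lift h to Fin n using hh
    rw [coeff_val] at h1 h2
    rcases H.concat i j k l (by simpa [Fin.ext_iff] using hij) (by simpa [Fin.ext_iff] using hjk)
      (by simpa [Fin.ext_iff] using hik) ⟨h, h1, h2⟩ with ⟨g, h3, h4⟩ | ⟨g, h3, h4⟩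
    · exact Or.inl (hcomp _ _ _ _ g (by rwa [coeff_val]) (by rwa [coeff_val]))
    · exact Or.inr (hcomp _ _ _ _ g (by rwa [coeff_val]) (by rwa [coeff_val]))
  have hswap : ∀ i j k, d.coeff i j k ≠ 0 → d.coeff j i k ≠ 0 := fun i j k h => by
    rw [coeff_skew, neg_ne_zero]; exact h
  rw [diagramSets, List.mem_filter, List.mem_sublists, Bool.and_eq_true]
  refine ⟨List.filter_sublist, ?_, ?_⟩
  · rw [pairwiseB_iff]
    have hnd : d.tripleSupport.Nodup := nodup_triples.filter _
    refine hnd.pairwise_of_forall_ne fun t ht u hu hne => ?_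
    have ht' := (d.mem_tripleSupport.1 ht).2
    have hu' := (d.mem_tripleSupport.1 hu).2
    obtain ⟨i, j, k⟩ := t
    obtain ⟨i', j', k'⟩ := u
    simp only at ht' hu'
    by_contra hc
    simp only [compatible, Bool.not_eq_true, Bool.not_eq_false', Bool.or_eq_true, Bool.and_eq_true,
      Nat.beq_eq] at hc
    have hij := (d.mem_tripleSupport.1 ht).1.1
    have hij' := (d.mem_tripleSupport.1 hu).1.1
    simp only at hij hij'
    rcases hc with ⟨rfl, rfl⟩ | ⟨rfl, ((rfl | rfl) | rfl) | rfl⟩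
    · obtain rfl := htarget _ _ _ _ ht' hu'
      exact hne rfl
    · obtain rfl := hlabel _ _ _ _ ht' hu'
      exact hne rfl
    · obtain rfl := hlabel _ _ _ _ (hswap _ _ _ ht') (hswap _ _ _ hu')
      exact hne rfl
    -- In the crossed cases uniqueness of labels forces the two triples to list the same two nodes
    -- in opposite orders, contrary to i < j in both.
    · have := hlabel _ _ _ _ ht' (hswap _ _ _ hu')
      omega
    · have := hlabel _ _ _ _ (hswap _ _ _ ht') hu'
      omega
  · simp only [concatOK, List.all_eq_true]
    intro t ht u hu p hp
    have ht' := (d.mem_tripleSupport.1 ht).2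
    have hij := (d.mem_tripleSupport.1 ht).1.1
    have hu' : d.coeff p.1 p.2 u.2.2 ≠ 0 := by
      have := (d.mem_tripleSupport.1 hu).2
      simp only [List.mem_cons, List.not_mem_nil, or_false] at hp
      rcases hp with rfl | rfl
      · exact this
      · exact hswap _ _ _ this
    by_contra hc
    simp only [Bool.not_eq_true, Bool.or_eq_false_iff, Bool.not_eq_false', Nat.beq_eq] at hc
    obtain ⟨⟨⟨⟨h1, h2⟩, h3⟩, h4⟩, h5⟩ := hc
    rw [h1] at hu'
    have h2' : p.2 ≠ t.1 := fun e => by rw [e] at h2; simp at h2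
    have h3' : p.2 ≠ t.2.1 := fun e => by rw [e] at h3; simp at h3
    rcases hconcat _ _ _ _ _ hij.ne h3'.symm h2'.symm ht' hu' with h | h
    · rw [h] at h4; cases h4
    · rw [h] at h5; cases h5

end Datum

end NiceNil

/-! ### Reduction to the listed supports -/

namespace NiceNil

theorem mem_pairs {n : ℕ} {p : ℕ × ℕ} : p ∈ pairs n ↔ p.1 < n ∧ p.2 < n ∧ p.1 ≠ p.2 := by
  obtain ⟨i, j⟩ := p
  simp only [pairs, List.mem_flatMap, List.mem_map, List.mem_range, List.mem_filter,
    Prod.mk.injEq, Bool.not_eq_true']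
  constructor
  · rintro ⟨a, ha, b, ⟨hb, hab⟩, rfl, rfl⟩
    exact ⟨ha, hb, fun e => by simp [e] at hab⟩
  · rintro ⟨h1, h2, h3⟩
    refine ⟨i, h1, j, ⟨h2, ?_⟩, rfl, rfl⟩
    rw [← Bool.not_eq_true, Nat.beq_eq]
    exact h3

/-- The permutation of the nodes described by a list. -/
theorem exists_perm_of_mem {n : ℕ} {p : List ℕ} (hp : p ∈ (List.range n).permutations') :
    ∃ π : Equiv.Perm (Fin n), ∀ i : Fin n, p.getD i 0 = π i := by
  have hp' := List.mem_permutations'.1 hp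
  have hlen : p.length = n := by rw [hp'.length_eq, List.length_range]
  have hnd : p.Nodup := hp'.nodup_iff.2 List.nodup_range
  have hget : ∀ i : Fin n, p.getD i 0 = p[(i : ℕ)]'(by omega) := fun i =>
    List.getD_eq_getElem _ _ _
  have hlt : ∀ i : Fin n, p.getD i 0 < n := fun i => by
    rw [hget]
    exact List.mem_range.1 (hp'.mem_iff.1 (List.getElem_mem _))
  let f : Fin n → Fin n := fun i => ⟨p.getD i 0, hlt i⟩
  have hf : Function.Injective f := by
    intro i j h
    have h' : p.getD i 0 = p.getD j 0 := congrArg Fin.val h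
    rw [hget, hget] at h'
    exact Fin.ext ((List.Nodup.getElem_inj_iff hnd).1 h')
  exact ⟨Equiv.ofBijective f (Finite.injective_iff_bijective.1 hf), fun i => rfl⟩

theorem exists_mem_permutations {n : ℕ} (π : Equiv.Perm (Fin n)) :
    ∃ p ∈ (List.range n).permutations', ∀ i : Fin n, p.getD i 0 = π i := by
  refine ⟨List.ofFn fun i => (π i : ℕ), List.mem_permutations'.2 ?_, fun i => by
    rw [List.getD_eq_getElem _ _ (by simp)]
    simp⟩
  refine (List.perm_ext_iff_of_nodup ?_ List.nodup_range).2 fun a => ?_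
  · exact List.nodup_ofFn.2 (Fin.val_injective.comp π.injective)
  · rw [List.mem_ofFn, List.mem_range]
    constructor
    · rintro ⟨i, rfl⟩
      exact (π i).2
    · intro ha
      exact ⟨π.symm ⟨a, ha⟩, by simp⟩

namespace Datum

variable {n : ℕ} {d : Datum n}

/-- This is where n ≤ 5 enters: three disjoint pairs would occupy six nodes, so the off-diagonal
part has one or two entries. -/
theorem exists_arrowSet (H : d.NondiagonalEquations) (hn : n ≤ 5) : ∃ P ∈ arrowSets n,
    ∀ i j, i ≠ j → (d.entry i j ≠ 0 ↔ hasPair P i j = true) := by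
  have hdisj : ∀ i j i' j', i ≠ j → i' ≠ j' → d.entry i j ≠ 0 → d.entry i' j' ≠ 0 →
      (i, j) ≠ (i', j') → i ≠ i' ∧ i ≠ j' ∧ j ≠ i' ∧ j ≠ j' := by
    intro i j i' j' hij hij' h h' hne
    obtain ⟨h1, h2⟩ := d.lt_of_entry h
    obtain ⟨h3, h4⟩ := d.lt_of_entry h'
    lift i to Fin n using h1
    lift j to Fin n using h2
    lift i' to Fin n using h3
    lift j' to Fin n using h4
    rw [entry_val] at h h'
    have := H.disjoint i j i' j' (fun e => hij (by rw [e])) (fun e => hij' (by rw [e])) h h'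
      (fun e => hne (by rw [(Prod.mk.inj e).1, (Prod.mk.inj e).2]))
    simpa [Fin.ext_iff] using this
  have hmem : ∀ i j, i ≠ j → d.entry i j ≠ 0 → (i, j) ∈ pairs n := fun i j hij h =>
    mem_pairs.2 ⟨(d.lt_of_entry h).1, (d.lt_of_entry h).2, hij⟩
  have hthree : ∀ i j i' j' i'' j'', i ≠ j → i' ≠ j' → i'' ≠ j'' → d.entry i j ≠ 0 →
      d.entry i' j' ≠ 0 → d.entry i'' j'' ≠ 0 → (i, j) ≠ (i', j') → (i'', j'') = (i, j) ∨
      (i'', j'') = (i', j') := by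
    intro a b a' b' a'' b'' h1 h2 h3 e1 e2 e3 hne
    by_contra hc
    rw [not_or] at hc
    have d1 := hdisj _ _ _ _ h1 h2 e1 e2 hne
    have d2 := hdisj _ _ _ _ h3 h1 e3 e1 hc.1
    have d3 := hdisj _ _ _ _ h3 h2 e3 e2 hc.2
    have hsub : ({a, b, a', b', a'', b''} : Finset ℕ) ⊆ Finset.range n := by
      intro x hx
      simp only [Finset.mem_insert, Finset.mem_singleton] at hx
      have l1 := d.lt_of_entry e1
      have l2 := d.lt_of_entry e2
      have l3 := d.lt_of_entry e3
      rw [Finset.mem_range]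
      omega
    have hcard := Finset.card_le_card hsub
    rw [Finset.card_range] at hcard
    have : ({a, b, a', b', a'', b''} : Finset ℕ).card = 6 := by
      rw [Finset.card_insert_of_notMem, Finset.card_insert_of_notMem,
        Finset.card_insert_of_notMem, Finset.card_insert_of_notMem,
        Finset.card_insert_of_notMem, Finset.card_singleton] <;>
      simp only [Finset.mem_insert, Finset.mem_singleton] <;> omega
    omega
  obtain ⟨i, j, hij, h⟩ := H.exists_off
  have hij' : (i : ℕ) ≠ j := fun e => hij (Fin.ext e)
  have h' : d.entry i j ≠ 0 := by rwa [entry_val]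
  have htwo : ∀ a b a' b', a ≠ b → a' ≠ b' → d.entry a b ≠ 0 → d.entry a' b' ≠ 0 → a < a' →
      ∃ P ∈ arrowSets n, ∀ i j, i ≠ j → (d.entry i j ≠ 0 ↔ hasPair P i j = true) := by
    intro a b a' b' h1 h2 e1 e2 hlt
    have hne : (a, b) ≠ (a', b') := fun e => hlt.ne (Prod.mk.inj e).1
    have d1 := hdisj _ _ _ _ h1 h2 e1 e2 hne
    refine ⟨[(a, b), (a', b')], ?_, fun x y hxy => ⟨fun hx => ?_, fun hx => ?_⟩⟩
    · refine List.mem_flatMap.2 ⟨(a, b), hmem _ _ h1 e1, List.mem_cons_of_mem _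
        (List.mem_map.2 ⟨(a', b'), List.mem_filter.2 ⟨hmem _ _ h2 e2, ?_⟩, rfl⟩)⟩
      rw [Bool.and_eq_true]
      refine ⟨by simpa using hlt, ?_⟩
      simp [disjointPairs, d1.1, d1.2.1, d1.2.2.1, d1.2.2.2, ← Bool.not_eq_true]
    · rw [hasPair_iff]
      rcases hthree _ _ _ _ _ _ h1 h2 hxy e1 e2 hx hne with e | e <;> simp [e]
    · rw [hasPair_iff] at hx
      simp only [List.mem_cons, List.not_mem_nil, or_false, Prod.mk.injEq] at hx
      rcases hx with ⟨rfl, rfl⟩ | ⟨rfl, rfl⟩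
      · exact e1
      · exact e2
  by_cases hex : ∃ a b : ℕ, a ≠ b ∧ d.entry a b ≠ 0 ∧ (a, b) ≠ ((i : ℕ), (j : ℕ))
  · obtain ⟨a, b, hab, e, hne⟩ := hex
    have d1 := hdisj _ _ _ _ hab hij' e h' hne
    -- The enumeration lists the pair with the smaller first node first; disjointness makes the
    -- first nodes different.
    rcases lt_or_gt_of_ne d1.1 with hlt | hlt
    · exact htwo _ _ _ _ hab hij' e h' hlt
    · exact htwo _ _ _ _ hij' hab h' e hlt
  · refine ⟨[((i : ℕ), (j : ℕ))], List.mem_flatMap.2 ⟨_, hmem _ _ hij' h', List.mem_cons_self⟩,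
      fun x y hxy => ⟨fun hx => ?_, fun hx => ?_⟩⟩
    · rw [hasPair_iff, List.mem_singleton]
      by_contra hne
      exact hex ⟨x, y, hxy, hx, hne⟩
    · rw [hasPair_iff, List.mem_singleton, Prod.mk.injEq] at hx
      rw [hx.1, hx.2]
      exact h'

theorem irrefl_of_mem_arrowSets {P : List (ℕ × ℕ)} (hP : P ∈ arrowSets n) (i : ℕ) :
    hasPair P i i = false := by
  rw [← Bool.not_eq_true, hasPair_iff]
  intro h
  simp only [arrowSets, List.mem_flatMap, List.mem_cons, List.mem_map, List.mem_filter] at hP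
  obtain ⟨p, hp, rfl | ⟨q, ⟨hq, -⟩, rfl⟩⟩ := hP
  · rw [List.mem_singleton] at h
    exact (mem_pairs.1 hp).2.2 (by rw [← h])
  · simp only [List.mem_cons, List.not_mem_nil, or_false] at h
    rcases h with h | h
    · exact (mem_pairs.1 hp).2.2 (by rw [← h])
    · exact (mem_pairs.1 hq).2.2 (by rw [← h])

theorem NondiagonalEquations.coeff_diag (H : d.NondiagonalEquations) (i j k : ℕ)
    (h : d.coeff i j k ≠ 0) : d.entry k k = d.entry i i + d.entry j j := by
  obtain ⟨h1, h2, h3⟩ := d.lt_of_coeff h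
  lift i to Fin n using h1
  lift j to Fin n using h2
  lift k to Fin n using h3
  rw [coeff_val] at h
  simpa using H.diag_eq _ _ _ h

/-- Every triggered triple consists of nodes of the support, hence of indices below n, where the
derivation identity is available. The second component remembers its origin for the later sign
comparison. -/
theorem exists_of_mem_relations {S : List Tri} {P : List (ℕ × ℕ)}
    (hS : IsSupport d.coeff d.entry S P) {r : List (Bool × Tri × (ℕ × ℕ))}
    (hr : r ∈ relations n S P) :
    (r.map (termReal d.coeff d.entry)).sum = 0 ∧ ∃ i j l, r = leibnizTerms n S P i j l := by
  simp only [relations, List.mem_map] at hr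
  obtain ⟨⟨i, j, l⟩, ht, rfl⟩ := hr
  have hlt : i < n ∧ j < n ∧ l < n := by
    have hPn : ∀ p ∈ P, p.1 < n ∧ p.2 < n := fun p hp => by
      by_cases e : p.1 = p.2
      · have := hS.irrefl p.1
        rw [← Bool.not_eq_true, hasPair_iff] at this
        exact absurd (by rw [show (p.1, p.1) = p from Prod.ext rfl e]; exact hp) this
      · exact d.lt_of_entry ((hS.pair _ _ e).2 (hasPair_iff.2 hp))
    have hSn : ∀ t ∈ S, t.1 < n ∧ t.2.1 < n ∧ t.2.2 < n := fun t ht =>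
      d.lt_of_coeff ((hS.tri _ _ _).2 (hasTri_iff.2 (Or.inl ht)))
    simp only [triggers, List.mem_filter, List.mem_flatMap, List.mem_append] at ht
    obtain ⟨⟨t, ht, p, hp, h | h | h⟩, -⟩ := ht
    · cases hb : t.2.2.beq p.1 <;> simp only [hb, cond_true, cond_false, List.mem_singleton,
        List.not_mem_nil, Prod.mk.injEq] at h
      obtain ⟨rfl, rfl, rfl⟩ := h
      exact ⟨(hSn t ht).1, (hSn t ht).2.1, (hPn p hp).2⟩
    · cases hb : t.1.beq p.2 <;> simp only [hb, cond_true, cond_false, List.mem_singleton,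
        List.not_mem_nil, Prod.mk.injEq] at h
      obtain ⟨rfl, rfl, rfl⟩ := h
      exact ⟨(hPn p hp).1, (hSn t ht).2.1, (hSn t ht).2.2⟩
    · cases hb : t.2.1.beq p.2 <;> simp only [hb, cond_true, cond_false, List.mem_singleton,
        List.not_mem_nil, Prod.mk.injEq] at h
      obtain ⟨rfl, rfl, rfl⟩ := h
      exact ⟨(hSn t ht).1, (hPn p hp).1, (hSn t ht).2.2⟩
  exact ⟨d.leibnizTerms_sum hS hlt.1 hlt.2.1 hlt.2.2, i, j, l, rfl⟩

/-- The support of a solution is admissible. -/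
theorem admissible_of_isSupport (H : d.NondiagonalEquations) {S : List Tri} {P : List (ℕ × ℕ)}
    (hS : IsSupport d.coeff d.entry S P) : admissible n S P = true := by
  rw [admissible, Bool.and_eq_true]
  constructor
  · simp only [noArrowOK, List.all_eq_true]
    intro p hp t ht
    by_contra hc
    simp only [Bool.not_eq_true, Bool.not_eq_false', Bool.and_eq_true, Bool.or_eq_true,
      Nat.beq_eq] at hc
    have hpp : p.1 ≠ p.2 := fun e => by
      have := hS.irrefl p.1
      rw [← Bool.not_eq_true, hasPair_iff] at this
      exact this (by rw [show (p.1, p.1) = p from Prod.ext rfl e]; exact hp)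
    have he := (hS.pair p.1 p.2 hpp).2 (hasPair_iff.2 hp)
    have ht' : d.coeff t.1 t.2.1 t.2.2 ≠ 0 := (hS.tri _ _ _).2 (hasTri_iff.2 (Or.inl ht))
    have key : ∀ i k j, i ≠ j → d.entry i j ≠ 0 → d.coeff i k j = 0 := by
      intro i k j hij h
      by_contra h0
      obtain ⟨h1, h2, h3⟩ := d.lt_of_coeff h0
      lift i to Fin n using h1
      lift j to Fin n using h3
      lift k to Fin n using h2
      rw [coeff_val] at h0
      rw [entry_val] at h
      exact h0 (H.no_arrow _ _ (fun e => hij (by rw [e])) h _)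
    obtain ⟨h1, h2 | h2⟩ := hc
    · refine ht' ?_
      rw [h1, h2]
      exact key _ _ _ hpp he
    · refine ht' ?_
      rw [coeff_skew, h1, h2, key _ _ _ hpp he, neg_zero]
  · rw [List.all_eq_true]
    intro r hr
    obtain ⟨hsum, i, j, l, e⟩ := exists_of_mem_relations hS hr
    by_contra hc
    rw [Bool.not_eq_true, Bool.not_eq_false', Nat.beq_eq] at hc
    obtain ⟨x, rfl⟩ := List.length_eq_one_iff.1 hc
    rw [List.map_singleton, List.sum_singleton] at hsum
    -- A single nonzero term cannot sum to zero.
    exact hS.termReal_ne_zero (n := n) (i := i) (j := j) (l := l) (by rw [← e]; simp) hsum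

theorem beq_or_iff {p : List ℕ} {t t' : Tri} : keyMatch p t t' = true ↔
    t'.2.2 = p.getD t.2.2 0 ∧ ((t'.1 = p.getD t.1 0 ∧ t'.2.1 = p.getD t.2.1 0) ∨
      (t'.1 = p.getD t.2.1 0 ∧ t'.2.1 = p.getD t.1 0)) := by
  simp [keyMatch]

theorem pairMatch_iff {p : List ℕ} {a a' : ℕ × ℕ} : pairMatch p a a' = true ↔
    a'.1 = p.getD a.1 0 ∧ a'.2 = p.getD a.2 0 := by
  simp [pairMatch]

/-- A support moves along a relabelling of the nodes. -/
theorem isSupport_of_supportMatch {d' : Datum n} {π : Equiv.Perm (Fin n)} {p : List ℕ}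
    (hp : ∀ i : Fin n, p.getD i 0 = π i)
    (hc : ∀ i j k, d'.L.c (π i) (π j) (π k) ≠ 0 ↔ d.L.c i j k ≠ 0)
    (hD : ∀ i j, d'.D (π j) (π i) ≠ 0 ↔ d.D j i ≠ 0)
    (hdiag : ∀ i j k, d'.coeff i j k ≠ 0 → d'.entry k k = d'.entry i i + d'.entry j j)
    {S S' : List Tri} {P P' : List (ℕ × ℕ)}
    (hS : IsSupport d.coeff d.entry S P) (hm : supportMatch S P S' P' p = true) :
    IsSupport d'.coeff d'.entry S' P' := by
  simp only [supportMatch, Bool.and_eq_true, List.all_eq_true, List.any_eq_true] at hm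
  obtain ⟨⟨⟨m1, m2⟩, m3⟩, m4⟩ := hm
  have hirr : ∀ a ∈ P, a.1 ≠ a.2 := fun a ha e => by
    have := hS.irrefl a.1
    rw [← Bool.not_eq_true, hasPair_iff] at this
    exact this (by rw [show (a.1, a.1) = a from Prod.ext rfl e]; exact ha)
  have hP : ∀ a ∈ P, ∃ i j : Fin n, a = ((i : ℕ), (j : ℕ)) ∧ i ≠ j ∧ d.D j i ≠ 0 := fun a ha => by
    have h := (hS.pair _ _ (hirr a ha)).2 (hasPair_iff.2 ha)
    obtain ⟨h1, h2⟩ := d.lt_of_entry h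
    refine ⟨⟨a.1, h1⟩, ⟨a.2, h2⟩, rfl, fun e => hirr a ha (congrArg Fin.val e), ?_⟩
    rw [← entry_val]
    exact h
  have hSm : ∀ t ∈ S, ∃ i j k : Fin n, t = ((i : ℕ), (j : ℕ), (k : ℕ)) ∧ d.L.c i j k ≠ 0 := by
    intro t ht
    have h : d.coeff t.1 t.2.1 t.2.2 ≠ 0 := (hS.tri _ _ _).2 (hasTri_iff.2 (Or.inl ht))
    obtain ⟨h1, h2, h3⟩ := d.lt_of_coeff h
    refine ⟨⟨t.1, h1⟩, ⟨t.2.1, h2⟩, ⟨t.2.2, h3⟩, rfl, ?_⟩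
    rw [← coeff_val]
    exact h
  have hirr' : ∀ a' ∈ P', ∃ i j : Fin n, a' = ((π i : ℕ), (π j : ℕ)) ∧ i ≠ j ∧ d.D j i ≠ 0 := by
    intro a' ha'
    obtain ⟨a, ha, hm⟩ := m2 a' ha'
    obtain ⟨i, j, rfl, hij, h⟩ := hP a ha
    rw [pairMatch_iff, hp, hp] at hm
    exact ⟨i, j, Prod.ext hm.1 hm.2, hij, h⟩
  refine ⟨d'.coeff_skew, fun x y z => ⟨fun h => ?_, fun h => ?_⟩,
    fun x y hxy => ⟨fun h => ?_, fun h => ?_⟩, fun x => ?_, hdiag⟩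
  · obtain ⟨h1, h2, h3⟩ := d'.lt_of_coeff h
    lift x to Fin n using h1
    lift y to Fin n using h2
    lift z to Fin n using h3
    obtain ⟨i, rfl⟩ := π.surjective x
    obtain ⟨j, rfl⟩ := π.surjective y
    obtain ⟨k, rfl⟩ := π.surjective z
    rw [coeff_val, hc, ← coeff_val, hS.tri, hasTri_iff] at h
    rw [hasTri_iff]
    rcases h with h | h
    · obtain ⟨⟨a, b, c⟩, ht', hm⟩ := m3 _ h
      rw [beq_or_iff, hp, hp, hp] at hm
      obtain ⟨rfl, ⟨rfl, rfl⟩ | ⟨rfl, rfl⟩⟩ := hm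
      · exact Or.inl ht'
      · exact Or.inr ht'
    · obtain ⟨⟨a, b, c⟩, ht', hm⟩ := m3 _ h
      rw [beq_or_iff, hp, hp, hp] at hm
      obtain ⟨rfl, ⟨rfl, rfl⟩ | ⟨rfl, rfl⟩⟩ := hm
      · exact Or.inr ht'
      · exact Or.inl ht'
  · have key : ∀ t' ∈ S', d'.coeff t'.1 t'.2.1 t'.2.2 ≠ 0 := by
      intro t' ht'
      obtain ⟨t, ht, hm⟩ := m4 t' ht'
      obtain ⟨i, j, k, rfl, h0⟩ := hSm t ht
      rw [beq_or_iff, hp, hp, hp] at hm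
      obtain ⟨h1, ⟨h2, h3⟩ | ⟨h2, h3⟩⟩ := hm <;> rw [h1, h2, h3, coeff_val, hc]
      · exact h0
      · rw [d.L.skew, neg_ne_zero]
        exact h0
    rcases hasTri_iff.1 h with h | h
    · exact key _ h
    · rw [coeff_skew, neg_ne_zero]
      exact key _ h
  · obtain ⟨h1, h2⟩ := d'.lt_of_entry h
    lift x to Fin n using h1
    lift y to Fin n using h2
    obtain ⟨i, rfl⟩ := π.surjective x
    obtain ⟨j, rfl⟩ := π.surjective y
    have hij : (i : ℕ) ≠ j := fun e => hxy (by rw [Fin.ext e])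
    rw [entry_val, hD, ← entry_val, hS.pair _ _ hij, hasPair_iff] at h
    obtain ⟨⟨a, b⟩, ha', hm⟩ := m1 _ h
    rw [pairMatch_iff, hp, hp] at hm
    obtain ⟨rfl, rfl⟩ := hm
    exact hasPair_iff.2 ha'
  · obtain ⟨i, j, e, -, h0⟩ := hirr' _ (hasPair_iff.1 h)
    obtain ⟨rfl, rfl⟩ := Prod.mk.inj e
    rw [entry_val, hD]
    exact h0
  · rw [← Bool.not_eq_true, hasPair_iff]
    intro h
    obtain ⟨i, j, e, hij, -⟩ := hirr' _ h
    obtain ⟨h1, h2⟩ := Prod.mk.inj e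
    exact hij (π.injective (Fin.ext (h1.symm.trans h2)))

/-- Every solution is equivalent to one whose support is listed. -/
theorem exists_listed_support (H : d.NondiagonalEquations) (hn : n ≤ 5)
    {cl : List (ℕ × List Tri × List (ℕ × ℕ))} (hcl : classified cl n = true) :
    ∃ d' : Datum n, d.Equivalent d' ∧ d'.NondiagonalEquations ∧
      ∃ q ∈ cl, q.1 = n ∧ IsSupport d'.coeff d'.entry q.2.1 q.2.2 := by
  obtain ⟨σ, hσ⟩ := H.exists_increasing
  have H1 := H.relabel σ
  obtain ⟨P, hP, hpair⟩ := exists_arrowSet H1 hn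
  have hS : IsSupport (d.relabel σ).coeff (d.relabel σ).entry (d.relabel σ).tripleSupport P :=
    ⟨coeff_skew _, coeff_ne_zero_iff _ hσ, hpair, irrefl_of_mem_arrowSets hP, H1.coeff_diag⟩
  simp only [classified, List.all_eq_true, Bool.or_eq_true, Bool.not_eq_true', List.any_eq_true,
    List.mem_filter, Bool.and_eq_true, Nat.beq_eq] at hcl
  rcases hcl _ (mem_diagramSets H1 hσ) P hP with h | ⟨q, ⟨hq, hqn, -⟩, -, p, hp, hm⟩
  · rw [admissible_of_isSupport H1 hS] at h
    cases h
  obtain ⟨π, hπ⟩ := exists_perm_of_mem hp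
  -- The permutation π carries the nodes of the support to those of the listed one, so the datum is
  -- pulled back along its inverse.
  refine ⟨(d.relabel σ).relabel π.symm, ?_, H1.relabel _, q, hq, hqn, ?_⟩
  · exact (isSignedPermutation_relabel d σ).equivalent.symm.trans
      (isSignedPermutation_relabel _ _).equivalent.symm
  · refine isSupport_of_supportMatch hπ (fun i j k => ?_) (fun i j => ?_)
      (H1.relabel _).coeff_diag hS hm
    · change (d.relabel σ).L.c (π.symm (π i)) (π.symm (π j)) (π.symm (π k)) ≠ 0 ↔ _
      simp
    · change (d.relabel σ).D (π.symm (π j)) (π.symm (π i)) ≠ 0 ↔ _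
      simp

end Datum

end NiceNil

namespace NiceNil

/-! ### Linear systems -/

/-- The value of a rational row on a real vector. -/
def dot : List ℚ → List ℝ → ℝ
  | a :: l, x :: v => a * x + dot l v
  | _, _ => 0

theorem dot_subRow (f : ℚ) (a b : List ℚ) (v : List ℝ) :
    dot (subRow f a b) v = dot a v - f * dot b v := by
  induction v generalizing a b with
  | nil => cases a <;> cases b <;> simp [subRow, dot]
  | cons x v ih =>
    cases a with
    | nil =>
      cases b with
      | nil => simp [subRow, dot]
      | cons b l => simp only [subRow, dot, ih]; push_cast; ring
    | cons a l =>
      cases b with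
      | nil => simp [subRow, dot]
      | cons b l' => simp only [subRow, dot, ih]; push_cast; ring

theorem dot_map_mul (f : ℚ) (a : List ℚ) (v : List ℝ) : dot (a.map (f * ·)) v = f * dot a v := by
  induction v generalizing a with
  | nil => cases a <;> simp [dot]
  | cons x v ih =>
    cases a with
    | nil => simp [dot]
    | cons a l => simp only [List.map_cons, dot, ih]; push_cast; ring

theorem dot_map_append {α : Type*} (l : List α) (f : α → ℚ) (F : α → ℝ) (r : List ℚ)
    (w : List ℝ) : dot (l.map f ++ r) (l.map F ++ w) =
      (l.map fun x => (f x : ℝ) * F x).sum + dot r w := by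
  induction l with
  | nil => simp
  | cons a l ih => simp only [List.map_cons, List.cons_append, dot, ih, List.sum_cons]; ring

theorem dot_map_range (M : ℕ) (g : ℕ → ℚ) (v : List ℝ) (hv : v.length = M) :
    dot ((List.range M).map g) v = ∑ c ∈ Finset.range M, (g c : ℝ) * v.getD c 0 := by
  induction v generalizing M g with
  | nil => subst hv; simp [dot]
  | cons x v ih =>
    subst hv
    rw [List.length_cons, List.range_succ_eq_map, List.map_cons, dot, List.map_map, ih _ _ rfl,
      Finset.sum_range_succ', List.getD_cons_zero, add_comm]
    rfl

theorem dot_reduceBy {c : ℕ} {p r : List ℚ} {v : List ℝ} (hp : dot p v = 0) (hr : dot r v = 0) :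
    dot (reduceBy c p r) v = 0 := by
  unfold reduceBy
  cases r.getD c 0 == 0
  · rw [cond_false, dot_subRow, hp, hr]; ring
  · exact hr

theorem extractPivot_sound {c : ℕ} {v : List ℝ} {rows : List (List ℚ)}
    (h : ∀ r ∈ rows, dot r v = 0) {p : List ℚ} {rest : List (List ℚ)}
    (he : extractPivot c rows = some (p, rest)) : dot p v = 0 ∧ ∀ r ∈ rest, dot r v = 0 := by
  induction rows generalizing p rest with
  | nil => simp [extractPivot] at he
  | cons r rs ih =>
    rw [extractPivot] at he
    have h1 := h r List.mem_cons_self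
    have h2 : ∀ r ∈ rs, dot r v = 0 := fun r hr => h r (List.mem_cons_of_mem _ hr)
    cases hb : r.getD c 0 == 0 <;> rw [hb] at he
    · simp only [cond_false, Option.some.injEq, Prod.mk.injEq] at he
      obtain ⟨rfl, rfl⟩ := he
      exact ⟨h1, h2⟩
    · simp only [cond_true, Option.map_eq_some_iff, Prod.mk.injEq, Prod.exists] at he
      obtain ⟨a, b, hab, rfl, rfl⟩ := he
      obtain ⟨h3, h4⟩ := ih h2 hab
      refine ⟨h3, fun x hx => ?_⟩
      rcases List.mem_cons.1 hx with rfl | hx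
      · exact h1
      · exact h4 _ hx

/-- Every row produced is a linear combination of the given ones, so it annihilates each of their
solutions. Completeness or correct pivoting of the elimination is never used. -/
theorem gauss_sound {v : List ℝ} (cols : List ℕ) : ∀ (done todo : List (List ℚ)) (free : List ℕ),
    (∀ r ∈ done, dot r v = 0) → (∀ r ∈ todo, dot r v = 0) →
      ∀ r ∈ (gauss cols done todo free).1, dot r v = 0 := by
  induction cols with
  | nil => intro done todo free h1 _; exact h1
  | cons c cs ih =>
    intro done todo free h1 h2
    rw [gauss]
    cases he : extractPivot c todo with
    | none => exact ih _ _ _ h1 h2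
    | some q =>
      obtain ⟨p, rest⟩ := q
      obtain ⟨h3, h4⟩ := extractPivot_sound h2 he
      have h5 : dot (p.map ((p.getD c 0)⁻¹ * ·)) v = 0 := by rw [dot_map_mul, h3, mul_zero]
      refine ih _ _ _ (fun r hr => ?_) (fun r hr => ?_)
      · rcases List.mem_cons.1 hr with rfl | hr
        · exact h5
        · obtain ⟨r', hr', rfl⟩ := List.mem_map.1 hr
          exact dot_reduceBy h5 (h1 _ hr')
      · obtain ⟨r', hr', rfl⟩ := List.mem_map.1 hr
        exact dot_reduceBy h5 (h4 _ hr')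

/-- An accepted row reads v_k + r_f v_f + r_N = 0, because the last coordinate of v is 1. -/
theorem readAffine_sound {N f : ℕ} {rows : List (List ℚ)} {v : List ℝ} (hv : v.length = N + 1)
    (hN : v.getD N 0 = 1) (hrows : ∀ r ∈ rows, dot r v = 0) (hf : f ≠ N) {k : ℕ} (hk : k < N)
    {a : ℚ × ℚ} (ha : readAffine N f rows k = some a) :
    v.getD k 0 = a.1 + a.2 * v.getD f 0 := by
  rw [readAffine] at ha
  by_cases hkf : k = f
  · subst hkf
    rw [Nat.beq_refl, cond_true, Option.some.injEq] at ha
    rw [← ha]; simp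
  · have hb : k.beq f = false := by rw [← Bool.not_eq_true, Nat.beq_eq]; exact hkf
    rw [hb, cond_false, Option.map_eq_some_iff] at ha
    obtain ⟨r, hr, rfl⟩ := ha
    have h1 := hrows r (List.mem_of_find?_eq_some hr)
    have h2 := List.find?_some hr
    rw [beq_iff_eq] at h2
    set rN := r.getD N 0
    set rf := r.getD f 0
    rw [h2, dot_map_range _ _ _ hv, Finset.sum_range_succ] at h1
    have h3 : ∀ c ∈ Finset.range N, (((bif c.beq k then (1 : ℚ) else bif c.beq f then rf
        else bif c.beq N then rN else 0 : ℚ) : ℝ) * v.getD c 0) =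
        (if c = k then v.getD k 0 else 0) + (if c = f then rf * v.getD f 0 else 0) := by
      intro c hc
      have hcN : c.beq N = false := by
        rw [← Bool.not_eq_true, Nat.beq_eq]; exact (Finset.mem_range.1 hc).ne
      by_cases h4 : c = k
      · subst h4; simp [hkf]
      · by_cases h5 : c = f
        · subst h5
          have : c.beq k = false := by rw [← Bool.not_eq_true, Nat.beq_eq]; exact h4
          simp [h4, this]
        · have e1 : c.beq k = false := by rw [← Bool.not_eq_true, Nat.beq_eq]; exact h4
          have e2 : c.beq f = false := by rw [← Bool.not_eq_true, Nat.beq_eq]; exact h5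
          simp [h4, h5, e1, e2, hcN]
    have e1 : N.beq k = false := by rw [← Bool.not_eq_true, Nat.beq_eq]; exact hk.ne'
    have e2 : N.beq f = false := by rw [← Bool.not_eq_true, Nat.beq_eq]; exact hf.symm
    rw [Finset.sum_congr rfl h3, Finset.sum_add_distrib, Finset.sum_ite_eq', Finset.sum_ite_eq',
      if_pos (Finset.mem_range.2 hk), e1, e2, Nat.beq_refl, hN] at h1
    simp only [cond_true, cond_false, mul_one] at h1
    -- If f is not below N it lies past the end of v, so its coordinate reads as zero and v_k is the
    -- constant −r_N.
    by_cases hfN : f < N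
    · rw [if_pos (Finset.mem_range.2 hfN)] at h1
      push_cast
      linarith
    · rw [if_neg (by simpa using hfN)] at h1
      have : v.getD f 0 = 0 := List.getD_eq_default _ _ (by omega)
      rw [this]
      push_cast
      linarith

theorem forall₂_of_mapM {α β : Type} {f : α → Option β} : ∀ {l : List α} {r : List β},
    l.mapM f = some r → List.Forall₂ (fun a b => f a = some b) l r := by
  intro l
  induction l with
  | nil => intro r h; simp at h; subst h; exact List.Forall₂.nil
  | cons a l ih =>
    intro r h
    rw [List.mapM_cons] at h
    simp only [Option.bind_eq_bind, Option.bind_eq_some_iff, Option.pure_def,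
      Option.some.injEq] at h
    obtain ⟨b, hb, r', hr', rfl⟩ := h
    exact List.Forall₂.cons hb (ih hr')

theorem getD_indexP {P : List (ℕ × ℕ)} {p : ℕ × ℕ} (hp : p ∈ P) (F : ℕ × ℕ → ℝ) (w : List ℝ) :
    indexP p P < P.length ∧ (P.map F ++ w).getD (indexP p P) 0 = F p := by
  induction P with
  | nil => simp at hp
  | cons q l ih =>
    rw [indexP]
    cases hb : q.1.beq p.1 && q.2.beq p.2
    · have hne : p ≠ q := by
        rintro rfl
        simp at hb
      obtain ⟨h1, h2⟩ := ih ((List.mem_cons.1 hp).resolve_left hne)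
      simpa using ⟨h1, h2⟩
    · rw [Bool.and_eq_true, Nat.beq_eq, Nat.beq_eq] at hb
      have : q = p := Prod.ext hb.1 hb.2
      simp [this]

theorem getD_indexT {S : List Tri} {t : Tri} (ht : hasTri S t.1 t.2.1 t.2.2 = true) (F : Tri → ℝ)
    (hF : ∀ i j k, F (i, j, k) = F (j, i, k)) (w : List ℝ) :
    indexT t S < S.length ∧ (S.map F ++ w).getD (indexT t S) 0 = F t := by
  obtain ⟨i, j, k⟩ := t
  induction S with
  | nil => simp [hasTri] at ht
  | cons u l ih =>
    obtain ⟨a, b, c⟩ := u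
    rw [indexT]
    cases hb : c.beq k && ((a.beq i && b.beq j) || (a.beq j && b.beq i))
    · have : hasTri l i j k = true := by
        rw [hasTri, List.any_cons, hb, Bool.false_or] at ht
        exact ht
      obtain ⟨h1, h2⟩ := ih this
      simpa using ⟨h1, h2⟩
    · simp only [Bool.and_eq_true, Bool.or_eq_true, Nat.beq_eq] at hb
      obtain ⟨rfl, ⟨rfl, rfl⟩ | ⟨rfl, rfl⟩⟩ := hb
      · simp
      · simp [hF]

theorem getD_append_add (l r : List ℝ) {m : ℕ} (hm : l.length = m) (i : ℕ) :
    (l ++ r).getD (m + i) 0 = r.getD i 0 := by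
  rw [List.getD_append_right _ _ _ _ (by omega), hm, Nat.add_sub_cancel_left]

/-- The vector satisfying the linear system. -/
def solutionVector (n : ℕ) (S : List Tri) (P : List (ℕ × ℕ)) (F : ℕ → ℝ) (G : ℕ × ℕ → ℝ)
    (K : Tri → ℝ) : List ℝ := (List.range n).map F ++ (P.map G ++ (S.map K ++ [1]))

theorem dot_mkRow (n : ℕ) (S : List Tri) (P : List (ℕ × ℕ)) (F : ℕ → ℝ) (G : ℕ × ℕ → ℝ)
    (K : Tri → ℝ) (f : ℕ → ℚ) (g : ℕ × ℕ → ℚ) (h : Tri → ℚ) (c : ℚ) :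
    dot (mkRow n S P f g h c) (solutionVector n S P F G K) =
      ∑ l ∈ Finset.range n, (f l : ℝ) * F l + (P.map fun p => (g p : ℝ) * G p).sum +
        (S.map fun t => (h t : ℝ) * K t).sum + c := by
  rw [mkRow, solutionVector, dot_map_append, dot_map_append, dot_map_append, sum_map_range]
  simp [dot, add_assoc]

/-- The quadratic relation singles out the free parameter. -/
theorem solveFree_sound {n : ℕ} {S : List Tri} {P : List (ℕ × ℕ)} {aff : List (ℚ × ℚ)}
    {R : List (List (Bool × Tri × (ℕ × ℕ)))} {t : ℝ} {G : ℕ × ℕ → ℝ} {K : Tri → ℝ}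
    (hG : ∀ p ∈ P, G p = (aff.getD (n + indexP p P) 0).1 + (aff.getD (n + indexP p P) 0).2 * t)
    (hK : ∀ u : Tri, hasTri S u.1 u.2.1 u.2.2 = true → K u =
      (aff.getD (n + P.length + indexT u S) 0).1 + (aff.getD (n + P.length + indexT u S) 0).2 * t)
    (hR : ∀ r ∈ R, ∀ a b, r = [a, b] → a.2.2 ∈ P ∧ b.2.2 ∈ P ∧
      hasTri S a.2.1.1 a.2.1.2.1 a.2.1.2.2 = true ∧ hasTri S b.2.1.1 b.2.1.2.1 b.2.1.2.2 = true ∧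
      G a.2.2 * K a.2.1 = G b.2.2 * K b.2.1)
    {s : ℚ} (hs : solveFree n S P aff R = some s) : t = s := by
  unfold solveFree at hs
  split at hs
  · rename_i x u p y u' p' R'
    obtain ⟨h1, h2, h3, h4, h5⟩ := hR _ List.mem_cons_self _ _ rfl
    simp only at h1 h2 h3 h4 h5
    rw [hG p h1, hG p' h2, hK u h3, hK u' h4] at h5
    simp only at hs
    set a := aff.getD (n + indexP p P) 0
    set a' := aff.getD (n + indexP p' P) 0
    set b := aff.getD (n + P.length + indexT u S) 0
    set b' := aff.getD (n + P.length + indexT u' S) 0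
    set c0 := a.1 * b.1 - a'.1 * b'.1 with hc0
    set c1 := a.1 * b.2 + a.2 * b.1 - (a'.1 * b'.2 + a'.2 * b'.1) with hc1
    set c2 := a.2 * b.2 - a'.2 * b'.2 with hc2
    cases hb : (c2 == 0 && !(c1 == 0)) <;> rw [hb] at hs
    · simp at hs
    · rw [cond_true, Option.some.injEq] at hs
      rw [Bool.and_eq_true, beq_iff_eq, Bool.not_eq_true', beq_eq_false_iff_ne] at hb
      -- The relation between products of affine functions is a polynomial in t of degree at most
      -- two; the test ensures c2 = 0 and c1 ≠ 0.
      have e : (c0 : ℝ) + c1 * t + c2 * t ^ 2 = 0 := by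
        rw [hc0, hc1, hc2]; push_cast; linear_combination h5
      have hc1' : (c1 : ℝ) ≠ 0 := by exact_mod_cast hb.2
      rw [hb.1] at e
      rw [← hs]
      push_cast at e ⊢
      field_simp
      linear_combination e
  · simp at hs

/-- The solution found by elimination is the only one. -/
theorem solveCase_sound {n : ℕ} {S : List Tri} {P : List (ℕ × ℕ)} {F : ℕ → ℝ} {G : ℕ × ℕ → ℝ}
    {K : Tri → ℝ} (hsym : ∀ i j k, K (i, j, k) = K (j, i, k))
    (hlin : ∀ r ∈ linearSystem n S P, dot r (solutionVector n S P F G K) = 0)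
    (hR : ∀ r ∈ relations n S P, ∀ a b, r = [a, b] → a.2.2 ∈ P ∧ b.2.2 ∈ P ∧
      hasTri S a.2.1.1 a.2.1.2.1 a.2.1.2.2 = true ∧ hasTri S b.2.1.1 b.2.1.2.1 b.2.1.2.2 = true ∧
      G a.2.2 * K a.2.1 = G b.2.2 * K b.2.1)
    {w : List ℚ} (hw : solveCase n S P = some w) :
    w.map (fun x : ℚ => (x : ℝ)) = (List.range n).map F ++ (P.map G ++ S.map K) := by
  unfold solveCase at hw
  simp only at hw
  set N := n + P.length + S.length with hN
  set g := gauss (List.range N) [] (linearSystem n S P) []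
  set f := g.2.headD (N + 1)
  set v := solutionVector n S P F G K with hvdef
  have hv' : v = (List.range n).map F ++ (P.map G ++ S.map K) ++ [1] := by
    simp [hvdef, solutionVector]
  have hlenZ : ((List.range n).map F ++ (P.map G ++ S.map K)).length = N := by
    simp [hN, add_assoc]
  have hlen : v.length = N + 1 := by rw [hv', List.length_append, hlenZ]; rfl
  have hvN : v.getD N 0 = 1 := by
    rw [hv', List.getD_append_right _ _ _ _ hlenZ.le, hlenZ, Nat.sub_self]
    rfl
  cases hfN : f.beq N <;> rw [hfN] at hw
  swap
  · simp at hw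
  have hf : f ≠ N := by
    rw [← Bool.not_eq_true, Nat.beq_eq] at hfN; exact hfN
  rw [cond_false, Option.bind_eq_some_iff] at hw
  obtain ⟨aff, haff, hw⟩ := hw
  rw [Option.map_eq_some_iff] at hw
  obtain ⟨s, hs, rfl⟩ := hw
  have h2 := forall₂_of_mapM haff
  have hal : aff.length = N := by rw [← h2.length_eq, List.length_range]
  have hann : ∀ r ∈ g.1, dot r v = 0 := gauss_sound _ _ _ _ (by simp) hlin
  have hval : ∀ k < N, v.getD k 0 = (aff.getD k 0).1 + (aff.getD k 0).2 * v.getD f 0 := by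
    intro k hk
    have h3 := List.Forall₂.get h2 (i := k) (by simpa using hk) (by omega)
    simp only [List.get_eq_getElem, List.getElem_range] at h3
    rw [readAffine_sound hlen hvN hann hf hk h3, List.getD_eq_getElem aff _ (by omega)]
  have hG : ∀ p ∈ P, G p =
      (aff.getD (n + indexP p P) 0).1 + (aff.getD (n + indexP p P) 0).2 * v.getD f 0 := by
    intro p hp
    obtain ⟨h3, h4⟩ := getD_indexP hp G (S.map K ++ [1])
    rw [← hval _ (by omega), ← h4]
    exact (getD_append_add _ _ (by simp) _).symm
  have hK : ∀ u : Tri, hasTri S u.1 u.2.1 u.2.2 = true → K u =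
      (aff.getD (n + P.length + indexT u S) 0).1 +
        (aff.getD (n + P.length + indexT u S) 0).2 * v.getD f 0 := by
    intro u hu
    obtain ⟨h3, h4⟩ := getD_indexT hu K hsym [1]
    rw [← hval _ (by omega), ← h4, hvdef, solutionVector, ← List.append_assoc]
    exact (getD_append_add _ _ (by simp) _).symm
  -- Either a free unknown exists and the quadratic relation determines it, or f = N + 1 and both
  -- sides are the default value zero.
  have hs' : v.getD f 0 = s := by
    cases hb : Nat.blt N f <;> rw [hb] at hs
    · exact solveFree_sound hG hK hR hs
    · rw [cond_true, Option.some.injEq] at hs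
      rw [← hs, List.getD_eq_default _ _ (by rw [hlen]; simpa using hb)]
      simp
  refine List.ext_getElem (by simp [hal, hN, add_assoc]) fun k hk _ => ?_
  have hkN : k < N := by simpa [hal] using hk
  have h3 := hval k hkN
  conv at h3 => lhs; rw [hv', List.getD_append _ _ _ _ (by omega), List.getD_eq_getElem _ _ (by omega)]
  rw [
    hs', List.getD_eq_getElem aff _ (by omega)] at h3
  rw [h3]
  simp

end NiceNil

/-! ### Linear and quadratic equations for the weights of a solution -/

namespace NiceNil

theorem cast_delta (a b : ℕ) : ((delta a b : ℚ) : ℝ) = if a = b then 1 else 0 := by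
  by_cases h : a = b
  · simp [delta, h]
  · have : a.beq b = false := by rw [← Bool.not_eq_true, Nat.beq_eq]; exact h
    simp [delta, h, this]

theorem sum_map_div {α : Type*} (l : List α) (f : α → ℝ) (a : ℝ) :
    (l.map fun x => f x / a).sum = (l.map f).sum / a := by
  induction l with
  | nil => simp
  | cons x l ih => simp [ih, add_div]

/-- Lists of keys without repetitions. -/
def WellFormed (S : List Tri) (P : List (ℕ × ℕ)) : Prop :=
  S.Nodup ∧ P.Nodup ∧ ∀ t ∈ S, t.1 < t.2.1

instance (S : List Tri) (P : List (ℕ × ℕ)) : Decidable (WellFormed S P) :=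
  inferInstanceAs (Decidable (_ ∧ _ ∧ _))

namespace Datum

variable {n : ℕ} (d : Datum n)

/-- The weight of a triple. -/
def triWeight (t : Tri) : ℝ :=
  d.eps t.1 * d.eps t.2.1 * d.eps t.2.2 * d.coeff t.1 t.2.1 t.2.2 ^ 2

/-- The weight of a pair. -/
def pairWeight (p : ℕ × ℕ) : ℝ := d.eps p.1 * d.eps p.2 * d.entry p.1 p.2 ^ 2

theorem triWeight_symm (i j k : ℕ) : d.triWeight (i, j, k) = d.triWeight (j, i, k) := by
  simp only [triWeight]
  rw [d.coeff_skew i j k]; ring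

variable {d} {S : List Tri} {P : List (ℕ × ℕ)} (hS : IsSupport d.coeff d.entry S P)
  (hw : WellFormed S P)
include hS hw

/-- Weights vanish off the support and are symmetric in i and j, and S lists each bracket once with
i < j; the factor 2 counts the two orders. -/
theorem sum_weight (F : Tri → ℝ) (hF : ∀ i j k, F (i, j, k) = F (j, i, k)) :
    ∑ i : Fin n, ∑ j : Fin n, ∑ k : Fin n, F ((i : ℕ), (j : ℕ), (k : ℕ)) * d.weight i j k =
      2 * (S.map fun t => F t * d.triWeight t).sum := by
  have hwt : ∀ i j k : Fin n, d.weight i j k = d.triWeight ((i : ℕ), (j : ℕ), (k : ℕ)) :=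
    fun i j k => by simp [weight, triWeight]
  rw [sum_eq_two_mul_sum_lt _ (fun i j k => by rw [weight_symm, hF])
    (fun i k => by rw [weight, d.c_self]; ring)]
  congr 1
  let f : ℕ → ℕ → ℕ → ℝ := fun i j k => if i < j then F (i, j, k) * d.triWeight (i, j, k) else 0
  have e1 : ∑ i : Fin n, ∑ j : Fin n, ∑ k : Fin n,
      (if i < j then F ((i : ℕ), (j : ℕ), (k : ℕ)) * d.weight i j k else 0) =
      ∑ i ∈ Finset.range n, ∑ j ∈ Finset.range n, ∑ k ∈ Finset.range n, f i j k := by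
    simp only [Finset.sum_range, hwt, f, Fin.val_fin_lt]
  rw [e1, ← List.sum_toFinset _ hw.1]
  have e2 : ∑ i ∈ Finset.range n, ∑ j ∈ Finset.range n, ∑ k ∈ Finset.range n, f i j k =
      ∑ t ∈ Finset.range n ×ˢ Finset.range n ×ˢ Finset.range n, f t.1 t.2.1 t.2.2 := by
    rw [Finset.sum_product]
    refine Finset.sum_congr rfl fun i _ => ?_
    rw [Finset.sum_product]
  have hsub : S.toFinset ⊆ Finset.range n ×ˢ Finset.range n ×ˢ Finset.range n := by
    intro t ht
    have h : d.coeff t.1 t.2.1 t.2.2 ≠ 0 :=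
      (hS.tri _ _ _).2 (hasTri_iff.2 (Or.inl (List.mem_toFinset.1 ht)))
    simpa using d.lt_of_coeff h
  rw [e2, ← Finset.sum_subset hsub]
  · refine Finset.sum_congr rfl fun t ht => ?_
    simp only [f]
    rw [if_pos (hw.2.2 t (List.mem_toFinset.1 ht))]
  · intro t _ ht
    simp only [f]
    split_ifs with hlt
    · by_cases hc : d.coeff t.1 t.2.1 t.2.2 = 0
      · simp [triWeight, hc]
      · rcases hasTri_iff.1 ((hS.tri _ _ _).1 hc) with h | h
        · exact absurd (List.mem_toFinset.2 h) ht
        · exact absurd (hw.2.2 _ h) hlt.not_gt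
    · rfl

theorem sum_offWeight_mul (F : ℕ → ℕ → ℝ) :
    ∑ i : Fin n, ∑ j : Fin n, d.offWeight i j * F i j =
      (P.map fun p => d.pairWeight p * F p.1 p.2).sum := by
  let f : ℕ → ℕ → ℝ := fun i j => if i = j then 0 else d.pairWeight (i, j) * F i j
  have e1 : ∑ i : Fin n, ∑ j : Fin n, d.offWeight i j * F i j =
      ∑ i ∈ Finset.range n, ∑ j ∈ Finset.range n, f i j := by
    simp only [Finset.sum_range, f, offWeight, pairWeight, eps_val, entry_val, Fin.ext_iff,
      ite_mul, zero_mul]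
  have hsub : P.toFinset ⊆ Finset.range n ×ˢ Finset.range n := by
    intro p hp
    have hp' := hasPair_iff.2 (List.mem_toFinset.1 hp : (p.1, p.2) ∈ P)
    have hne : p.1 ≠ p.2 := fun e => by
      rw [e, hS.irrefl] at hp'
      cases hp'
    simpa using d.lt_of_entry ((hS.pair _ _ hne).2 hp')
  rw [e1, ← List.sum_toFinset _ hw.2.1, ← Finset.sum_product', ← Finset.sum_subset hsub]
  · refine Finset.sum_congr rfl fun p hp => ?_
    have hp' := hasPair_iff.2 (List.mem_toFinset.1 hp : (p.1, p.2) ∈ P)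
    have hne : p.1 ≠ p.2 := fun e => by
      rw [e, hS.irrefl] at hp'
      cases hp'
    simp only [f]
    rw [if_neg hne]
  · intro p _ hp
    simp only [f]
    split_ifs with h
    · rfl
    · by_cases h0 : d.entry p.1 p.2 = 0
      · simp [pairWeight, h0]
      · exact absurd (List.mem_toFinset.2 (hasPair_iff.1 ((hS.pair _ _ h).1 h0))) hp

/-- The balance condition, as a sum over the support. -/
theorem balance_iff {l : ℕ} (hl : l < n) :
    (∑ i, ∑ j, ∑ k, rootEntry ⟨l, hl⟩ i j k * d.weight i j k =
      4 * d.D.trace * (d.D ⟨l, hl⟩ ⟨l, hl⟩ - 1) - 2 * ∑ i, ∑ j, d.offWeight i j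
        + 2 * (∑ j, d.offWeight ⟨l, hl⟩ j - ∑ i, d.offWeight i ⟨l, hl⟩)) ↔
    (S.map fun t => (rootCoeff l t : ℝ) * d.triWeight t).sum =
      2 * d.D.trace * (d.entry l l - 1) -
        (P.map fun p => ((1 - delta l p.1 + delta l p.2 : ℚ) : ℝ) * d.pairWeight p).sum := by
  have e1 : ∑ i, ∑ j, ∑ k, rootEntry ⟨l, hl⟩ i j k * d.weight i j k =
      2 * (S.map fun t => (rootCoeff l t : ℝ) * d.triWeight t).sum := by
    rw [← sum_weight hS hw (fun t => (rootCoeff l t : ℝ)) (fun i j k => by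
      simp only [rootCoeff]; push_cast; ring)]
    refine Finset.sum_congr rfl fun i _ => Finset.sum_congr rfl fun j _ =>
      Finset.sum_congr rfl fun k _ => ?_
    simp only [rootEntry, rootCoeff, Rat.cast_sub, cast_delta, Fin.ext_iff]
  have e2 : 2 * ∑ i, ∑ j, d.offWeight i j -
      2 * (∑ j, d.offWeight ⟨l, hl⟩ j - ∑ i, d.offWeight i ⟨l, hl⟩) =
      2 * (P.map fun p => ((1 - delta l p.1 + delta l p.2 : ℚ) : ℝ) * d.pairWeight p).sum := by
    have := sum_offWeight_mul hS hw fun i j => ((1 - delta l i + delta l j : ℚ) : ℝ)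
    simp only [mul_comm (d.pairWeight _)] at this
    rw [← this]
    have h3 : ∀ i j : Fin n, d.offWeight i j * ((1 - delta l i + delta l j : ℚ) : ℝ) =
        d.offWeight i j - (if (⟨l, hl⟩ : Fin n) = i then d.offWeight i j else 0) +
          (if (⟨l, hl⟩ : Fin n) = j then d.offWeight i j else 0) := fun i j => by
      push_cast
      rw [cast_delta, cast_delta]
      simp only [Fin.ext_iff]
      split_ifs <;> ring
    simp only [h3, Finset.sum_add_distrib, Finset.sum_sub_distrib, Finset.sum_ite_eq,
      Finset.mem_univ, if_true]
    rw [Finset.sum_comm (f := fun i j => if (⟨l, hl⟩ : Fin n) = i then d.offWeight i j else 0)]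
    simp only [Finset.sum_ite_eq, Finset.mem_univ, if_true]
    ring
  have e3 : d.entry l l = d.D ⟨l, hl⟩ ⟨l, hl⟩ := d.entry_val ⟨l, hl⟩ ⟨l, hl⟩
  rw [e1, e3]
  constructor <;> intro h <;> linarith

omit hS hw in
theorem trace_eq_sum : d.D.trace = ∑ l ∈ Finset.range n, d.entry l l := by
  rw [Finset.sum_range]
  simp [Matrix.trace]

/-- A solution satisfies the linear system of its support. -/
theorem linearSystem_sound (H : d.NondiagonalEquations) : ∀ r ∈ linearSystem n S P,
    dot r (solutionVector n S P (fun l => d.entry l l)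
      (fun p => d.pairWeight p / (2 * d.D.trace)) fun t => d.triWeight t / (2 * d.D.trace)) = 0 := by
  have hT := H.trace_ne_zero
  have hsum : ∀ a, a < n → ∑ l ∈ Finset.range n, ((delta l a : ℚ) : ℝ) * d.entry l l =
      d.entry a a := fun a ha => by
    simp only [cast_delta, ite_mul, one_mul, zero_mul, Finset.sum_ite_eq', Finset.mem_range, ha, if_true]
  intro r hr
  simp only [linearSystem, List.mem_append, List.mem_map, List.mem_range] at hr
  obtain ⟨t, ht, rfl⟩ | ⟨p, hp, rfl⟩ | ⟨l, hl, rfl⟩ := hr <;> rw [dot_mkRow]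
  · have hc : d.coeff t.1 t.2.1 t.2.2 ≠ 0 := (hS.tri _ _ _).2 (hasTri_iff.2 (Or.inl ht))
    obtain ⟨h1, h2, h3⟩ := d.lt_of_coeff hc
    have h4 := hS.diag _ _ _ hc
    simp only [rootCoeff, Rat.cast_sub, sub_mul, Finset.sum_sub_distrib, hsum _ h1, hsum _ h2,
      hsum _ h3]
    simp [h4]
  · have hp' := hasPair_iff.2 (hp : (p.1, p.2) ∈ P)
    have hne : p.1 ≠ p.2 := fun e => by
      rw [e, hS.irrefl] at hp'
      cases hp'
    have h0 := (hS.pair _ _ hne).2 hp'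
    obtain ⟨h1, h2⟩ := d.lt_of_entry h0
    have h3 : d.D.trace = d.entry p.1 p.1 - d.entry p.2 p.2 := by
      have := H.trace_eq ⟨p.1, h1⟩ ⟨p.2, h2⟩ (fun e => hne (congrArg Fin.val e)) (by
        rw [← entry_val]; exact h0)
      rw [this, ← entry_val, ← entry_val]
    rw [trace_eq_sum] at h3
    simp only [Rat.cast_add, Rat.cast_sub, Rat.cast_one, add_mul, sub_mul, one_mul,
      Finset.sum_add_distrib, Finset.sum_sub_distrib, hsum _ h1, hsum _ h2, h3]
    simp
  · have h1 := (balance_iff hS hw hl).1 (H.balance ⟨l, hl⟩)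
    have e1 : (S.map fun t => (rootCoeff l t : ℝ) * (d.triWeight t / (2 * d.D.trace))).sum =
        (S.map fun t => (rootCoeff l t : ℝ) * d.triWeight t).sum / (2 * d.D.trace) := by
      rw [← sum_map_div]
      simp only [mul_div_assoc]
    have e2 : (P.map fun p => ((1 - delta l p.1 + delta l p.2 : ℚ) : ℝ) *
        (d.pairWeight p / (2 * d.D.trace))).sum =
        (P.map fun p => ((1 - delta l p.1 + delta l p.2 : ℚ) : ℝ) * d.pairWeight p).sum /
          (2 * d.D.trace) := by
      rw [← sum_map_div]
      simp only [mul_div_assoc]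
    have e3 : ∑ a ∈ Finset.range n, ((-delta l a : ℚ) : ℝ) * d.entry a a = -d.entry l l := by
      simp only [Rat.cast_neg, neg_mul, Finset.sum_neg_distrib, cast_delta, ite_mul, one_mul, zero_mul,
        Finset.sum_ite_eq, Finset.mem_range, hl, if_true]
    rw [e1, e2, e3, h1]
    push_cast
    field_simp
    ring

omit hw in
/-- The quadratic relations between the weights. -/
theorem relation_sound :
    ∀ r ∈ relations n S P, ∀ a b, r = [a, b] → a.2.2 ∈ P ∧ b.2.2 ∈ P ∧
      hasTri S a.2.1.1 a.2.1.2.1 a.2.1.2.2 = true ∧ hasTri S b.2.1.1 b.2.1.2.1 b.2.1.2.2 = true ∧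
      d.pairWeight a.2.2 / (2 * d.D.trace) * (d.triWeight a.2.1 / (2 * d.D.trace)) =
      d.pairWeight b.2.2 / (2 * d.D.trace) * (d.triWeight b.2.1 / (2 * d.D.trace)) := by
  rintro r hr a b rfl
  obtain ⟨hsum, i, j, l, e⟩ := exists_of_mem_relations hS hr
  have ha : a ∈ leibnizTerms n S P i j l := by rw [← e]; simp
  have hb : b ∈ leibnizTerms n S P i j l := by rw [← e]; simp
  obtain ⟨h1, h2⟩ := mem_of_mem_leibnizTerms ha
  obtain ⟨h3, h4⟩ := mem_of_mem_leibnizTerms hb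
  have e1 := sign_of_mem_leibnizTerms d.eps_mul_self ha
  have e2 := sign_of_mem_leibnizTerms d.eps_mul_self hb
  refine ⟨h2, h4, h1, h3, ?_⟩
  have hsq : ∀ r : Bool × Tri × (ℕ × ℕ), termReal d.coeff d.entry r ^ 2 =
      (d.coeff r.2.1.1 r.2.1.2.1 r.2.1.2.2 * d.entry r.2.2.1 r.2.2.2) ^ 2 := fun r => by
    unfold termReal
    cases r.1 <;> simp
  have e3 : termReal d.coeff d.entry a ^ 2 = termReal d.coeff d.entry b ^ 2 := by
    simp only [List.map_cons, List.map_nil, List.sum_cons, List.sum_nil, add_zero] at hsum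
    rw [eq_neg_of_add_eq_zero_left hsum, neg_sq]
  rw [hsq, hsq] at e3
  -- Two terms with zero sum have equal squares. Both carry the same product of signs ε_i ε_j ε_l,
  -- and multiplying by it turns the squares into products of weights.
  have e4 : d.pairWeight a.2.2 * d.triWeight a.2.1 = d.pairWeight b.2.2 * d.triWeight b.2.1 := by
    simp only [pairWeight, triWeight]
    rw [mul_pow, mul_pow] at e3
    linear_combination (d.eps i * d.eps j * d.eps l) * e3 +
      d.coeff a.2.1.1 a.2.1.2.1 a.2.1.2.2 ^ 2 * d.entry a.2.2.1 a.2.2.2 ^ 2 * e1 -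
      d.coeff b.2.1.1 b.2.1.2.1 b.2.1.2.2 ^ 2 * d.entry b.2.2.1 b.2.2.2 ^ 2 * e2
  rw [div_mul_div_comm, div_mul_div_comm, e4]

end Datum

end NiceNil

/-! ### Recovering a solution from its signed squares -/

namespace NiceNil

namespace Datum

variable {n : ℕ} {d : Datum n}

/-- The signed squares of the structure constants and of the off-diagonal entries, and the
diagonal entries, are those of the profile. -/
structure Encodes (d : Datum n) (q : Profile) : Prop where
  br : ∀ b ∈ q.br, ssq (d.coeff b.1.1 b.1.2.1 b.1.2.2) = b.2
  off : ∀ a ∈ q.off, ssq (d.entry a.1.1 a.1.2) = a.2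
  diag : ∀ i : Fin n, d.D i i = q.diag.getD i 0
  support : IsSupport d.coeff d.entry q.S q.P

theorem mem_signLists {n : ℕ} {s : List ℚ} (hs : s ∈ signLists n) {i : ℕ} (hi : i < n) :
    s.getD i 0 = 1 ∨ s.getD i 0 = -1 := by
  induction n generalizing s i with
  | zero => omega
  | succ n ih =>
    simp only [signLists, List.mem_flatMap, List.mem_cons, List.not_mem_nil, or_false] at hs
    obtain ⟨c, hc, rfl | rfl⟩ := hs <;> cases i with
    | zero => simp
    | succ i => simpa using ih hc (by omega : i < n)

theorem exists_mem_signLists (n : ℕ) (f : ℕ → ℝ) (hf : ∀ i, f i = 1 ∨ f i = -1) :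
    ∃ s ∈ signLists n, ∀ i < n, ((s.getD i 0 : ℚ) : ℝ) = f i := by
  induction n generalizing f with
  | zero => exact ⟨[], by simp [signLists], fun i hi => absurd hi (by omega)⟩
  | succ n ih =>
    obtain ⟨s, hs, h⟩ := ih (fun i => f (i + 1)) fun i => hf _
    rcases hf 0 with h0 | h0
    · refine ⟨1 :: s, List.mem_flatMap.2 ⟨s, hs, by simp⟩, fun i hi => ?_⟩
      cases i with
      | zero => simp [h0]
      | succ i => simpa using h i (by omega)
    · refine ⟨(-1) :: s, List.mem_flatMap.2 ⟨s, hs, by simp⟩, fun i hi => ?_⟩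
      cases i with
      | zero => simp [h0]
      | succ i => simpa using h i (by omega)

theorem exists_mem_signChoices {α : Type} (l : List (α × ℚ)) (f : α → ℝ)
    (h : ∀ x ∈ l, f x.1 = x.2 ∨ f x.1 = -x.2) :
    ∃ l' ∈ signChoices l, (∀ x ∈ l', f x.1 = x.2) ∧ l'.map Prod.fst = l.map Prod.fst := by
  induction l with
  | nil => exact ⟨[], by simp [signChoices], by simp, rfl⟩
  | cons a l ih =>
    obtain ⟨l', hl', h1, h2⟩ := ih fun x hx => h x (List.mem_cons_of_mem _ hx)
    rcases h a List.mem_cons_self with ha | ha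
    · refine ⟨a :: l', List.mem_flatMap.2 ⟨l', hl', by simp⟩, fun x hx => ?_, by simp [h2]⟩
      rcases List.mem_cons.1 hx with rfl | hx
      · exact ha
      · exact h1 x hx
    · refine ⟨(a.1, -a.2) :: l', List.mem_flatMap.2 ⟨l', hl', by simp⟩, fun x hx => ?_,
        by simp [h2]⟩
      rcases List.mem_cons.1 hx with rfl | hx
      · rw [ha]; simp
      · exact h1 x hx

theorem zip_sound {α : Type} (K : α → ℝ) : ∀ (l : List α) (w : List ℚ),
    w.map (fun x : ℚ => (x : ℝ)) = l.map K →
      (∀ x ∈ l.zip w, (x.2 : ℝ) = K x.1) ∧ (l.zip w).map Prod.fst = l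
  | [], w, _ => by simp
  | a :: l, [], h => by simp at h
  | a :: l, b :: w, h => by
    simp only [List.map_cons, List.cons.injEq] at h
    obtain ⟨h1, h2⟩ := zip_sound K l w h.2
    refine ⟨fun x hx => ?_, by simp [h2]⟩
    rcases List.mem_cons.1 hx with rfl | hx
    · exact h.1
    · exact h1 x hx

theorem brValue_eq {br : List (Tri × ℚ)} (c : ℕ → ℕ → ℕ → ℝ) (hskew : ∀ i j k, c i j k = -c j i k)
    (hbr : ∀ b ∈ br, ssq (c b.1.1 b.1.2.1 b.1.2.2) = b.2) {i j k : ℕ}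
    (hs : c i j k ≠ 0 → hasTri (br.map Prod.fst) i j k = true) :
    ((brValue br i j k : ℚ) : ℝ) = ssq (c i j k) := by
  induction br with
  | nil =>
    have : c i j k = 0 := by
      by_contra h
      simpa [hasTri] using hs h
    simp [brValue, this]
  | cons b l ih =>
    obtain ⟨⟨u, v, w⟩, q⟩ := b
    have h1 := hbr _ List.mem_cons_self
    simp only at h1
    rw [brValue]
    cases hb : w.beq k && (u.beq i && v.beq j)
    · cases hb' : w.beq k && (u.beq j && v.beq i)
      · rw [cond_false, cond_false]
        refine ih (fun b hb => hbr b (List.mem_cons_of_mem _ hb)) fun h => ?_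
        have := hs h
        rw [List.map_cons, hasTri, List.any_cons] at this
        simp only [Bool.and_or_distrib_left, hb, hb', Bool.or_false, Bool.false_or] at this
        simp only [hasTri, Bool.and_or_distrib_left]
        exact this
      · simp only [Bool.and_eq_true, Nat.beq_eq] at hb'
        obtain ⟨rfl, rfl, rfl⟩ := hb'
        rw [cond_false, cond_true, hskew v u w, ssq_neg, h1]
        simp
    · simp only [Bool.and_eq_true, Nat.beq_eq] at hb
      obtain ⟨rfl, rfl, rfl⟩ := hb
      rw [cond_true, h1]

theorem offValue_eq {off : List ((ℕ × ℕ) × ℚ)} (m : ℕ → ℕ → ℝ)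
    (hoff : ∀ a ∈ off, ssq (m a.1.1 a.1.2) = a.2) {i j : ℕ}
    (hs : m i j ≠ 0 → hasPair (off.map Prod.fst) i j = true) :
    ((offValue off i j : ℚ) : ℝ) = ssq (m i j) := by
  induction off with
  | nil =>
    have : m i j = 0 := by
      by_contra h
      simpa [hasPair] using hs h
    simp [offValue, this]
  | cons a l ih =>
    obtain ⟨⟨u, v⟩, q⟩ := a
    have h1 := hoff _ List.mem_cons_self
    simp only at h1
    rw [offValue]
    cases hb : u.beq i && v.beq j
    · rw [cond_false]
      refine ih (fun b hb => hoff b (List.mem_cons_of_mem _ hb)) fun h => ?_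
      have := hs h
      rw [List.map_cons, hasPair, List.any_cons] at this
      simp only [hb, Bool.false_or] at this
      simpa only [hasPair] using this
    · simp only [Bool.and_eq_true, Nat.beq_eq] at hb
      obtain ⟨rfl, rfl⟩ := hb
      rw [cond_true, h1]

/-- Being monomial, a term of a derivation identity has a rational signed square, so a two-term
identity can be checked over ℚ. -/
theorem ssq_termReal {br : List (Tri × ℚ)} {off : List ((ℕ × ℕ) × ℚ)} {c : ℕ → ℕ → ℕ → ℝ}
    {m : ℕ → ℕ → ℝ} (hbr : ∀ i j k, ((brValue br i j k : ℚ) : ℝ) = ssq (c i j k))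
    {r : Bool × Tri × (ℕ × ℕ)}
    (hoff : ((offValue off r.2.2.1 r.2.2.2 : ℚ) : ℝ) = ssq (m r.2.2.1 r.2.2.2)) :
    ((termValue br off r : ℚ) : ℝ) = ssq (termReal c m r) := by
  unfold termValue termReal
  rw [ssq_mul, ssq_mul, ← hbr, ← hoff]
  cases r.1
  · simp [ssq_neg]
  · simp

/-- A matching of profiles is an equivalence of the encoded data. -/
theorem Encodes.equivalent {d' : Datum n} {q q' : Profile} (hq : d.Encodes q) (hq' : d'.Encodes q')
    (hn : q.size = n) {p : List ℕ} (hp : p ∈ (List.range n).permutations') {s : List ℚ}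
    (hs : s ∈ signLists n) (hdiag : diagMatch q q' p = true)
    (hsupp : supportMatch q.S q.P q'.S q'.P p = true) (hsign : signMatch q q' p s = true)
    (heps : ∀ i : Fin n, d'.eps (p.getD i 0) = d.eps i) : d.Equivalent d' := by
  obtain ⟨π, hπ⟩ := exists_perm_of_mem hp
  simp only [supportMatch, Bool.and_eq_true, List.all_eq_true, List.any_eq_true] at hsupp
  obtain ⟨⟨⟨m1, m2⟩, m3⟩, m4⟩ := hsupp
  simp only [signMatch, Bool.and_eq_true, List.all_eq_true, List.any_eq_true] at hsign
  obtain ⟨s1, s2⟩ := hsign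
  let r : Fin n → ℝ := fun i => ((s.getD i 0 : ℚ) : ℝ)
  have hr : ∀ i, r i = 1 ∨ r i = -1 := fun i => by
    rcases mem_signLists hs i.2 with h | h <;> simp only [r, h] <;> norm_num
  have hkey : ∀ i j k : Fin n, hasTri q.S i j k = true →
      d'.L.c (π i) (π j) (π k) = r i * r j * r k * d.L.c i j k := by
    have key : ∀ i j k : Fin n, ((i : ℕ), (j : ℕ), (k : ℕ)) ∈ q.S →
        d'.L.c (π i) (π j) (π k) = r i * r j * r k * d.L.c i j k := by
      intro i j k h
      obtain ⟨b, hb, e⟩ := List.mem_map.1 h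
      obtain ⟨b', hb', hm⟩ := s1 b hb
      have h1 := hq.br b hb
      have h2 := hq'.br b' hb'
      obtain ⟨⟨u, v, w⟩, z⟩ := b
      obtain ⟨⟨u', v', w'⟩, z'⟩ := b'
      obtain ⟨rfl, rfl, rfl⟩ := by simpa only [Prod.mk.injEq] using e
      simp only [brMatch, hπ, Bool.and_eq_true, Bool.or_eq_true, Nat.beq_eq, beq_iff_eq] at hm
      simp only [coeff_val] at h1
      -- The two structure constants are compared through their signed squares, on which the scaling
      -- signs act by themselves because each is its own signed square.
      refine ssq_injective ?_
      rw [ssq_mul, ssq_mul, ssq_mul, ssq_sign (hr _), ssq_sign (hr _), ssq_sign (hr _), h1]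
      obtain ⟨rfl, ⟨⟨rfl, rfl⟩, hz⟩ | ⟨⟨rfl, rfl⟩, hz⟩⟩ := hm
      · simp only [coeff_val] at h2
        rw [h2, hz]
        simp only [r]
        push_cast
        ring
      · simp only [coeff_val] at h2
        rw [d'.L.skew, ssq_neg, h2, hz]
        simp only [r]
        push_cast
        ring
    intro i j k h
    rcases hasTri_iff.1 h with h | h
    · exact key _ _ _ h
    · rw [d'.L.skew, d.L.skew, key _ _ _ h]; ring
  refine (⟨hr, fun i j k => ?_, fun i j => ?_, fun i => ?_⟩ :
    IsSignedPermutation d d' π r).equivalent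
  · by_cases hc : d.L.c i j k = 0
    · rw [hc, mul_zero]
      by_contra hc'
      rw [← coeff_val] at hc'
      replace hc' := (hq'.support.tri _ _ _).1 hc'
      have key : ∀ u v : Fin n, ((π u : ℕ), (π v : ℕ), (π k : ℕ)) ∈ q'.S → d.L.c u v k ≠ 0 := by
        intro u v h
        obtain ⟨t, ht, hm⟩ := m4 _ h
        have h0 : d.coeff t.1 t.2.1 t.2.2 ≠ 0 :=
          (hq.support.tri _ _ _).2 (hasTri_iff.2 (Or.inl ht))
        obtain ⟨a, b, c⟩ := t
        obtain ⟨h1, h2, h3⟩ := d.lt_of_coeff h0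
        simp only at h1 h2 h3 h0
        lift a to Fin n using h1
        lift b to Fin n using h2
        lift c to Fin n using h3
        rw [coeff_val] at h0
        simp only [beq_or_iff, hπ, Fin.val_inj, π.injective.eq_iff] at hm
        obtain ⟨rfl, ⟨rfl, rfl⟩ | ⟨rfl, rfl⟩⟩ := hm
        · exact h0
        · rw [d.L.skew, neg_ne_zero]; exact h0
      rcases hasTri_iff.1 hc' with h | h
      · exact key _ _ h hc
      · exact key _ _ h (by rw [d.L.skew, hc, neg_zero])
    · exact hkey i j k ((hq.support.tri _ _ _).1 (by rwa [coeff_val]))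
  · by_cases hij : i = j
    · subst hij
      rw [hq.diag, hq'.diag, ← hπ]
      simp only [diagMatch, List.all_eq_true, List.mem_range, beq_iff_eq] at hdiag
      rw [← hdiag i (by rw [hn]; exact i.2)]
      rcases hr i with h | h <;> rw [h] <;> ring
    · have hij' : (i : ℕ) ≠ j := fun e => hij (Fin.ext e)
      have hπij : ((π i : Fin n) : ℕ) ≠ π j := fun e => hij (π.injective (Fin.ext e))
      by_cases hc : d.D j i = 0
      · rw [hc, mul_zero]
        by_contra hc'
        rw [← entry_val] at hc'
        replace hc' := hasPair_iff.1 ((hq'.support.pair _ _ hπij).1 hc')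
        obtain ⟨⟨a, b⟩, ha, hm⟩ := m2 _ hc'
        have hab : a ≠ b := fun e => by
          have := hq.support.irrefl a
          rw [← Bool.not_eq_true, hasPair_iff] at this
          exact this (by rw [← e] at ha; exact ha)
        have h0 := (hq.support.pair a b hab).2 (hasPair_iff.2 ha)
        obtain ⟨h1, h2⟩ := d.lt_of_entry h0
        lift a to Fin n using h1
        lift b to Fin n using h2
        rw [entry_val] at h0
        simp only [pairMatch_iff, hπ, Fin.val_inj, π.injective.eq_iff] at hm
        rw [← hm.1, ← hm.2] at h0
        exact h0 hc
      · have h := (hq.support.pair _ _ hij').1 (by rwa [entry_val])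
        obtain ⟨b, hb, e⟩ := List.mem_map.1 (hasPair_iff.1 h)
        obtain ⟨b', hb', hm⟩ := s2 b hb
        have h1 := hq.off b hb
        have h2 := hq'.off b' hb'
        obtain ⟨⟨u, v⟩, z⟩ := b
        obtain ⟨⟨u', v'⟩, z'⟩ := b'
        obtain ⟨rfl, rfl⟩ := by simpa only [Prod.mk.injEq] using e
        simp only [offMatch, pairMatch_iff, hπ, Bool.and_eq_true, beq_iff_eq] at hm
        obtain ⟨⟨rfl, rfl⟩, hz⟩ := hm
        simp only [entry_val] at h1 h2
        refine ssq_injective ?_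
        rw [ssq_mul, ssq_mul, ssq_sign (hr _), ssq_sign (hr _), h1, h2, hz]
        simp only [r]
        push_cast
        ring
  · have := heps i
    rw [hπ, eps_val, eps_val] at this
    simp only [sgn, Int.cast_inj] at this
    exact Units.ext this

/-- The outcome of the elimination and of the choices of signs. -/
theorem completeRow_sound {rr : List RatRow} {S : List Tri} {P : List (ℕ × ℕ)}
    (H : d.NondiagonalEquations) (hS : IsSupport d.coeff d.entry S P) (hw : WellFormed S P)
    (hc : completeRow rr n S P = true) :
    ∃ q' ∈ rr, q'.size = n ∧ ∃ σ ∈ q'.sigs, ∃ q : Profile, q.size = n ∧ d.Encodes q ∧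
      ∃ p ∈ (List.range n).permutations', ∃ s ∈ signLists n, diagMatch q q'.toProfile p = true ∧
        supportMatch q.S q.P q'.S q'.P p = true ∧ signMatch q q'.toProfile p s = true ∧
        ∀ i : Fin n, ((epsOf σ (p.getD i 0) : ℚ) : ℝ) = d.eps i := by
  have hT := H.trace_ne_zero
  unfold completeRow at hc
  split at hc
  · cases hc
  rename_i v hv
  have hsol := solveCase_sound (fun i j k => by rw [triWeight_symm]) (linearSystem_sound hS hw H) (relation_sound hS) hv
  set diag := v.take n with hdiag
  set T := diag.sum with hTdef
  set b := P.zip (((v.drop n).take P.length).map (2 * T * ·)) with hb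
  set X := S.zip ((v.drop (n + P.length)).map (2 * T * ·)) with hX
  have hd1 : diag.map (fun x : ℚ => (x : ℝ)) = (List.range n).map fun l => d.entry l l := by
    rw [hdiag, List.map_take, hsol, List.take_left' (by simp)]
  have hd2 : ((v.drop n).take P.length).map (fun x : ℚ => (x : ℝ)) =
      P.map fun p => d.pairWeight p / (2 * d.D.trace) := by
    rw [List.map_take, List.map_drop, hsol, List.drop_left' (by simp), List.take_left' (by simp)]
  have hd3 : (v.drop (n + P.length)).map (fun x : ℚ => (x : ℝ)) =
      S.map fun t => d.triWeight t / (2 * d.D.trace) := by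
    rw [List.map_drop, hsol, ← List.append_assoc, List.drop_left' (by simp)]
  have hTr : (T : ℝ) = d.D.trace := by
    -- The rational trace computed from the elimination is the actual one, so multiplication by 2T
    -- undoes the normalization of the weights.
    rw [trace_eq_sum, ← sum_map_range, ← hd1, hTdef]
    exact map_list_sum (Rat.castHom ℝ) diag
  have hb' : ∀ w : List ℚ, ∀ (α : Type) (l : List α) (f : α → ℝ),
      w.map (fun x : ℚ => (x : ℝ)) = l.map (fun p => f p / (2 * d.D.trace)) →
      (w.map (2 * T * ·)).map (fun x : ℚ => (x : ℝ)) = l.map f := by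
    intro w α l f h
    have : (w.map (2 * T * ·)).map (fun x : ℚ => (x : ℝ)) =
        (w.map (fun x : ℚ => (x : ℝ))).map (2 * d.D.trace * ·) := by
      rw [List.map_map, List.map_map]
      refine List.map_congr_left fun x _ => ?_
      simp [hTr]
    rw [this, h, List.map_map]
    refine List.map_congr_left fun x _ => ?_
    simp only [Function.comp_apply]
    field_simp
  obtain ⟨hb1, hb2⟩ := zip_sound d.pairWeight P _ (hb' _ _ P d.pairWeight hd2)
  obtain ⟨hX1, hX2⟩ := zip_sound d.triWeight S _ (hb' _ _ S d.triWeight hd3)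
  rw [← hb] at hb1 hb2
  rw [← hX] at hX1 hX2
  have hne : ∀ p ∈ P, p.1 ≠ p.2 := fun p hp e => by
    have := hS.irrefl p.1
    rw [← Bool.not_eq_true, hasPair_iff] at this
    exact this (by rw [show (p.1, p.1) = p from Prod.ext rfl e]; exact hp)
  have hP0 : ∀ p ∈ P, d.entry p.1 p.2 ≠ 0 := fun p hp =>
    (hS.pair _ _ (hne p hp)).2 (hasPair_iff.2 hp)
  have hS0 : ∀ t ∈ S, d.coeff t.1 t.2.1 t.2.2 ≠ 0 := fun t ht =>
    (hS.tri _ _ _).2 (hasTri_iff.2 (Or.inl ht))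
  have hbP : ∀ x ∈ b, x.1 ∈ P := fun x hx => by
    rw [← hb2]; exact List.mem_map_of_mem hx
  have hXS : ∀ x ∈ X, x.1 ∈ S := fun x hx => by
    rw [← hX2]; exact List.mem_map_of_mem hx
  have hbe : ∀ p : ℕ × ℕ, p.1 ≠ p.2 → d.eps p.1 * d.eps p.2 = 1 ∨ d.eps p.1 * d.eps p.2 = -1 :=
    fun p _ => mul_sign (d.eps_eq _) (d.eps_eq _)
  -- A signed square is plus or minus the corresponding weight, so the actual brackets occur among
  -- the enumerated choices.
  obtain ⟨br, hbr, hbr1, hbr2⟩ := exists_mem_signChoices X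
    (fun t => ssq (d.coeff t.1 t.2.1 t.2.2)) fun x hx => by
      rw [hX1 x hx, triWeight, ← abs_ssq]
      rcases mul_sign (mul_sign (d.eps_eq x.1.1) (d.eps_eq x.1.2.1)) (d.eps_eq x.1.2.2) with h | h <;>
        rcases abs_choice (ssq (d.coeff x.1.1 x.1.2.1 x.1.2.2)) with h' | h' <;> rw [h, h'] <;> simp
  obtain ⟨off, hoff, hoff1, hoff2⟩ := exists_mem_signChoices b
    (fun p => ssq (d.entry p.1 p.2)) fun x hx => by
      rw [hb1 x hx, pairWeight, ← abs_ssq]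
      rcases mul_sign (d.eps_eq x.1.1) (d.eps_eq x.1.2) with h | h <;>
        rcases abs_choice (ssq (d.entry x.1.1 x.1.2)) with h' | h' <;> rw [h, h'] <;> simp
  rw [hX2] at hbr2
  rw [hb2] at hoff2
  have hbrv : ∀ i j k, ((brValue br i j k : ℚ) : ℝ) = ssq (d.coeff i j k) := fun i j k =>
    brValue_eq d.coeff d.coeff_skew hbr1 fun h => by rw [hbr2]; exact (hS.tri _ _ _).1 h
  have hoffv : ∀ i j, i ≠ j → ((offValue off i j : ℚ) : ℝ) = ssq (d.entry i j) := fun i j hij =>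
    offValue_eq d.entry hoff1 fun h => by rw [hoff2]; exact (hS.pair _ _ hij).1 h
  obtain ⟨e, he, he1⟩ := exists_mem_signLists n d.eps d.eps_eq
  have hlen : diag.length = n := by
    have := congrArg List.length hd1
    simpa using this
  simp only [Bool.or_eq_true, beq_iff_eq, List.any_eq_true, List.all_eq_true, Bool.not_eq_true',
    Bool.and_eq_true, List.mem_filter, List.mem_flatMap, List.mem_map, List.mem_range] at hc
  rcases hc with ((hc | ⟨x, hx, hc⟩) | ⟨x, hx, hc⟩) | hc
  · exact absurd (by rw [← hTr, hTdef, hc, Rat.cast_zero]) hT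
  · have h1 := hb1 x hx
    rw [hc, pairWeight, Rat.cast_zero] at h1
    have h0 := pow_ne_zero 2 (hP0 _ (hbP x hx))
    rcases hbe x.1 (hne _ (hbP x hx)) with h | h <;> rw [h] at h1 <;>
      exact absurd (by linarith) h0
  · have h1 := hX1 x hx
    rw [hc, triWeight, Rat.cast_zero] at h1
    have h0 := pow_ne_zero 2 (hS0 _ (hXS x hx))
    rcases mul_sign (mul_sign (d.eps_eq x.1.1) (d.eps_eq x.1.2.1)) (d.eps_eq x.1.2.2) with h | h <;>
      rw [h] at h1 <;> exact absurd (by linarith) h0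
  · rcases hc br hbr off hoff with hc | hc
    -- The actual signed squares satisfy all two-term derivation identities, so this choice was not
    -- discarded.
    · exfalso
      rw [← Bool.not_eq_true, List.all_eq_true] at hc
      refine hc fun r hr => ?_
      rw [relationOK, Bool.or_eq_true, Bool.not_eq_true']
      by_cases hl : r.length.beq 2 = true
      · right
        rw [Nat.beq_eq] at hl
        obtain ⟨x, y, rfl⟩ := List.length_eq_two.1 hl
        obtain ⟨hsum, i, j, l, e⟩ := exists_of_mem_relations hS hr
        have hterm : ∀ z ∈ leibnizTerms n S P i j l,
            ((termValue br off z : ℚ) : ℝ) = ssq (termReal d.coeff d.entry z) := fun z hz =>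
          ssq_termReal hbrv (hoffv _ _ (hne _ (mem_of_mem_leibnizTerms hz).2))
        have hx := hterm x (by rw [← e]; simp)
        have hy := hterm y (by rw [← e]; simp)
        simp only [List.map_cons, List.map_nil, List.sum_cons, List.sum_nil, add_zero] at hsum ⊢
        rw [beq_iff_eq]
        have : ((termValue br off x + termValue br off y : ℚ) : ℝ) = 0 := by
          push_cast
          rw [hx, hy, eq_neg_of_add_eq_zero_left hsum, ssq_neg]
          ring
        exact_mod_cast this
      · left
        rwa [Bool.not_eq_true] at hl
    · have heps : epsValid X b e = true := by
        have hlt : ∀ i < n, ((e.getD i 0 : ℚ) : ℝ) = d.eps i := he1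
        simp only [epsValid, Bool.and_eq_true, List.all_eq_true, decide_eq_true_eq]
        constructor
        · intro x hx
          obtain ⟨h1, h2, h3⟩ := d.lt_of_coeff (hS0 _ (hXS x hx))
          have : (0 : ℝ) < ((x.2 * e.getD x.1.1 0 * e.getD x.1.2.1 0 * e.getD x.1.2.2 0 : ℚ) : ℝ) := by
            push_cast
            rw [hlt _ h1, hlt _ h2, hlt _ h3, hX1 x hx, triWeight]
            have h0 := pow_pos (abs_pos.2 (hS0 _ (hXS x hx))) 2
            rw [sq_abs] at h0
            have h4 : ∀ a b c z : ℝ, a * b * c * z * a * b * c = (a * b * c) * (a * b * c) * z :=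
              fun _ _ _ _ => by ring
            rw [h4]
            rcases mul_sign (mul_sign (d.eps_eq x.1.1) (d.eps_eq x.1.2.1)) (d.eps_eq x.1.2.2)
              with h | h <;> rw [h] <;> linarith
          exact_mod_cast this
        · intro x hx
          obtain ⟨h1, h2⟩ := d.lt_of_entry (hP0 _ (hbP x hx))
          have : (0 : ℝ) < ((x.2 * e.getD x.1.1 0 * e.getD x.1.2 0 : ℚ) : ℝ) := by
            push_cast
            rw [hlt _ h1, hlt _ h2, hb1 x hx, pairWeight]
            have h0 := pow_pos (abs_pos.2 (hP0 _ (hbP x hx))) 2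
            rw [sq_abs] at h0
            have h3 : ∀ a b z : ℝ, a * b * z * a * b = (a * b) * (a * b) * z :=
              fun _ _ _ => by ring
            rw [h3]
            rcases mul_sign (d.eps_eq x.1.1) (d.eps_eq x.1.2) with h | h <;> rw [h] <;> linarith
          exact_mod_cast this
      obtain ⟨⟨q', p⟩, ⟨⟨q'', ⟨hq'', hcmp⟩, p', ⟨hp', hdm, hsm⟩, heq⟩, s, hs, hsgn⟩, σ, hσ, hσe⟩ :=
        hc e ⟨he, heps⟩
      obtain ⟨rfl, rfl⟩ := Prod.mk.inj heq
      refine ⟨q'', hq'', ?_, σ, hσ, ⟨n, br, diag, off⟩, rfl, ⟨hbr1, hoff1, fun i => ?_, ?_⟩, p', hp', s,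
        hs, hdm, ?_, hsgn, fun i => ?_⟩
      · simp only [diagComparable, Bool.and_eq_true, Nat.beq_eq] at hcmp
        exact hcmp.1.symm
      · have h1 : (diag.map (fun x : ℚ => (x : ℝ))).getD i 0 = d.entry i i := by
          rw [hd1, List.getD_eq_getElem _ _ (by simp)]
          simp
        rw [← entry_val, ← h1, List.getD_eq_getElem _ _ (by simp [hlen]),
          List.getD_eq_getElem _ _ (by simp [hlen])]
        simp
      · simp only [Profile.S, Profile.P, hbr2, hoff2]
        exact hS
      · simp only [Profile.S, Profile.P, hbr2, hoff2]
        exact hsm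
      · rw [← hσe i i.2, he1 i i.2]

end Datum

end NiceNil

/-! ### Consistency and balance of the tabulated profiles -/

namespace NiceNil

/-- The real square root with sign. -/
def ssqrt (x : ℝ) : ℝ := SignType.sign x * √|x|

theorem ssq_ssqrt (x : ℝ) : ssq (ssqrt x) = x := by
  rcases lt_trichotomy x 0 with h | rfl | h
  · rw [ssqrt, sign_neg h]
    simp only [SignType.coe_neg_one, neg_mul, one_mul]
    rw [ssq_neg, ssq_of_nonneg (Real.sqrt_nonneg _), Real.sq_sqrt (abs_nonneg _), abs_of_neg h,
      neg_neg]
  · simp [ssqrt, ssq_zero]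
  · rw [ssqrt, sign_pos h]
    simp only [SignType.coe_one, one_mul]
    rw [ssq_of_nonneg (Real.sqrt_nonneg _), Real.sq_sqrt (abs_nonneg _), abs_of_pos h]

theorem brValue_of_mem {br : List (Tri × ℚ)} (hnd : (br.map Prod.fst).Nodup)
    (hlt : ∀ t ∈ br.map Prod.fst, t.1 < t.2.1) {b : Tri × ℚ} (hb : b ∈ br) :
    brValue br b.1.1 b.1.2.1 b.1.2.2 = b.2 := by
  induction br with
  | nil => cases hb
  | cons a l ih =>
    rw [List.map_cons, List.nodup_cons] at hnd
    rw [brValue]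
    rcases List.mem_cons.1 hb with rfl | hb'
    · simp
    · have h1 : a.1 ≠ b.1 := fun e => hnd.1 (e ▸ List.mem_map_of_mem hb')
      have h2 := hlt a.1 (by simp)
      have h3 := hlt b.1 (List.mem_map_of_mem hb)
      have e1 : (a.1.2.2.beq b.1.2.2 && (a.1.1.beq b.1.1 && a.1.2.1.beq b.1.2.1)) = false := by
        rw [← Bool.not_eq_true]
        simp only [Bool.and_eq_true, Nat.beq_eq]
        rintro ⟨u, v, w⟩
        exact h1 (Prod.ext v (Prod.ext w u))
      have e2 : (a.1.2.2.beq b.1.2.2 && (a.1.1.beq b.1.2.1 && a.1.2.1.beq b.1.1)) = false := by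
        rw [← Bool.not_eq_true]
        simp only [Bool.and_eq_true, Nat.beq_eq]
        rintro ⟨u, v, w⟩
        omega
      rw [e1, e2, cond_false, cond_false]
      exact ih hnd.2 (fun t ht => hlt t (List.mem_cons_of_mem _ ht)) hb'

theorem brValue_ne_zero_iff {br : List (Tri × ℚ)} (h0 : ∀ b ∈ br, b.2 ≠ 0) (i j k : ℕ) :
    brValue br i j k ≠ 0 ↔ hasTri (br.map Prod.fst) i j k = true := by
  induction br with
  | nil => simp [brValue, hasTri]
  | cons a l ih =>
    have h1 := h0 a List.mem_cons_self
    have ih' := ih fun b hb => h0 b (List.mem_cons_of_mem _ hb)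
    simp only [hasTri] at ih' ⊢
    rw [brValue, List.map_cons, List.any_cons, Bool.and_or_distrib_left]
    cases a.1.2.2.beq k && (a.1.1.beq i && a.1.2.1.beq j) <;>
      cases a.1.2.2.beq k && (a.1.1.beq j && a.1.2.1.beq i) <;>
      simp only [cond_true, cond_false, Bool.or_true, Bool.true_or, Bool.false_or, h1, ne_eq,
        neg_eq_zero, not_false_eq_true, ← ih']

theorem brValue_skew {br : List (Tri × ℚ)} (hlt : ∀ t ∈ br.map Prod.fst, t.1 < t.2.1) (i j k : ℕ) :
    brValue br i j k = -brValue br j i k := by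
  induction br with
  | nil => simp [brValue]
  | cons a l ih =>
    have h1 := hlt a.1 (by simp)
    have ih' := ih fun t ht => hlt t (List.mem_cons_of_mem _ ht)
    rw [brValue, brValue]
    cases e1 : a.1.2.2.beq k && (a.1.1.beq i && a.1.2.1.beq j) <;>
      cases e2 : a.1.2.2.beq k && (a.1.1.beq j && a.1.2.1.beq i)
    · simpa using ih'
    · simp
    · simp
    · simp only [Bool.and_eq_true, Nat.beq_eq] at e1 e2
      omega

theorem offValue_of_mem {off : List ((ℕ × ℕ) × ℚ)} (hnd : (off.map Prod.fst).Nodup)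
    {a : (ℕ × ℕ) × ℚ} (ha : a ∈ off) : offValue off a.1.1 a.1.2 = a.2 := by
  induction off with
  | nil => cases ha
  | cons b l ih =>
    rw [List.map_cons, List.nodup_cons] at hnd
    rw [offValue]
    rcases List.mem_cons.1 ha with rfl | ha'
    · simp
    · have h1 : b.1 ≠ a.1 := fun e => hnd.1 (e ▸ List.mem_map_of_mem ha')
      have e1 : (b.1.1.beq a.1.1 && b.1.2.beq a.1.2) = false := by
        rw [← Bool.not_eq_true]
        simp only [Bool.and_eq_true, Nat.beq_eq]
        rintro ⟨u, v⟩
        exact h1 (Prod.ext u v)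
      rw [e1, cond_false]
      exact ih hnd.2 ha'

theorem offValue_ne_zero_iff {off : List ((ℕ × ℕ) × ℚ)} (h0 : ∀ a ∈ off, a.2 ≠ 0) (i j : ℕ) :
    offValue off i j ≠ 0 ↔ hasPair (off.map Prod.fst) i j = true := by
  induction off with
  | nil => simp [offValue, hasPair]
  | cons a l ih =>
    have h1 := h0 a List.mem_cons_self
    have ih' := ih fun b hb => h0 b (List.mem_cons_of_mem _ hb)
    simp only [hasPair] at ih' ⊢
    rw [offValue, List.map_cons, List.any_cons]
    cases a.1.1.beq i && a.1.2.beq j <;>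
      simp only [cond_true, cond_false, Bool.true_or, Bool.false_or, h1, ne_eq, not_false_eq_true,
        ← ih']

/-- The vanishing sum of the terms of the derivation property at three nodes. -/
def Profile.leibnizAt (q : Profile) (i j l : ℕ) : Bool :=
  match leibnizTerms q.size q.S q.P i j l with
  | [] => true
  | [x, y] => termValue q.br q.off x + termValue q.br q.off y == 0
  | _ => false

/-- The conditions on a profile, apart from those on the metric, that make it a solution. -/
structure Profile.Consistent (q : Profile) : Prop where
  wellFormed : WellFormed q.S q.P
  nonempty : q.P ≠ []
  br_ne_zero : ∀ b ∈ q.br, b.2 ≠ 0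
  off_ne_zero : ∀ a ∈ q.off, a.2 ≠ 0
  length_diag : q.diag.length = q.size
  trace_ne_zero : q.diag.sum ≠ 0
  tri : ∀ t ∈ q.S, t.2.1 < t.2.2 ∧ t.2.2 < q.size ∧
    q.diag.getD t.2.2 0 = q.diag.getD t.1 0 + q.diag.getD t.2.1 0
  pair : ∀ p ∈ q.P, p.1 ≠ p.2 ∧ p.1 < q.size ∧ p.2 < q.size ∧
    q.diag.sum = q.diag.getD p.1 0 - q.diag.getD p.2 0
  no_chain : ∀ t ∈ q.S, ∀ u ∈ q.S, (u.1 = t.2.2 → u.2.1 = t.1 ∨ u.2.1 = t.2.1) ∧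
    (u.2.1 = t.2.2 → u.1 = t.1 ∨ u.1 = t.2.1)
  compatible : ∀ t ∈ q.S, ∀ u ∈ q.S, t ≠ u → compatible t u = true
  disjoint : ∀ p ∈ q.P, ∀ p' ∈ q.P, p ≠ p' → disjointPairs p p' = true
  no_arrow : ∀ p ∈ q.P, ∀ t ∈ q.S, (t.2.2 = p.2 → t.1 ≠ p.1 ∧ t.2.1 ≠ p.1) ∧
    (t.2.2 = p.1 → t.1 ≠ p.2 ∧ t.2.1 ≠ p.2)
  leibniz : ∀ i < q.size, ∀ j < q.size, ∀ l < q.size, q.leibnizAt i j l = true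

instance (q : Profile) : Decidable q.Consistent :=
  decidable_of_iff (WellFormed q.S q.P ∧ q.P ≠ [] ∧ (∀ b ∈ q.br, b.2 ≠ 0) ∧
    (∀ a ∈ q.off, a.2 ≠ 0) ∧ q.diag.length = q.size ∧ q.diag.sum ≠ 0 ∧
    (∀ t ∈ q.S, t.2.1 < t.2.2 ∧ t.2.2 < q.size ∧
      q.diag.getD t.2.2 0 = q.diag.getD t.1 0 + q.diag.getD t.2.1 0) ∧
    (∀ p ∈ q.P, p.1 ≠ p.2 ∧ p.1 < q.size ∧ p.2 < q.size ∧
      q.diag.sum = q.diag.getD p.1 0 - q.diag.getD p.2 0) ∧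
    (∀ t ∈ q.S, ∀ u ∈ q.S, (u.1 = t.2.2 → u.2.1 = t.1 ∨ u.2.1 = t.2.1) ∧
      (u.2.1 = t.2.2 → u.1 = t.1 ∨ u.1 = t.2.1)) ∧
    (∀ t ∈ q.S, ∀ u ∈ q.S, t ≠ u → NiceNil.compatible t u = true) ∧
    (∀ p ∈ q.P, ∀ p' ∈ q.P, p ≠ p' → disjointPairs p p' = true) ∧
    (∀ p ∈ q.P, ∀ t ∈ q.S, (t.2.2 = p.2 → t.1 ≠ p.1 ∧ t.2.1 ≠ p.1) ∧
      (t.2.2 = p.1 → t.1 ≠ p.2 ∧ t.2.1 ≠ p.2)) ∧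
    ∀ i < q.size, ∀ j < q.size, ∀ l < q.size, q.leibnizAt i j l = true)
    ⟨fun ⟨a, b, c, d, e, f, g, h, i, j, k, l, m⟩ => ⟨a, b, c, d, e, f, g, h, i, j, k, l, m⟩,
      fun ⟨a, b, c, d, e, f, g, h, i, j, k, l, m⟩ => ⟨a, b, c, d, e, f, g, h, i, j, k, l, m⟩⟩

/-- The weighted sums over the support balance, for the metric with the given timelike nodes. -/
def Profile.Balanced (q : Profile) (σ : List ℕ) : Prop :=
  ∀ l < q.size, (q.br.map fun b => rootCoeff l b.1 *
      (epsOf σ b.1.1 * epsOf σ b.1.2.1 * epsOf σ b.1.2.2 * |b.2|)).sum =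
    2 * q.diag.sum * (q.diag.getD l 0 - 1) -
      (q.off.map fun a => (1 - delta l a.1.1 + delta l a.1.2) *
        (epsOf σ a.1.1 * epsOf σ a.1.2 * |a.2|)).sum

instance (q : Profile) (σ : List ℕ) : Decidable (q.Balanced σ) :=
  inferInstanceAs (Decidable (∀ l < q.size, _))

/-- Rational arithmetic and finitely many index conditions, evaluated for each row. The conditions
on the metric are kept apart because one row carries several metrics. -/
theorem consistent_ratRows : ∀ q ∈ ratRows, q.Consistent := by
  decide +kernel

theorem balanced_ratRows : ∀ q ∈ ratRows, ∀ σ ∈ q.sigs, q.Balanced σ := by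
  decide +kernel

end NiceNil

/-! ### Realization of profiles by metric Lie algebras with a derivation -/

namespace NiceNil

/-- The signed squares of `c` and of the off-diagonal `m`, and the diagonal of `m`, are those of
the profile. -/
structure Profile.Represents (q : Profile) (c : ℕ → ℕ → ℕ → ℝ) (m : ℕ → ℕ → ℝ) : Prop where
  br : ∀ i j k, ssq (c i j k) = brValue q.br i j k
  off : ∀ i j, i ≠ j → ssq (m i j) = offValue q.off i j
  diag : ∀ i, m i i = q.diag.getD i 0

namespace Profile

variable {q : Profile} (hc : q.Consistent) {c : ℕ → ℕ → ℕ → ℝ} {m : ℕ → ℕ → ℝ}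
include hc

theorem Represents.isSupport (h : q.Represents c m) : IsSupport c m q.S q.P := by
  have htri : ∀ i j k, c i j k ≠ 0 ↔ hasTri q.S i j k = true := fun i j k => by
    rw [Profile.S, ← brValue_ne_zero_iff hc.br_ne_zero, ne_eq, ne_eq, ← ssq_eq_zero, h.br,
      Rat.cast_eq_zero]
  refine ⟨fun i j k => ?_, htri, fun i j hij => ?_, fun i => ?_, fun i j k hijk => ?_⟩
  · apply ssq_injective
    rw [ssq_neg, h.br, h.br, brValue_skew hc.wellFormed.2.2 i j k, Rat.cast_neg]
  · rw [Profile.P, ← offValue_ne_zero_iff hc.off_ne_zero, ne_eq, ne_eq, ← ssq_eq_zero, h.off i j hij,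
      Rat.cast_eq_zero]
  · rw [← Bool.not_eq_true, hasPair_iff]
    exact fun hi => (hc.pair _ hi).1 rfl
  · rw [h.diag, h.diag, h.diag]
    rcases hasTri_iff.1 ((htri _ _ _).1 hijk) with ht | ht
    · exact_mod_cast (hc.tri _ ht).2.2
    · rw [add_comm]
      exact_mod_cast (hc.tri _ ht).2.2

theorem lt_of_hasTri {i j k : ℕ} (h : hasTri q.S i j k = true) : i < k ∧ j < k ∧ k < q.size := by
  rcases hasTri_iff.1 h with ht | ht
  · have h1 := hc.wellFormed.2.2 _ ht
    have h2 := hc.tri _ ht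
    simp only at h1 h2
    omega
  · have h1 := hc.wellFormed.2.2 _ ht
    have h2 := hc.tri _ ht
    simp only at h1 h2
    omega

theorem chain {i j k h l : ℕ} (h1 : hasTri q.S i j h = true) (h2 : hasTri q.S h k l = true) :
    k = i ∨ k = j := by
  rcases hasTri_iff.1 h1 with ht | ht <;> rcases hasTri_iff.1 h2 with hu | hu
  · exact (hc.no_chain _ ht _ hu).1 rfl
  · exact (hc.no_chain _ ht _ hu).2 rfl
  · exact ((hc.no_chain _ ht _ hu).1 rfl).symm
  · exact ((hc.no_chain _ ht _ hu).2 rfl).symm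

/-- In the tabulated algebras [[e_i, e_j], e_k] vanishes for pairwise distinct i, j, k, so the
Jacobi identity there is trivial. If two of the indices agree it follows from skew-symmetry. -/
theorem Represents.jacobi (h : q.Represents c m) (i j k l h' : ℕ) :
    c i j h' * c h' k l + c j k h' * c h' i l + c k i h' * c h' j l = 0 := by
  have hS := h.isSupport hc
  have hz : ∀ i j k, k ≠ i → k ≠ j → c i j h' * c h' k l = 0 := fun i j k h1 h2 => by
    by_contra h3
    obtain ⟨h4, h5⟩ := mul_ne_zero_iff.1 h3
    rcases chain hc ((hS.tri _ _ _).1 h4) ((hS.tri _ _ _).1 h5) with e | e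
    · exact h1 e
    · exact h2 e
  have h0 : ∀ i k, c i i k = 0 := fun i k => self_eq_neg.1 (hS.skew i i k)
  by_cases h1 : i = j
  · subst h1
    rw [h0, hS.skew k i h']; ring
  by_cases h2 : j = k
  · subst h2
    rw [h0, hS.skew j i h']; ring
  by_cases h3 : i = k
  · subst h3
    rw [h0, hS.skew j i h']; ring
  · rw [hz i j k (Ne.symm h3) (Ne.symm h2), hz j k i h1 h3, hz k i j h2 (Ne.symm h1)]
    ring

/-- For a consistent profile each list of supported terms is empty or has two terms with opposite
signed squares; injectivity of the signed square makes the terms themselves opposite. -/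
theorem Represents.leibniz (h : q.Represents c m) {i j l : ℕ} (hi : i < q.size) (hj : j < q.size)
    (hl : l < q.size) :
    ∑ h ∈ Finset.range q.size, c i j h * m h l = ∑ h ∈ Finset.range q.size, m i h * c h j l +
      ∑ h ∈ Finset.range q.size, m j h * c i h l := by
  have hS := h.isSupport hc
  rw [← sub_eq_zero, ← hS.sum_leibnizTerms q.size hi hj hl]
  have h1 := hc.leibniz i hi j hj l hl
  have hterm : ∀ z ∈ leibnizTerms q.size q.S q.P i j l,
      ((termValue q.br q.off z : ℚ) : ℝ) = ssq (termReal c m z) := fun z hz =>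
    Datum.ssq_termReal (fun i j k => (h.br i j k).symm)
      (h.off _ _ (hc.pair _ (mem_of_mem_leibnizTerms hz).2).1).symm
  unfold leibnizAt at h1
  split at h1
  · rename_i e
    rw [e]; rfl
  · rename_i x y e
    have hx := hterm x (by rw [e]; simp)
    have hy := hterm y (by rw [e]; simp)
    rw [beq_iff_eq] at h1
    have h2 : ssq (termReal c m x) = ssq (-termReal c m y) := by
      rw [ssq_neg, ← hx, ← hy, eq_neg_of_add_eq_zero_left h1, Rat.cast_neg]
    rw [e]
    simp only [List.map_cons, List.map_nil, List.sum_cons, List.sum_nil, add_zero]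
    rw [ssq_injective h2]; ring
  · cases h1

-- Signed square roots realize any prescribed signed squares; the algebraic identities follow
-- afterwards from consistency.
omit hc in
theorem exists_represents (q : Profile) : ∃ c m, q.Represents c m :=
  ⟨fun i j k => ssqrt (brValue q.br i j k),
    fun i j => if i = j then (q.diag.getD i 0 : ℚ) else ssqrt (offValue q.off i j),
    fun i j k => ssq_ssqrt _, fun i j hij => by rw [if_neg hij, ssq_ssqrt], fun i => if_pos rfl⟩

theorem encodes_iff {n : ℕ} (hn : q.size = n) {d : Datum n} :
    d.Encodes q ↔ q.Represents d.coeff d.entry := by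
  subst hn
  constructor
  · intro h
    refine ⟨fun i j k => (Datum.brValue_eq _ d.coeff_skew h.br fun h' =>
        (h.support.tri _ _ _).1 h').symm, fun i j hij => (Datum.offValue_eq _ h.off fun h' =>
        (h.support.pair _ _ hij).1 h').symm, fun i => ?_⟩
    by_cases hi : i < q.size
    · exact (d.entry_val ⟨i, hi⟩ ⟨i, hi⟩).trans (h.diag ⟨i, hi⟩)
    · rw [Datum.entry, dif_neg fun h' => hi h'.1, List.getD_eq_default _ _ (by
        rw [hc.length_diag]; omega), Rat.cast_zero]
  · intro h
    refine ⟨fun b hb => ?_, fun a ha => ?_, fun i => ?_, h.isSupport hc⟩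
    · rw [h.br, brValue_of_mem hc.wellFormed.1 hc.wellFormed.2.2 hb]
    · rw [h.off _ _ (hc.pair a.1 (List.mem_map_of_mem ha)).1, offValue_of_mem hc.wellFormed.2.1 ha]
    · rw [← h.diag, Datum.entry_val]

/-- The datum with a consistent profile and a given metric. -/
theorem exists_datum {n : ℕ} (hn : q.size = n) (σ : List ℕ) :
    ∃ d : Datum n, d.Encodes q ∧ ∀ i : Fin n, d.eps i = epsOf σ i := by
  subst hn
  obtain ⟨c, m, h⟩ := q.exists_represents
  have hS := h.isSupport hc
  let L : StructureConstants q.size :=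
    { c := fun i j k => c i j k
      skew := fun i j k => hS.skew _ _ _
      jacobi := fun i j k l => Finset.sum_eq_zero fun h' _ => h.jacobi hc i j k l h' }
  let d : Datum q.size :=
    { L := L
      D := fun i j => m j i
      leibniz := (L.leibniz_iff _).2 fun i j l => by
        have := h.leibniz hc i.2 j.2 l.2
        simpa only [Finset.sum_range] using this
      ε := fun i => if σ.any (Nat.beq i) then -1 else 1 }
  refine ⟨d, (encodes_iff hc rfl).2 ⟨fun i j k => ?_, fun i j hij => ?_, fun i => ?_⟩, fun i => ?_⟩
  · rw [← h.br]
    unfold Datum.coeff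
    split_ifs with hlt
    · rfl
    · congr 1
      by_contra h'
      have := lt_of_hasTri hc ((hS.tri _ _ _).1 (Ne.symm h'))
      omega
  · rw [← h.off i j hij]
    unfold Datum.entry
    split_ifs with hlt
    · rfl
    · congr 1
      by_contra h'
      have := hc.pair _ (hasPair_iff.1 ((hS.pair _ _ hij).1 (Ne.symm h')))
      exact hlt ⟨this.2.1, this.2.2.1⟩
  · rw [← h.diag]
    unfold Datum.entry
    split_ifs with hlt
    · rfl
    · rw [h.diag, List.getD_eq_default _ _ (by rw [hc.length_diag]; omega), Rat.cast_zero]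
  · rw [Datum.eps_val, Datum.sgn]
    change (((if σ.any (Nat.beq i) = true then -1 else 1 : ℤˣ) : ℤ) : ℝ) = _
    unfold epsOf
    cases σ.any (Nat.beq i) <;> simp

end Profile

namespace Datum

variable {q : Profile} (hc : q.Consistent) {n : ℕ} {d : Datum n} (h : d.Encodes q)
include hc h

theorem Encodes.increasing (i j k : Fin n) (hijk : d.L.c i j k ≠ 0) : i < k ∧ j < k := by
  have := Profile.lt_of_hasTri hc ((h.support.tri _ _ _).1 (by rwa [coeff_val]))
  exact ⟨this.1, this.2.1⟩

omit hc in
theorem Encodes.mem_P {i j : Fin n} (hij : i ≠ j) (hD : d.D j i ≠ 0) :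
    ((i : ℕ), (j : ℕ)) ∈ q.P :=
  hasPair_iff.1 ((h.support.pair _ _ fun e => hij (Fin.ext e)).1 (by rwa [entry_val]))

/-- A triple only excludes arrows from i to j. For the tabulated entries the reverse arrows are
absent as well, which the Einstein condition uses. -/
theorem Encodes.no_arrow_rev (i j : Fin n) (hij : i ≠ j) (hD : d.D j i ≠ 0) (k : Fin n) :
    d.L.c j k i = 0 := by
  by_contra hc'
  have h1 := hc.no_arrow _ (h.mem_P hij hD)
  rcases hasTri_iff.1 ((h.support.tri j k i).1 (by rwa [coeff_val])) with ht | ht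
  · exact ((h1 _ ht).2 rfl).1 rfl
  · exact ((h1 _ ht).2 rfl).2 rfl

/-- A datum with a consistent profile and a balanced metric is a solution. -/
theorem Encodes.equations (hn : q.size = n) {σ : List ℕ} (hσ : ∀ i : Fin n, d.eps i = epsOf σ i)
    (hb : q.Balanced σ) : d.NondiagonalEquations := by
  subst hn
  have htrace : d.D.trace = (q.diag.sum : ℚ) := by
    rw [trace_eq_sum, ← sum_map_range]
    have : (List.range q.size).map (fun l => d.entry l l) =
        q.diag.map (Rat.castHom ℝ) := by
      refine List.ext_getElem (by simp [hc.length_diag]) fun i h1 h2 => ?_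
      have hi : i < q.size := by simpa using h1
      have h3 := h.diag ⟨i, hi⟩
      rw [← entry_val, List.getD_eq_getElem _ _ (by simpa using h2)] at h3
      simpa using h3
    rw [this]
    exact (map_list_sum (Rat.castHom ℝ) q.diag).symm
  have htri : ∀ i j k : Fin q.size, d.L.c i j k ≠ 0 → hasTri q.S i j k = true := fun i j k h' =>
    (h.support.tri _ _ _).1 (by rwa [coeff_val])
  refine ⟨?_, ?_, ?_, ?_, ?_, ?_, fun l => ?_, ?_, ?_, ?_, ?_⟩
  · rw [htrace]
    exact_mod_cast hc.trace_ne_zero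
  · obtain ⟨p, hp⟩ := List.exists_mem_of_ne_nil _ hc.nonempty
    obtain ⟨h1, h2, h3, -⟩ := hc.pair p hp
    refine ⟨⟨p.1, h2⟩, ⟨p.2, h3⟩, fun e => h1 (congrArg Fin.val e), ?_⟩
    rw [← entry_val]
    exact (h.support.pair _ _ h1).2 (hasPair_iff.2 hp)
  · intro i j i' j' hij hij' hD hD' hne
    have := hc.disjoint _ (h.mem_P hij hD) _ (h.mem_P hij' hD') fun e => hne (by
      simpa only [Prod.mk.injEq, Fin.val_inj] using e)
    simp only [disjointPairs, Bool.not_eq_true', ← Bool.not_eq_true, Bool.or_eq_true, Nat.beq_eq,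
      Fin.val_inj, not_or] at this
    exact ⟨this.1.1.1, this.1.1.2, this.1.2, this.2⟩
  · intro i j hij hD k
    by_contra hc'
    have h1 := hc.no_arrow _ (h.mem_P hij hD)
    rcases hasTri_iff.1 (htri i k j hc') with ht | ht
    · exact ((h1 _ ht).1 rfl).1 rfl
    · exact ((h1 _ ht).1 rfl).2 rfl
  · intro i j hij hD
    rw [htrace, h.diag, h.diag]
    exact_mod_cast (hc.pair _ (h.mem_P hij hD)).2.2.2
  · intro i j k hijk
    have := h.support.diag i j k (by rwa [coeff_val])
    simpa only [entry_val] using this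
  -- The absolute value of a signed square is the ordinary square, so multiplying it by the signs of
  -- the nodes gives the weight. Real balance thus reduces to the rational one.
  · refine (balance_iff h.support hc.wellFormed l.2).2 ?_
    have h1 := hb l l.2
    have heps : ∀ i < q.size, d.eps i = epsOf σ i := fun i hi => hσ ⟨i, hi⟩
    have e1 : (q.S.map fun t => (rootCoeff l t : ℝ) * d.triWeight t).sum =
        ((q.br.map fun b => rootCoeff l b.1 *
          (epsOf σ b.1.1 * epsOf σ b.1.2.1 * epsOf σ b.1.2.2 * |b.2|)).sum : ℚ) := by
      rw [← Rat.coe_castHom (α := ℝ), map_list_sum, List.map_map, Profile.S, List.map_map]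
      refine congrArg _ (List.map_congr_left fun b hb => ?_)
      have h2 := hc.tri b.1 (List.mem_map_of_mem hb)
      have h3 := hc.wellFormed.2.2 b.1 (List.mem_map_of_mem hb)
      simp only [Function.comp_apply, Rat.coe_castHom, triWeight]
      push_cast
      rw [← h.br b hb, abs_ssq, heps _ (by omega), heps _ (by omega), heps _ (by omega)]
    have e2 : (q.P.map fun p => ((1 - delta l p.1 + delta l p.2 : ℚ) : ℝ) * d.pairWeight p).sum =
        ((q.off.map fun a => (1 - delta l a.1.1 + delta l a.1.2) *
        (epsOf σ a.1.1 * epsOf σ a.1.2 * |a.2|)).sum : ℚ) := by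
      rw [← Rat.coe_castHom (α := ℝ), map_list_sum, List.map_map, Profile.P, List.map_map]
      refine congrArg _ (List.map_congr_left fun a ha => ?_)
      have h2 := hc.pair a.1 (List.mem_map_of_mem ha)
      simp only [Function.comp_apply, Rat.coe_castHom, pairWeight]
      push_cast
      rw [← h.off a ha, abs_ssq, heps _ h2.2.1, heps _ h2.2.2.1]
    rw [e1, e2, htrace, h1, entry_val, h.diag]
    push_cast
    ring
  · intro i j j' k h1 h2
    have hlt := hc.wellFormed.2.2
    have hcomp := hc.compatible
    rcases hasTri_iff.1 (htri _ _ _ h1) with ht | ht <;>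
      rcases hasTri_iff.1 (htri _ _ _ h2) with hu | hu <;> by_contra hne <;>
      have h3 := hcomp _ ht _ hu (fun e => by
        simp only [Prod.mk.injEq, Fin.val_inj] at e
        have h4 := hlt _ ht
        have h5 := hlt _ hu
        simp only [Fin.val_fin_lt] at h4 h5
        grind) <;>
      simp [compatible] at h3
  · intro i j k k' h1 h2
    have hlt := hc.wellFormed.2.2
    have hcomp := hc.compatible
    rcases hasTri_iff.1 (htri _ _ _ h1) with ht | ht <;>
      rcases hasTri_iff.1 (htri _ _ _ h2) with hu | hu <;> by_contra hne <;>
      have h4 := hlt _ ht <;> have h5 := hlt _ hu <;> simp only [Fin.val_fin_lt] at h4 h5 <;>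
      first
      | exact absurd h4 h5.not_gt
      | (have h3 := hcomp _ ht _ hu (fun e => by
          simp only [Prod.mk.injEq, Fin.val_inj] at e
          exact hne e.2.2)
         simp [compatible] at h3)
  · intro i hi
    have key : ∀ a b : Fin q.size, Relation.TransGen (fun a b => ∃ j, d.L.c a j b ≠ 0) a b → a < b := by
      intro a b hab
      induction hab with
      | single h' => exact (h.increasing hc _ _ _ h'.choose_spec).1
      | tail _ h' ih => exact ih.trans (h.increasing hc _ _ _ h'.choose_spec).1
    exact lt_irrefl _ (key i i hi)
  -- The concatenation axiom is vacuous here, as there are no chains with three distinct inputs.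
  · rintro i j k l hij hjk hik ⟨h', h1, h2⟩
    rcases Profile.chain hc (htri _ _ _ h1) (htri _ _ _ h2) with e | e
    · exact absurd (Fin.ext e).symm hik
    · exact absurd (Fin.ext e).symm hjk

end Datum

end NiceNil

/-! ### Comparison of the real tables with their signed squares -/

namespace NiceNil

theorem ssq_neg_mul_sqrt (a b : ℝ) (ha : 0 ≤ a) (hb : 0 ≤ b) : ssq (-(a * √b)) = -(a ^ 2 * b) := by
  rw [ssq_neg, ssq_of_nonneg (mul_nonneg ha (Real.sqrt_nonneg _)), mul_pow, Real.sq_sqrt hb]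

theorem ssq_mul_sqrt (a b : ℝ) (ha : 0 ≤ a) (hb : 0 ≤ b) : ssq (a * √b) = a ^ 2 * b := by
  rw [ssq_of_nonneg (mul_nonneg ha (Real.sqrt_nonneg _)), mul_pow, Real.sq_sqrt hb]

/-- The summand of a structure constant. -/
def bracketTerm (i j k : ℕ) (b : ℕ × ℕ × ℕ × ℝ) : ℝ :=
  if b.2.2.1 = k + 1 then
    (if b.1 = i + 1 ∧ b.2.1 = j + 1 then b.2.2.2 else 0)
      - (if b.1 = j + 1 ∧ b.2.1 = i + 1 then b.2.2.2 else 0)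
  else 0

/-- The summand of an off-diagonal entry. -/
def entryTerm (i j : ℕ) (a : ℕ × ℕ × ℝ) : ℝ := if a.1 = i + 1 ∧ a.2.1 = j + 1 then a.2.2 else 0

/-- A bracket of the table, compared with its signed square. -/
def BracketMatch (b : ℕ × ℕ × ℕ × ℝ) (a : Tri × ℚ) : Prop :=
  b.1 = a.1.1 + 1 ∧ b.2.1 = a.1.2.1 + 1 ∧ b.2.2.1 = a.1.2.2 + 1 ∧ ssq (-b.2.2.2) = a.2

/-- An off-diagonal entry of the table, compared with its signed square. -/
def EntryMatch (b : ℕ × ℕ × ℝ) (a : (ℕ × ℕ) × ℚ) : Prop :=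
  b.1 = a.1.1 + 1 ∧ b.2.1 = a.1.2 + 1 ∧ ssq b.2.2 = a.2

/-- A row of the tables and the row of signed squares that describes it. -/
structure TableRow.Matches (r : TableRow) (q : RatRow) : Prop where
  size : r.size = q.size
  brackets : List.Forall₂ BracketMatch r.brackets q.br
  diagonal : r.diagonal = q.diag.map fun x : ℚ => (x : ℝ)
  offDiagonal : List.Forall₂ EntryMatch r.offDiagonal q.off
  signatures : r.signatures = q.sigs.map fun σ => σ.map (· + 1)

theorem sum_bracketTerm_eq_zero {l : List (ℕ × ℕ × ℕ × ℝ)} {br : List (Tri × ℚ)}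
    (h : List.Forall₂ BracketMatch l br) {i j k : ℕ}
    (ht : hasTri (br.map Prod.fst) i j k = false) : (l.map (bracketTerm i j k)).sum = 0 := by
  induction h with
  | nil => rfl
  | @cons b a l br hb _ ih =>
    obtain ⟨⟨u, v, w⟩, z⟩ := a
    obtain ⟨b1, b2, b3, x⟩ := b
    obtain ⟨rfl, rfl, rfl, -⟩ := hb
    simp only [hasTri, List.map_cons, List.any_cons, Bool.or_eq_false_iff] at ht
    rw [List.map_cons, List.sum_cons, ih ht.2, add_zero]
    have h1 := ht.1
    simp only [← Bool.not_eq_true, Bool.and_eq_true, Bool.or_eq_true, Nat.beq_eq] at h1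
    simp only [bracketTerm, Nat.add_right_cancel_iff]
    split_ifs <;> first | (exfalso; grind) | simp

theorem ssq_sum_bracketTerm {l : List (ℕ × ℕ × ℕ × ℝ)} {br : List (Tri × ℚ)}
    (h : List.Forall₂ BracketMatch l br) (hnd : (br.map Prod.fst).Nodup)
    (hlt : ∀ t ∈ br.map Prod.fst, t.1 < t.2.1) (i j k : ℕ) :
    ssq (-(l.map (bracketTerm i j k)).sum) = brValue br i j k := by
  induction h with
  | nil => simp [brValue, ssq_zero]
  | @cons b a l br hb hl ih =>
    have h0 := hlt a.1 (by simp)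
    rw [List.map_cons, List.nodup_cons] at hnd
    have hlt' : ∀ t ∈ br.map Prod.fst, t.1 < t.2.1 := fun t ht => hlt t (List.mem_cons_of_mem _ ht)
    obtain ⟨⟨u, v, w⟩, z⟩ := a
    obtain ⟨b1, b2, b3, x⟩ := b
    obtain ⟨rfl, rfl, rfl, hx⟩ := hb
    simp only at h0 hx
    -- Keys are distinct and increasing, so no later bracket contributes at the nodes of the first
    -- one, in either order. The sum therefore has at most one nonzero summand, although signed
    -- squares are not additive.
    have hrest : ∀ i j, (i = u ∧ j = v) ∨ (i = v ∧ j = u) → hasTri (br.map Prod.fst) i j w = false := by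
      intro i j hij
      rw [← Bool.not_eq_true, hasTri_iff]
      rintro (h1 | h1)
      · have h2 := hlt' _ h1
        simp only at h2
        rcases hij with ⟨rfl, rfl⟩ | ⟨rfl, rfl⟩
        · exact hnd.1 h1
        · omega
      · have h2 := hlt' _ h1
        simp only at h2
        rcases hij with ⟨rfl, rfl⟩ | ⟨rfl, rfl⟩
        · omega
        · exact hnd.1 h1
    rw [brValue, List.map_cons, List.sum_cons]
    cases e1 : w.beq k && (u.beq i && v.beq j)
    · cases e2 : w.beq k && (u.beq j && v.beq i)
      · simp only [← Bool.not_eq_true, Bool.and_eq_true, Nat.beq_eq] at e1 e2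
        rw [cond_false, cond_false, ← ih hnd.2 hlt']
        have : bracketTerm i j k (u + 1, v + 1, w + 1, x) = 0 := by
          simp only [bracketTerm, Nat.add_right_cancel_iff]
          split_ifs <;> first | (exfalso; grind) | simp
        rw [this, zero_add]
      · simp only [Bool.and_eq_true, Nat.beq_eq] at e2
        obtain ⟨rfl, rfl, rfl⟩ := e2
        rw [sum_bracketTerm_eq_zero hl (hrest _ _ (Or.inr ⟨rfl, rfl⟩)), cond_false, cond_true]
        have : bracketTerm v u w (u + 1, v + 1, w + 1, x) = -x := by
          rw [bracketTerm, if_pos rfl, if_neg (by simp only; omega), if_pos ⟨rfl, rfl⟩, zero_sub]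
        rw [this, add_zero, ssq_neg, hx, Rat.cast_neg]
    · simp only [Bool.and_eq_true, Nat.beq_eq] at e1
      obtain ⟨rfl, rfl, rfl⟩ := e1
      rw [sum_bracketTerm_eq_zero hl (hrest _ _ (Or.inl ⟨rfl, rfl⟩)), cond_true]
      have : bracketTerm u v w (u + 1, v + 1, w + 1, x) = x := by
        rw [bracketTerm, if_pos rfl, if_pos ⟨rfl, rfl⟩, if_neg (by simp only; omega), sub_zero]
      rw [this, add_zero, hx]

theorem sum_entryTerm_eq_zero {l : List (ℕ × ℕ × ℝ)} {off : List ((ℕ × ℕ) × ℚ)}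
    (h : List.Forall₂ EntryMatch l off) {i j : ℕ}
    (ht : (i, j) ∉ off.map Prod.fst) : (l.map (entryTerm i j)).sum = 0 := by
  induction h with
  | nil => rfl
  | @cons b a l off hb _ ih =>
    obtain ⟨⟨u, v⟩, z⟩ := a
    obtain ⟨b1, b2, x⟩ := b
    obtain ⟨rfl, rfl, -⟩ := hb
    rw [List.map_cons, List.mem_cons, not_or] at ht
    rw [List.map_cons, List.sum_cons, ih ht.2, add_zero, entryTerm, if_neg]
    simp only [Nat.add_right_cancel_iff]
    rintro ⟨rfl, rfl⟩
    exact ht.1 rfl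

theorem ssq_sum_entryTerm {l : List (ℕ × ℕ × ℝ)} {off : List ((ℕ × ℕ) × ℚ)}
    (h : List.Forall₂ EntryMatch l off) (hnd : (off.map Prod.fst).Nodup) (i j : ℕ) :
    ssq (l.map (entryTerm i j)).sum = offValue off i j := by
  induction h with
  | nil => simp [offValue, ssq_zero]
  | @cons b a l off hb hl ih =>
    rw [List.map_cons, List.nodup_cons] at hnd
    obtain ⟨⟨u, v⟩, z⟩ := a
    obtain ⟨b1, b2, x⟩ := b
    obtain ⟨rfl, rfl, hx⟩ := hb
    rw [offValue, List.map_cons, List.sum_cons]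
    cases e1 : u.beq i && v.beq j
    · simp only [← Bool.not_eq_true, Bool.and_eq_true, Nat.beq_eq] at e1
      rw [cond_false, ← ih hnd.2, entryTerm, if_neg (by simpa using e1), zero_add]
    · simp only [Bool.and_eq_true, Nat.beq_eq] at e1
      obtain ⟨rfl, rfl⟩ := e1
      rw [sum_entryTerm_eq_zero hl hnd.1, entryTerm, if_pos ⟨rfl, rfl⟩, cond_true, add_zero, hx]

/-- The description by a row of the tables, in terms of the signed squares. -/
theorem describes_iff {t : TableEntry} {q : RatRow} (hm : t.row.Matches q) (hc : q.Consistent)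
    {σ : List ℕ} (hσ : t.timelike = σ.map (· + 1)) {d : Datum t.row.size} :
    t.Describes d ↔ d.Encodes q.toProfile ∧ ∀ i : Fin t.row.size, d.eps i = epsOf σ i := by
  have hirr : ∀ i : ℕ, (i, i) ∉ q.off.map Prod.fst := fun i hi => (hc.pair _ hi).1 rfl
  have hdiag : ∀ i : ℕ, t.row.diagonal.getD i 0 = ((q.diag.getD i 0 : ℚ) : ℝ) := fun i => by
    rw [hm.diagonal, ← List.getD_map _ _ fun x : ℚ => (x : ℝ), Rat.cast_zero]
  have hbr := ssq_sum_bracketTerm hm.brackets hc.wellFormed.1 hc.wellFormed.2.2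
  have hoff := ssq_sum_entryTerm hm.offDiagonal hc.wellFormed.2.1
  have heps : ∀ i : ℕ, (i + 1 ∈ t.timelike) ↔ σ.any (Nat.beq i) = true := fun i => by
    rw [hσ, List.mem_map, List.any_eq_true]
    simp only [Nat.beq_eq, Nat.add_right_cancel_iff, @eq_comm ℕ i]
  have hsize := hm.size.symm
  rw [Profile.encodes_iff hc hsize]
  constructor
  · rintro ⟨h1, h2, h3⟩
    refine ⟨⟨fun i j k => ?_, fun i j hij => ?_, fun i => ?_⟩, fun i => ?_⟩
    · rw [Datum.coeff]
      split_ifs with hlt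
      · rw [h1, ← hbr]; rfl
      · have : hasTri q.S i j k = false := by
          rw [← Bool.not_eq_true]
          intro h'
          have := Profile.lt_of_hasTri hc h'
          omega
        rw [← Bool.not_eq_true, Profile.S, ← brValue_ne_zero_iff hc.br_ne_zero, not_not] at this
        rw [this, ssq_zero, Rat.cast_zero]
    · rw [Datum.entry]
      split_ifs with hlt
      · rw [h2, if_neg (by simpa using hij), zero_add, ← hoff]; rfl
      · have : ¬ hasPair q.P i j = true := by
          rw [hasPair_iff]
          intro h'
          have := hc.pair _ h'
          exact hlt (by rw [← hsize]; exact ⟨this.2.1, this.2.2.1⟩)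
        rw [Profile.P, ← offValue_ne_zero_iff hc.off_ne_zero, not_not] at this
        rw [this, ssq_zero, Rat.cast_zero]
    · rw [Datum.entry]
      split_ifs with hlt
      · rw [h2, if_pos rfl, hdiag]
        simp only [add_eq_left]
        exact sum_entryTerm_eq_zero hm.offDiagonal (hirr i)
      · rw [List.getD_eq_default _ _ (by rw [hc.length_diag]; omega), Rat.cast_zero]
    · rw [Datum.eps_val, Datum.sgn, h3, epsOf]
      have := heps i
      cases h : σ.any (Nat.beq i)
      · rw [if_neg (by rw [this, h]; simp)]; simp
      · rw [if_pos (by rw [this, h])]; simp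
  · rintro ⟨h1, h2⟩
    refine ⟨fun i j k => ?_, fun i j => ?_, fun i => ?_⟩
    · apply ssq_injective
      rw [← Datum.coeff_val, h1.br, ← hbr]; rfl
    · by_cases hij : i = j
      · subst hij
        rw [if_pos rfl, hdiag, ← Datum.entry_val, h1.diag]
        symm
        simp only [add_eq_left]
        exact sum_entryTerm_eq_zero hm.offDiagonal (hirr i)
      · rw [if_neg hij, zero_add]
        apply ssq_injective
        rw [← Datum.entry_val, h1.off _ _ fun e => hij (Fin.ext e), ← hoff]; rfl
    · have h3 := h2 i
      have := heps i
      rw [Datum.eps_val, Datum.sgn, epsOf] at h3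
      refine Units.ext ?_
      cases h : σ.any (Nat.beq i) <;> rw [h] at h3
      · rw [if_neg (by rw [this, h]; simp)]
        simpa using h3
      · rw [if_pos (by rw [this, h])]
        simp only [cond_true] at h3
        rw [Units.val_neg, Units.val_one]
        exact_mod_cast h3

end NiceNil

/-! ### Inequivalence of the entries -/

namespace NiceNil

/-- No permutation and choice of signs matches the profiles. -/
def unmatched (q q' : Profile) : Bool :=
  !(q.size.beq q'.size) || (List.range q.size).permutations'.all fun p => !(diagMatch q q' p) ||
    (signLists q.size).all fun s => !(signMatch q q' p s)

/-- No permutation and choice of signs matches the profile with itself and the two metrics. -/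
def unmatchedMetrics (q : Profile) (σ σ' : List ℕ) : Bool :=
  (List.range q.size).permutations'.all fun p => !(diagMatch q q p) ||
    !((List.range q.size).all fun i => epsOf σ i == epsOf σ' (p.getD i 0)) ||
    (signLists q.size).all fun s => !(signMatch q q p s)

/-- The search must include signs: some rows differ only in the sign of one off-diagonal entry. -/
theorem pairwise_unmatched :
    pairwiseB (fun q q' => unmatched q.toProfile q'.toProfile) ratRows = true := by
  decide +kernel

/-- Metrics on the same row could be exchanged only by a symmetry of its profile; no such symmetry
carries one listed metric to another. -/
theorem pairwise_unmatchedMetrics :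
    (ratRows.all fun q => pairwiseB (unmatchedMetrics q.toProfile) q.sigs) = true := by
  decide +kernel

theorem wellFormed_supports : ∀ q ∈ supports, WellFormed q.2.1 q.2.2 := by
  decide +kernel

/-- The tables list the coefficients of de^k, which are the negatives of the structure constants;
this explains the sign in the comparison of brackets. -/
theorem forall₂_tableRows : List.Forall₂ TableRow.Matches tableRows ratRows := by
  unfold tableRows table34 table5 ratRows
  simp only [List.cons_append, List.nil_append]
  repeat' apply List.Forall₂.cons
  all_goals first
    | exact List.Forall₂.nil
    | refine ⟨rfl, ?_, ?_, ?_, rfl⟩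
  all_goals first
    | (repeat' apply List.Forall₂.cons) <;> first
      | exact List.Forall₂.nil
      | (refine ⟨rfl, rfl, rfl, ?_⟩; first
          | (rw [ssq_neg_mul_sqrt _ _ (by norm_num) (by norm_num)]; norm_num)
          | (rw [ssq_neg, ssq_of_nonneg (by norm_num)]; norm_num))
      | (refine ⟨rfl, rfl, ?_⟩; first
          | (rw [ssq_mul_sqrt _ _ (by norm_num) (by norm_num)]; norm_num; done)
          | (rw [ssq_of_nonneg (by norm_num)]; norm_num; done)
          | (rw [ssq_neg, ssq_of_nonneg (by positivity), Real.sq_sqrt (by norm_num)]; norm_num)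
          | (rw [ssq_of_nonneg (by positivity), Real.sq_sqrt (by norm_num)]; norm_num)
          -- A coefficient such as `-1/6*√10` parses as `(-1)/6*√10`, so the sign is first moved to
          -- the front.
          | (rw [neg_div, neg_mul, ssq_neg_mul_sqrt _ _ (by norm_num) (by norm_num)]; norm_num)
          | (rw [neg_div, ssq_neg, ssq_of_nonneg (by norm_num)]; norm_num))
    | norm_num

namespace Datum

variable {n : ℕ} {d d' : Datum n} {q q' : Profile}

theorem IsSignedPermutation.ne_zero {π : Equiv.Perm (Fin n)} {r : Fin n → ℝ}
    (h : IsSignedPermutation d d' π r) (i : Fin n) : r i ≠ 0 := by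
  rcases h.sign i with h | h <;> simp [h]

/-- An equivalence of encoded data is a matching of the profiles. -/
theorem IsSignedPermutation.exists_match {π : Equiv.Perm (Fin n)} {r : Fin n → ℝ}
    (h : IsSignedPermutation d d' π r) (hq : d.Encodes q) (hq' : d'.Encodes q')
    (hc : q.Consistent) (hn : q.size = n) :
    ∃ p ∈ (List.range n).permutations', (∀ i : Fin n, p.getD i 0 = π i) ∧
      diagMatch q q' p = true ∧ ∃ s ∈ signLists n, signMatch q q' p s = true := by
  subst hn
  obtain ⟨p, hp, hpπ⟩ := exists_mem_permutations π
  obtain ⟨s, hs, hsr⟩ := exists_mem_signLists q.size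
    (fun i => if hi : i < q.size then r ⟨i, hi⟩ else 1) fun i => by
      split_ifs with hi
      · exact h.sign _
      · exact Or.inl rfl
  have hsr' : ∀ i : Fin q.size, ((s.getD i 0 : ℚ) : ℝ) = r i := fun i => by
    rw [hsr i i.2, dif_pos i.2]
  refine ⟨p, hp, hpπ, ?_, s, hs, ?_⟩
  · simp only [diagMatch, List.all_eq_true, List.mem_range, beq_iff_eq]
    intro i hi
    have h1 := h.map ⟨i, hi⟩ ⟨i, hi⟩
    rw [h.mul_self, one_mul, hq.diag, hq'.diag, ← hpπ] at h1
    exact_mod_cast h1.symm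
  · simp only [signMatch, Bool.and_eq_true, List.all_eq_true, List.any_eq_true]
    constructor
    · rintro ⟨⟨u, v, w⟩, z⟩ hb
      have h1 := hq.br _ hb
      have hmem : (u, v, w) ∈ q.S := List.mem_map_of_mem hb
      have h2 : d.coeff u v w ≠ 0 := (hq.support.tri _ _ _).2 (hasTri_iff.2 (Or.inl hmem))
      obtain ⟨hu, hv, hw⟩ := d.lt_of_coeff h2
      simp only at h1
      lift u to Fin q.size using hu
      lift v to Fin q.size using hv
      lift w to Fin q.size using hw
      rw [coeff_val] at h1 h2
      have h3 := h.bracket u v w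
      have h4 : ssq (d'.L.c (π u) (π v) (π w)) =
          ((s.getD u 0 * s.getD v 0 * s.getD w 0 * z : ℚ) : ℝ) := by
        rw [h3, ssq_mul, ssq_mul, ssq_mul, ssq_sign (h.sign _), ssq_sign (h.sign _),
          ssq_sign (h.sign _), h1]
        push_cast
        rw [hsr', hsr', hsr']
      have h5 : d'.L.c (π u) (π v) (π w) ≠ 0 := by
        rw [h3]
        exact mul_ne_zero (mul_ne_zero (mul_ne_zero (h.ne_zero _) (h.ne_zero _)) (h.ne_zero _)) h2
      rw [← coeff_val] at h5
      rcases hasTri_iff.1 ((hq'.support.tri _ _ _).1 h5) with h6 | h6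
      · obtain ⟨b', hb', e⟩ := List.mem_map.1 h6
        obtain ⟨⟨u', v', w'⟩, z'⟩ := b'
        obtain ⟨rfl, rfl, rfl⟩ := by simpa only [Prod.mk.injEq] using e
        refine ⟨_, hb', ?_⟩
        have h7 := hq'.br _ hb'
        simp only [coeff_val] at h7
        rw [h7] at h4
        have h8 : z' = s.getD u 0 * s.getD v 0 * s.getD w 0 * z := by exact_mod_cast h4
        simp only [brMatch, hpπ, Nat.beq_refl, Bool.true_and, Bool.or_eq_true, beq_iff_eq]
        exact Or.inl h8
      · obtain ⟨b', hb', e⟩ := List.mem_map.1 h6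
        obtain ⟨⟨u', v', w'⟩, z'⟩ := b'
        obtain ⟨rfl, rfl, rfl⟩ := by simpa only [Prod.mk.injEq] using e
        refine ⟨_, hb', ?_⟩
        have h7 := hq'.br _ hb'
        simp only [coeff_val] at h7
        rw [d'.L.skew, ssq_neg, h7] at h4
        have h8 : -z' = s.getD u 0 * s.getD v 0 * s.getD w 0 * z := by exact_mod_cast h4
        have h9 : z' = -(s.getD u 0 * s.getD v 0 * s.getD w 0 * z) := by rw [← h8, neg_neg]
        simp only [brMatch, hpπ, Nat.beq_refl, Bool.true_and, Bool.or_eq_true, beq_iff_eq,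
          Bool.and_eq_true]
        right
        linarith
    · rintro ⟨⟨u, v⟩, z⟩ hb
      have h1 := hq.off _ hb
      have hmem : (u, v) ∈ q.P := List.mem_map_of_mem hb
      obtain ⟨huv, hu, hv, -⟩ := hc.pair _ hmem
      have h2 : d.entry u v ≠ 0 := (hq.support.pair _ _ huv).2 (hasPair_iff.2 hmem)
      simp only at h1 huv hu hv
      lift u to Fin q.size using hu
      lift v to Fin q.size using hv
      rw [entry_val] at h1 h2
      have h3 := h.map u v
      have h4 : ssq (d'.D (π v) (π u)) = ((s.getD u 0 * s.getD v 0 * z : ℚ) : ℝ) := by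
        rw [h3, ssq_mul, ssq_mul, ssq_sign (h.sign _), ssq_sign (h.sign _), h1]
        push_cast
        rw [hsr', hsr']
      have h5 : d'.D (π v) (π u) ≠ 0 := by
        rw [h3]
        exact mul_ne_zero (mul_ne_zero (h.ne_zero _) (h.ne_zero _)) h2
      have hne : ((π u : Fin _) : ℕ) ≠ π v := fun e => huv (congrArg Fin.val (π.injective (Fin.ext e)))
      rw [← entry_val] at h5
      obtain ⟨b', hb', e⟩ := List.mem_map.1 (hasPair_iff.1 ((hq'.support.pair _ _ hne).1 h5))
      obtain ⟨⟨u', v'⟩, z'⟩ := b'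
      obtain ⟨rfl, rfl⟩ := by simpa only [Prod.mk.injEq] using e
      refine ⟨_, hb', ?_⟩
      have h7 := hq'.off _ hb'
      simp only [entry_val] at h7
      rw [h7] at h4
      have h8 : z' = s.getD u 0 * s.getD v 0 * z := by exact_mod_cast h4
      simp only [offMatch, pairMatch, hpπ, Nat.beq_refl, Bool.true_and, beq_iff_eq]
      exact h8

end Datum

end NiceNil

/-! ### Completion of the classification -/

namespace NiceNil

namespace Datum

theorem not_equivalent_of_unmatched {n m : ℕ} {d : Datum n} {d' : Datum m} {q q' : Profile}
    (hq : d.Encodes q) (hq' : d'.Encodes q') (hc : q.Consistent) (hn : q.size = n)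
    (hm : q'.size = m) (h : unmatched q q' = true) : ¬ d.Equivalent d' := by
  intro he
  obtain rfl := he.size_eq
  obtain ⟨π, r, hπ⟩ := he.exists_signedPermutation
  obtain ⟨p, hp, -, hd, s, hs, hsm⟩ := hπ.exists_match hq hq' hc hn
  rw [← hn] at hp hs
  simp only [unmatched, Bool.or_eq_true, Bool.not_eq_true', List.all_eq_true] at h
  rcases h with h | h
  · rw [← Bool.not_eq_true, Nat.beq_eq] at h
    exact h (hn.trans hm.symm)
  · rcases h p hp with h | h
    · rw [hd] at h; cases h
    · rw [h s hs] at hsm; cases hsm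

theorem not_equivalent_of_unmatchedMetrics {n m : ℕ} {d : Datum n} {d' : Datum m} {q : Profile}
    (hq : d.Encodes q) (hq' : d'.Encodes q) (hc : q.Consistent) (hn : q.size = n)
    {σ σ' : List ℕ} (hσ : ∀ i : Fin n, d.eps i = epsOf σ i)
    (hσ' : ∀ i : Fin m, d'.eps i = epsOf σ' i) (h : unmatchedMetrics q σ σ' = true) :
    ¬ d.Equivalent d' := by
  intro he
  obtain rfl := he.size_eq
  obtain ⟨π, r, hπ⟩ := he.exists_signedPermutation
  obtain ⟨p, hp, hpπ, hd, s, hs, hsm⟩ := hπ.exists_match hq hq' hc hn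
  subst hn
  simp only [unmatchedMetrics, Bool.or_eq_true, Bool.not_eq_true', List.all_eq_true] at h
  rcases h p hp with (h | h) | h
  · rw [hd] at h; cases h
  · rw [← Bool.not_eq_true, List.all_eq_true] at h
    refine h fun i hi => ?_
    rw [List.mem_range] at hi
    have h1 := hσ ⟨i, hi⟩
    have h2 := hσ' (π ⟨i, hi⟩)
    rw [eps_val, sgn, hπ.eps, ← sgn, ← eps_val, h1, ← hpπ] at h2
    rw [beq_iff_eq]
    exact_mod_cast h2
  · rw [h s hs] at hsm; cases hsm

end Datum

/-- An off-diagonal entry needs two nodes, so with n ≤ 5 and n ≠ 2 only the sizes 3, 4 and 5 are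
left. -/
theorem two_le_of_equations {n : ℕ} {d : Datum n} (H : d.NondiagonalEquations) : 2 ≤ n := by
  obtain ⟨i, j, hij, -⟩ := H.exists_off
  have h1 := i.2
  have h2 := j.2
  have h3 : (i : ℕ) ≠ j := fun e => hij (Fin.ext e)
  omega

/-- The combinatorial half of the classification: all increasing nice diagrams with all sets of
pairs are enumerated, and those passing the one-term test are compared with the list up to
permutation of nodes. -/
theorem classified_supports : ∀ n ∈ [3, 4, 5], classified supports n = true := by
  set_option maxRecDepth 100000 in
  decide +kernel

/-- The algebraic half. An obstructed support matches no row, so it passes only because the computed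
trace or a weight vanishes, or no signs of the brackets, off-diagonal entries and metric are
compatible. -/
theorem completeRow_supports :
    (supports.all fun q => completeRow ratRows q.1 q.2.1 q.2.2) = true := by
  set_option maxRecDepth 100000 in
  decide +kernel

/-- A solution is moved to a listed support, where elimination determines its profile up to signs.
The matched row and metric then characterize it up to equivalence, independently of the datum chosen
to realize them. -/
theorem exists_ratRow {n : ℕ} (hn : n ≤ 5) (hn2 : n ≠ 2) {d : Datum n} (H : d.NondiagonalEquations) :
    ∃ q ∈ ratRows, q.size = n ∧ ∃ σ ∈ q.sigs, ∀ d' : Datum n, d'.Encodes q.toProfile →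
      (∀ i : Fin n, d'.eps i = epsOf σ i) → d.Equivalent d' := by
  have h2 := two_le_of_equations H
  obtain ⟨d₁, he, H₁, q₀, hq₀, rfl, hS⟩ := Datum.exists_listed_support H hn
    (classified_supports n (by simp only [List.mem_cons, List.not_mem_nil, or_false]; omega))
  obtain ⟨q', hq', hsize, σ, hσ, q, hqn, hq, p, hp, s, hs, h1, h2, h3, h4⟩ :=
    Datum.completeRow_sound H₁ hS (wellFormed_supports q₀ hq₀)
      (List.all_eq_true.1 completeRow_supports q₀ hq₀)
  obtain ⟨π, hπ⟩ := exists_perm_of_mem hp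
  refine ⟨q', hq', hsize, σ, hσ, fun d' hd' hε => he.trans ?_⟩
  refine hq.equivalent hd' hqn hp hs h1 h2 h3 fun i => ?_
  rw [← h4, hπ, hε]

namespace TableEntry

theorem length_eq : tableRows.length = ratRows.length := forall₂_tableRows.length_eq

theorem matches_ratRows (t : TableEntry) : t.row.Matches (ratRows.get (t.1.cast length_eq)) :=
  (List.forall₂_iff_get.1 forall₂_tableRows).2 _ _ _

theorem lt_length_sigs (t : TableEntry) :
    (t.2 : ℕ) < (ratRows.get (t.1.cast length_eq)).sigs.length := by
  have h := congrArg List.length t.matches_ratRows.signatures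
  rw [List.length_map] at h
  rw [← h]
  exact t.2.2

/-- The row of signed squares of an entry. -/
def ratRow (t : TableEntry) : RatRow := ratRows.get (t.1.cast length_eq)

/-- The timelike nodes of an entry, numbered from zero. -/
def nodes (t : TableEntry) : List ℕ := t.ratRow.sigs.get ⟨t.2, t.lt_length_sigs⟩

theorem timelike_eq (t : TableEntry) : t.timelike = t.nodes.map (· + 1) := by
  have h := t.matches_ratRows.signatures
  have h1 : t.timelike = t.row.signatures[(t.2 : ℕ)]'(t.2.2) := rfl
  rw [h1]
  simp only [h, List.getElem_map]
  rfl

theorem ratRow_mem (t : TableEntry) : t.ratRow ∈ ratRows := List.get_mem _ _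

theorem nodes_mem (t : TableEntry) : t.nodes ∈ t.ratRow.sigs := List.get_mem _ _

theorem consistent (t : TableEntry) : t.ratRow.Consistent := consistent_ratRows _ t.ratRow_mem

theorem describes_iff_encodes (t : TableEntry) {d : Datum t.row.size} :
    t.Describes d ↔ d.Encodes t.ratRow.toProfile ∧ ∀ i : Fin t.row.size, d.eps i = epsOf t.nodes i :=
  describes_iff t.matches_ratRows t.consistent t.timelike_eq

theorem exists_eq {q : RatRow} (hq : q ∈ ratRows) {σ : List ℕ} (hσ : σ ∈ q.sigs) :
    ∃ t : TableEntry, t.ratRow = q ∧ t.nodes = σ := by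
  obtain ⟨i, rfl⟩ := List.get_of_mem hq
  obtain ⟨j, rfl⟩ := List.get_of_mem hσ
  have hi : ((i.cast length_eq.symm).cast length_eq) = i := rfl
  have hm : (tableRows.get (i.cast length_eq.symm)).Matches (ratRows.get i) :=
    (List.forall₂_iff_get.1 forall₂_tableRows).2 _ _ _
  have hj : (j : ℕ) < (tableRows.get (i.cast length_eq.symm)).signatures.length := by
    rw [hm.signatures, List.length_map]
    exact j.2
  exact ⟨⟨i.cast length_eq.symm, ⟨j, hj⟩⟩, rfl, rfl⟩

theorem exists_describes (t : TableEntry) : ∃ d : Datum t.row.size, t.Describes d := by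
  obtain ⟨d, h1, h2⟩ := Profile.exists_datum t.consistent t.matches_ratRows.size.symm t.nodes
  exact ⟨d, t.describes_iff_encodes.2 ⟨h1, h2⟩⟩

theorem Describes.equations {t : TableEntry} {d : Datum t.row.size} (h : t.Describes d) :
    d.NondiagonalEquations := by
  obtain ⟨h1, h2⟩ := t.describes_iff_encodes.1 h
  exact h1.equations t.consistent t.matches_ratRows.size.symm h2
    (balanced_ratRows _ t.ratRow_mem _ t.nodes_mem)

/-- Distinct entries of the tables are inequivalent. -/
theorem eq_of_equivalent {t t' : TableEntry} {d : Datum t.row.size} {d' : Datum t'.row.size}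
    (h : t.Describes d) (h' : t'.Describes d') (he : d.Equivalent d') : t = t' := by
  have key : ∀ {t t' : TableEntry} {d : Datum t.row.size} {d' : Datum t'.row.size},
      t.Describes d → t'.Describes d' → d.Equivalent d' → ¬ t.1 < t'.1 := by
    intro t t' d d' h h' he hlt
    exact Datum.not_equivalent_of_unmatched (t.describes_iff_encodes.1 h).1
      (t'.describes_iff_encodes.1 h').1 t.consistent t.matches_ratRows.size.symm
      t'.matches_ratRows.size.symm
      (List.pairwise_iff_get.1 ((Datum.pairwiseB_iff _ _).1 pairwise_unmatched) (t.1.cast length_eq)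
        (t'.1.cast length_eq) hlt) he
  -- Inequivalence is checked only for earlier rows against later ones; symmetry of equivalence
  -- covers the other order.
  have hrow : t.1 = t'.1 := le_antisymm (not_lt.1 (key h' h he.symm)) (not_lt.1 (key h h' he))
  obtain ⟨r, s⟩ := t
  obtain ⟨r', s'⟩ := t'
  obtain rfl : r = r' := hrow
  have key' : ∀ {s s' : Fin (tableRows.get r).signatures.length}
      {d : Datum (TableEntry.row ⟨r, s⟩).size} {d' : Datum (TableEntry.row ⟨r, s'⟩).size},
      TableEntry.Describes ⟨r, s⟩ d → TableEntry.Describes ⟨r, s'⟩ d' → d.Equivalent d' →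
        ¬ s < s' := by
    intro s s' d d' h h' he hlt
    obtain ⟨h1, h2⟩ := (TableEntry.describes_iff_encodes ⟨r, s⟩).1 h
    obtain ⟨h1', h2'⟩ := (TableEntry.describes_iff_encodes ⟨r, s'⟩).1 h'
    exact Datum.not_equivalent_of_unmatchedMetrics h1 h1' (TableEntry.consistent ⟨r, s⟩)
      (TableEntry.matches_ratRows ⟨r, s⟩).size.symm h2 h2'
      (List.pairwise_iff_get.1 ((Datum.pairwiseB_iff _ _).1 (List.all_eq_true.1 pairwise_unmatchedMetrics _
        (TableEntry.ratRow_mem ⟨r, s⟩))) ⟨s, TableEntry.lt_length_sigs ⟨r, s⟩⟩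
        ⟨s', TableEntry.lt_length_sigs ⟨r, s'⟩⟩ hlt) he
  rw [le_antisymm (not_lt.1 (key' h' h he.symm)) (not_lt.1 (key' h h' he))]

end TableEntry

end NiceNil

end

open NiceNil in
theorem mainTheorem1 :
    (∀ n : ℕ, n ≤ 5 → n ≠ 2 → ∀ d : Datum n, d.IsNondiagonalSolution →
      ∃! t : TableEntry, ∃ d' : Datum t.row.size, TableEntry.Describes t d' ∧ d.Equivalent d') ∧
    (∀ t : TableEntry, ∃ d : Datum t.row.size, TableEntry.Describes t d ∧
      d.IsNondiagonalSolution ∧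
      IsMetric d.metric ∧
      SolvesGeneralizedNilsoliton d.metric (d.derivation : d.Alg →ₗ[ℝ] d.Alg) ∧
      Module.finrank ℝ d.Ext = t.row.size + 1 ∧
      LieAlgebra.IsSolvable d.Ext ∧
      IsMetric d.extMetric ∧
      IsEinstein d.extMetric ∧
      IsStandardDecomposition d.extMetric d.nilIdeal d.line ∧
      ¬ ∃ (N : LieIdeal ℝ d.Ext) (A : LieSubalgebra ℝ d.Ext),
        IsPseudoIwasawa d.extMetric N A) := by
  constructor
  · intro n hn hn2 d hd
    obtain ⟨q, hq, hsize, σ, hσ, h⟩ := exists_ratRow hn hn2 hd.equations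
    obtain ⟨t, rfl, rfl⟩ := TableEntry.exists_eq hq hσ
    obtain rfl : t.row.size = n := t.matches_ratRows.size.trans hsize
    obtain ⟨d', hd'⟩ := t.exists_describes
    have hd'' := t.describes_iff_encodes.1 hd'
    have he := h d' hd''.1 hd''.2
    refine ⟨t, ⟨d', hd', he⟩, ?_⟩
    rintro t' ⟨d₂, hd₂, he₂⟩
    -- Two entries equivalent to the same solution are equivalent to each other, hence equal.
    exact TableEntry.eq_of_equivalent hd₂ hd' (he₂.symm.trans he)
  · intro t
    obtain ⟨d, hd⟩ := t.exists_describes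
    have H := hd.equations
    have hq := (t.describes_iff_encodes.1 hd).1
    have hinc := hq.increasing t.consistent
    exact ⟨d, hd, H.isNondiagonalSolution, d.isMetric, H.solvesGeneralizedNilsoliton, d.finrank_ext,
      d.isSolvable_ext hinc, d.isMetric_ext, H.isEinstein (hq.no_arrow_rev t.consistent),
      d.isStandardDecomposition hinc, H.not_isPseudoIwasawa⟩
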